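/- Let $q\ge 1$ and $p=\frac{\sqrt q}{1+\sqrt q}$. For a finite subgraph $G=(V,E)$ of $\mathbb Z^2$ and a partition $\xi$ of its boundary (the vertices of $G$ incident to an edge outside $G$), let $\phi^\xi_{G}$ be the FK-percolation measure on sets of open edges $\omega\subseteq E$, with $$\phi^\xi_{G}[\omega]=\frac1{Z^\xi_G}\,p^{|\omega|}(1-p)^{|E\setminus\omega|}q^{k(\omega^\xi)},$$ where $k(\omega^\xi)$ is the number of connected components of $(V,\omega)$ once the vertices in each class of $\xi$ are considered connected, and $Z^\xi_G$ is the normalising constant. For an integer $N\ge1$ let $\mathrm{Strip}_N=\mathbb Z\times[-N,N]$, and let $\phi^{1/0}_{\mathrm{Strip}_N}$ be the limit, as $M\to\infty$, of the measures $\phi^{\xi_M}_{[-M,M]\times[-N,N]}$, where $\xi_M$ wires all vertices of the top side together, is free on the bottom side (each vertex of the bottom side is alone in its class), and is arbitrary on the lateral sides. The limit is in the sense of convergence of the probability of every event that depends on finitely many edges; it exists and does not depend on the lateral boundary conditions. **Theorem.** For every $q\ge1$ there exists $c=c(q)>0$ such that, for every real $\rho\ge1$ and all integers $N\ge n\ge1$,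 $$\phi^{1/0}_{\mathrm{Strip}_N}\big[\,[-\rho n,\rho n]\times[-n,n]\text{ is crossed horizontally by an open path of }\omega\,\big]\ \ge\ c^{\rho},$$ and $$\phi^{1/0}_{\mathrm{Strip}_N}\big[\,[-\rho n,\rho n]\times[-n,n]\text{ is crossed horizontally by an open path of }\omega^*\,\big]\ \ge\ c^{\rho}.$$ Here $\omega^*$ is the dual configuration on $(\mathbb Z^2)^*=\mathbb Z^2+(\frac12,\frac12)$, in which a dual edge is open if and only if the edge of $\mathrm{Strip}_N$ that it crosses is closed. A path crosses $[-a,a]\times[-b,b]$ horizontally if all its vertices have second coordinate in $[-b,b]$ and first coordinate in $(-a-1,a+1)$, it starts at a vertex with first coordinate at most $-a$, and it ends at a vertex with first coordinate at least $a$. -/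

import Mathlib

open Filter Topology MeasureTheory

noncomputable section

namespace FKStrip

/-- The square lattice `ℤ²`, with edges between points at Euclidean distance one. -/
def lattice : SimpleGraph (ℤ × ℤ) where
  Adj u v := |u.1 - v.1| + |u.2 - v.2| = 1
  symm := ⟨fun u v h => by rw [abs_sub_comm v.1, abs_sub_comm v.2]; exact h⟩
  loopless := ⟨fun u h => by simp at h⟩

/-- A percolation configuration, identified with its set of open edges. It carries the
product sigma-algebra. -/
abbrev Config : Type := Set (Sym2 (ℤ × ℤ))

open Classical in
/-- The edges of the subgraph of `ℤ²` induced by a finite set of vertices. -/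
def edgesIn (V : Finset (ℤ × ℤ)) : Finset (Sym2 (ℤ × ℤ)) :=
  V.sym2.filter (fun e => e ∈ lattice.edgeSet)

/-- The boundary of the induced subgraph: its vertices incident to an edge outside of it. -/
def boundary (V : Finset (ℤ × ℤ)) : Set (ℤ × ℤ) :=
  {v | v ∈ V ∧ ∃ w, lattice.Adj v w ∧ w ∉ V}

/-- `ξ` is a boundary condition on the subgraph induced by `V`: a partition of the boundary,
extended by singletons to all other points. Equivalent vertices are wired together. -/
def IsBoundaryCondition (V : Finset (ℤ × ℤ)) (ξ : Setoid (ℤ × ℤ)) : Prop :=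
  ∀ u v, ξ u v → u ≠ v → u ∈ boundary V ∧ v ∈ boundary V

/-- `k(ω^ξ)`: the number of connected components of the graph with vertex set `V` and edge set
`ω`, where vertices wired together by `ξ` are considered connected. -/
def numClusters (V : Finset (ℤ × ℤ)) (ξ : Setoid (ℤ × ℤ)) (ω : Config) : ℕ :=
  Nat.card (SimpleGraph.fromRel
    (fun u v : V => s((u : ℤ × ℤ), (v : ℤ × ℤ)) ∈ ω ∨ ξ u v)).ConnectedComponent

/-- The weight `p^|ω| (1-p)^|E∖ω| q^k(ω^ξ)` of a configuration. -/
def fkWeight (V : Finset (ℤ × ℤ)) (p q : ℝ) (ξ : Setoid (ℤ × ℤ))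
    (ω : Finset (Sym2 (ℤ × ℤ))) : ℝ :=
  p ^ ω.card * (1 - p) ^ ((edgesIn V).card - ω.card) * q ^ numClusters V ξ (ω : Config)

/-- The partition function. -/
def fkPartition (V : Finset (ℤ × ℤ)) (p q : ℝ) (ξ : Setoid (ℤ × ℤ)) : ℝ :=
  ∑ ω ∈ (edgesIn V).powerset, fkWeight V p q ξ ω

/-- The FK-percolation measure `φ^ξ_{V,p,q}` on subsets of the edge set of the subgraph of `ℤ²`
induced by `V`. -/
def fkMeasure (V : Finset (ℤ × ℤ)) (p q : ℝ) (ξ : Setoid (ℤ × ℤ)) : Measure Config :=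
  ∑ ω ∈ (edgesIn V).powerset,
    ENNReal.ofReal (fkWeight V p q ξ ω / fkPartition V p q ξ) • Measure.dirac (ω : Config)

/-- The self-dual (critical) parameter `√q / (1 + √q)`. -/
def pSd (q : ℝ) : ℝ := Real.sqrt q / (1 + Real.sqrt q)

/-- The vertices of the rectangle `[-M,M] × [-N,N]`. -/
def rect (M N : ℕ) : Finset (ℤ × ℤ) :=
  Finset.Icc (-(M : ℤ)) M ×ˢ Finset.Icc (-(N : ℤ)) N

/-- Boundary conditions on `[-M,M] × [-N,N]` that are wired on the top side and free on the
bottom side. They are arbitrary on the lateral sides. -/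
structure IsTopWiredBottomFree (M N : ℕ) (ξ : Setoid (ℤ × ℤ)) : Prop where
  isBoundaryCondition : IsBoundaryCondition (rect M N) ξ
  top_wired : ∀ u ∈ rect M N, ∀ v ∈ rect M N, u.2 = N → v.2 = N → ξ u v
  bottom_free : ∀ u ∈ rect M N, u.2 = -N → ∀ v, ξ u v → u = v

/-- The event `A` depends on the states of finitely many edges only. -/
def IsLocal (A : Set Config) : Prop :=
  ∃ F : Finset (Sym2 (ℤ × ℤ)), ∀ ω ω' : Config,
    (∀ e ∈ F, e ∈ ω ↔ e ∈ ω') → (ω ∈ A ↔ ω' ∈ A)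

/-- `φ` is the measure `φ^{1/0}` on the strip `ℤ × [-N,N]`: the limit, as `M → ∞`, of the
measures on `[-M,M] × [-N,N]` with wired top and free bottom, whatever the boundary conditions
on the lateral sides. The convergence is that of the probabilities of all local events,
which determines `φ`. -/
structure IsStripMeasure (N : ℕ) (p q : ℝ) (φ : Measure Config) : Prop where
  isProbabilityMeasure : IsProbabilityMeasure φ
  tendsto : ∀ ξ : ℕ → Setoid (ℤ × ℤ), (∀ M, IsTopWiredBottomFree M N (ξ M)) →
    ∀ A : Set Config, IsLocal A →
      Tendsto (fun M => (fkMeasure (rect M N) p q (ξ M)).real A) atTop (𝓝 (φ.real A))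

/-- The edges of the strip `ℤ × [-N,N]`. -/
def stripEdges (N : ℕ) : Set (Sym2 (ℤ × ℤ)) :=
  {e | e ∈ lattice.edgeSet ∧ ∀ v ∈ e, |v.2| ≤ (N : ℤ)}

/-- The dual configuration `ω*` of a configuration `ω` on a graph with edge set `E`: a dual edge
is open if and only if the edge of `E` that it crosses is closed. The vertex
`(x + 1/2, y + 1/2)` of the dual lattice is encoded by `(x, y)`. Thus the horizontal edge
`{(x,y), (x+1,y)}` is crossed by the dual edge with code `{(x,y-1), (x,y)}`, and the
vertical edge `{(x,y), (x,y+1)}` by the dual edge with code `{(x-1,y), (x,y)}`. -/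
def dualConfig (E : Set (Sym2 (ℤ × ℤ))) (ω : Config) : Config :=
  {f | ∃ x y : ℤ,
    (f = s((x, y - 1), (x, y)) ∧ s((x, y), (x + 1, y)) ∈ E \ ω) ∨
    (f = s((x - 1, y), (x, y)) ∧ s((x, y), (x, y + 1)) ∈ E \ ω)}

/-- The rectangle `[-a,a] × [-b,b]` is crossed horizontally by `η`, a configuration on the lattice
`ℤ² + (δ,δ)`, whose vertex `(x+δ, y+δ)` is encoded by `(x,y)`: there is an open path of height
at most `b` in absolute value, from a vertex on or just beyond the left side to a vertex on or just
beyond the right side. When `δ = 0` and `a`, `b` are integers, this is an open path in the rectangle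
from its left side to its right side. -/
def CrossedHorizontally (δ a b : ℝ) (η : Config) : Prop :=
  ∃ u v : {w : ℤ × ℤ | |(w.1 : ℝ) + δ| < a + 1 ∧ |(w.2 : ℝ) + δ| ≤ b},
    (u.1.1 : ℝ) + δ ≤ -a ∧ a ≤ (v.1.1 : ℝ) + δ ∧
    ((SimpleGraph.fromEdgeSet η).induce _).Reachable u v

end FKStrip

end

/-!
Write `x = √q`. Up to a factor that depends only on the rectangle, the weight of a configuration at
the self-dual point is `x ^ (|ω| + 2 k)`, which is invariant under planar duality. All statements
about the measures are derived from this form of the weight, in which opening an edge multiplies the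
weight by `x` or by `1 / x`, according to whether the ends of the edge are already connected.

*Limit and duality.* A Doeblin argument (`exists_limit`) shows that the probability of a local event
converges, uniformly in the lateral boundary conditions; the limit is `strip`. The composition of
duality with a vertical reflection exchanges wired top and free bottom, so it preserves `strip`
(`strip_dual`). Hence a dual crossing is as likely as a primal one, and with `v L` and `h L` the
probabilities of a vertical and of a horizontal crossing of `[0, L] × [-n, n - 1]`, one has
`1 ≤ v (L - 1) + h L` (`one_le_strip_add`).

*The crossing principle.* Let a domain have two boundary arcs `Q₁` and `Q₂`, each of them wired by
open edges, such that duality composed with an isometry maps the domain to a larger one, and the two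
arcs to the complementary ones up to inclusion. Then the two arcs are connected with probability at
least `1 / (1 + q)`, whatever the boundary conditions elsewhere (`Cut.wsum_le`). Indeed, either they
are connected in `ω` or their images are connected in the dual of `ω`, and the latter event is
compared to the former one by domination, the factor `q` being the cost of wiring `Q₁` to `Q₂`. The
planar topology is expressed by the intersection number of cuts modulo two
(`Cut.conn_or_dual_conn`), so that the arcs may be arbitrary sets found by exploring the extremal
crossings of rectangles (`IsExploration`, `pr_le_of_explorations`). As the boundary conditions are
irrelevant, so is the position of the rectangle in the strip.

The principle is applied twice. Two narrow rectangles on the sides of a square are crossed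
vertically: the symmetry with respect to a diagonal shows that they are connected to each other, so
that a likely vertical crossing of a narrow rectangle yields a horizontal crossing
(`pr_VCross_mul_le`). The topmost horizontal crossing of `[0, L] × [c, d]` and the rightmost vertical
crossing of a translate that starts below it are connected to each other, by the symmetry with
respect to a vertical line, which extends the horizontal crossing from `[0, L]` to about
`[0, 3 L / 2]` (`pr_extend`).

*Conclusion.* If `v (n / 4)` is at least `1 / 2`, the former application provides a horizontal
crossing of a rectangle of width about `3 n / 2`, and its translates are glued with vertical crossings
of width `n / 4`. Otherwise let `L` be the least width with `v L ≥ 1 / 2`. By duality `h L ≥ 1 / 2`,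
the latter application provides a crossing of width about `3 L / 2`, and its translates are glued
with vertical crossings of width `L`. If there is no such `L`, then `h` is at least `1 / 2` at all
widths. In each case `h` decays at most exponentially at the scale `n`
(`CrossingBounds.exists_building_block`, `CrossingBounds.pow_le`).
-/

noncomputable section

open scoped Classical

namespace FKStrip

/-! ### Edges of the square lattice, chains with coefficients in `ZMod 2` -/

/-- Edges of the square lattice: `(false, x, y)` is the horizontal edge from `(x, y)` to
`(x + 1, y)`, and `(true, x, y)` the vertical edge from `(x, y)` to `(x, y + 1)`. -/
abbrev Edge : Type := Bool × ℤ × ℤ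

/-- The horizontal edge from `(x, y)` to `(x + 1, y)`. -/
abbrev eH (x y : ℤ) : Edge := (false, x, y)

/-- The vertical edge from `(x, y)` to `(x, y + 1)`. -/
abbrev eV (x y : ℤ) : Edge := (true, x, y)

/-- The lower or left end of an edge. -/
def src (e : Edge) : ℤ × ℤ := e.2

/-- The upper or right end of an edge. -/
def tgt : Edge → ℤ × ℤ
  | (false, x, y) => (x + 1, y)
  | (true, x, y) => (x, y + 1)

@[simp] lemma src_eH (x y : ℤ) : src (false, x, y) = (x, y) := rfl
@[simp] lemma src_eV (x y : ℤ) : src (true, x, y) = (x, y) := rfl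
@[simp] lemma tgt_eH (x y : ℤ) : tgt (false, x, y) = (x + 1, y) := rfl
@[simp] lemma tgt_eV (x y : ℤ) : tgt (true, x, y) = (x, y + 1) := rfl

lemma src_ne_tgt (e : Edge) : src e ≠ tgt e := by
  rcases e with ⟨_ | _, x, y⟩ <;> simp

/-- The edges incident to a vertex. -/
def star (v : ℤ × ℤ) : Finset Edge :=
  {eH v.1 v.2, eH (v.1 - 1) v.2, eV v.1 v.2, eV v.1 (v.2 - 1)}

lemma mem_star {e : Edge} {v : ℤ × ℤ} : e ∈ star v ↔ src e = v ∨ tgt e = v := by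
  rcases e with ⟨_ | _, x, y⟩ <;> rcases v with ⟨a, b⟩ <;> simp [star, src, tgt] <;> omega

lemma sum_star {M : Type*} [AddCommMonoid M] (f : Edge → M) (x y : ℤ) :
    ∑ e ∈ star (x, y), f e = f (eH x y) + f (eH (x - 1) y) + f (eV x y) + f (eV x (y - 1)) := by
  unfold star
  rw [Finset.sum_insert, Finset.sum_insert, Finset.sum_insert, Finset.sum_singleton]
  · abel
  all_goals simp; try omega

/-- The coboundary of a `ZMod 2`-valued function on vertices. -/
def cob (C : ℤ × ℤ → ZMod 2) (e : Edge) : ZMod 2 := C (src e) + C (tgt e)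

/-- The indicator function of a set, with values in `ZMod 2`. -/
def ind (K : Set (ℤ × ℤ)) (v : ℤ × ℤ) : ZMod 2 := if v ∈ K then 1 else 0

lemma cob_ind_eq_zero {K : Set (ℤ × ℤ)} {e : Edge} :
    cob (ind K) e = 0 ↔ (src e ∈ K ↔ tgt e ∈ K) := by
  unfold cob ind
  split_ifs with h1 h2 h2 <;> simp [h1, h2, CharTwo.add_self_eq_zero]

lemma cob_ind_eq_one {K : Set (ℤ × ℤ)} {e : Edge} (h : ¬ (src e ∈ K ↔ tgt e ∈ K)) :
    cob (ind K) e = 1 := by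
  unfold cob ind
  split_ifs with h1 h2 h2 <;> simp_all

lemma zmod_two_cases (a : ZMod 2) : a = 0 ∨ a = 1 := by
  revert a; decide

/-! ### Open clusters and their number -/

/-- The equivalence relation generated by wiring `a` to `b`. -/
def link (a b : ℤ × ℤ) : Setoid (ℤ × ℤ) := Relation.EqvGen.setoid fun u v => u = a ∧ v = b

/-- The partition in which the points of `Q` form one class and the others are alone. -/
def wire (Q : Set (ℤ × ℤ)) : Setoid (ℤ × ℤ) where
  r u v := u = v ∨ (u ∈ Q ∧ v ∈ Q)
  iseqv := ⟨fun _ => Or.inl rfl, by rintro u v (h | h); exacts [Or.inl h.symm, Or.inr h.symm], by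
    rintro u v w (rfl | h) (rfl | h')
    exacts [Or.inl rfl, Or.inr h', Or.inr h, Or.inr ⟨h.1, h'.2⟩]⟩

lemma wire_iff {Q : Set (ℤ × ℤ)} {u v : ℤ × ℤ} : wire Q u v ↔ u = v ∨ (u ∈ Q ∧ v ∈ Q) := Iff.rfl

lemma wire_le {Q : Set (ℤ × ℤ)} {s : Setoid (ℤ × ℤ)} (h : ∀ u ∈ Q, ∀ v ∈ Q, s u v) :
    wire Q ≤ s := by
  rintro u v (rfl | ⟨h1, h2⟩)
  exacts [s.refl _, h _ h1 _ h2]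

/-- The partition into clusters, when the classes of `r` and the ends of each edge of `ω` are
connected. -/
def conn (r : Setoid (ℤ × ℤ)) (ω : Set Edge) : Setoid (ℤ × ℤ) :=
  r ⊔ Relation.EqvGen.setoid fun u v => ∃ e ∈ ω, src e = u ∧ tgt e = v

lemma eqvGen_le {R : ℤ × ℤ → ℤ × ℤ → Prop} {s : Setoid (ℤ × ℤ)} (h : ∀ u v, R u v → s u v) :
    Relation.EqvGen.setoid R ≤ s := Setoid.eqvGen_le h

lemma link_le {a b : ℤ × ℤ} {s : Setoid (ℤ × ℤ)} : link a b ≤ s ↔ s a b :=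
  ⟨fun h => h (Relation.EqvGen.rel _ _ ⟨rfl, rfl⟩), fun h =>
    eqvGen_le (by rintro u v ⟨rfl, rfl⟩; exact h)⟩

lemma conn_le {r s : Setoid (ℤ × ℤ)} {ω : Set Edge} :
    conn r ω ≤ s ↔ r ≤ s ∧ ∀ e ∈ ω, s (src e) (tgt e) := by
  refine ⟨fun h => ⟨le_sup_left.trans h, fun e he => h (le_sup_right (a := r)
    (Relation.EqvGen.rel _ _ ⟨e, he, rfl, rfl⟩))⟩, fun h => sup_le h.1 (eqvGen_le ?_)⟩
  rintro u v ⟨e, he, rfl, rfl⟩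
  exact h.2 e he

lemma le_conn (r : Setoid (ℤ × ℤ)) (ω : Set Edge) : r ≤ conn r ω := (conn_le.1 le_rfl).1

lemma conn_edge {r : Setoid (ℤ × ℤ)} {ω : Set Edge} {e : Edge} (he : e ∈ ω) :
    conn r ω (src e) (tgt e) := (conn_le.1 le_rfl).2 e he

lemma conn_mono {r s : Setoid (ℤ × ℤ)} {ω η : Set Edge} (h : r ≤ s) (h' : ω ⊆ η) :
    conn r ω ≤ conn s η :=
  conn_le.2 ⟨h.trans (le_conn _ _), fun _ he => conn_edge (h' he)⟩

lemma conn_conn (r : Setoid (ℤ × ℤ)) (ω η : Set Edge) : conn (conn r ω) η = conn r (ω ∪ η) := by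
  apply le_antisymm
  · exact conn_le.2 ⟨conn_mono le_rfl Set.subset_union_left, fun e he => conn_edge (Or.inr he)⟩
  · refine conn_le.2 ⟨(le_conn _ _).trans (le_conn _ _), fun e he => ?_⟩
    rcases he with he | he
    exacts [le_conn _ _ (conn_edge he), conn_edge he]

lemma conn_insert (r : Setoid (ℤ × ℤ)) (ω : Set Edge) (e : Edge) :
    conn r (insert e ω) = conn r ω ⊔ link (src e) (tgt e) := by
  apply le_antisymm
  · refine conn_le.2 ⟨(le_conn _ _).trans le_sup_left, fun e' he => ?_⟩
    rcases he with rfl | he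
    exacts [link_le.1 le_sup_right, (le_sup_left : _ ≤ _ ⊔ link (src e) (tgt e)) (conn_edge he)]
  · exact sup_le (conn_mono le_rfl (Set.subset_insert _ _))
      (link_le.2 (conn_edge (Set.mem_insert _ _)))

lemma conn_sup (r s : Setoid (ℤ × ℤ)) (ω : Set Edge) : conn (r ⊔ s) ω = conn r ω ⊔ s := by
  unfold conn; rw [sup_assoc, sup_assoc, sup_comm s]

lemma setoid_mem_iff {K : Set (ℤ × ℤ)} {s : Setoid (ℤ × ℤ)}
    (h : s ≤ Setoid.ker fun v => v ∈ K) {u v : ℤ × ℤ} (huv : s u v) : u ∈ K ↔ v ∈ K :=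
  iff_of_eq (h huv)

lemma wire_le_ker {Q K : Set (ℤ × ℤ)} (h : Q ⊆ K ∨ Disjoint Q K) :
    wire Q ≤ Setoid.ker fun v => v ∈ K := by
  refine wire_le fun u hu v hv => ?_
  rw [Setoid.ker_def, eq_iff_iff]
  rcases h with h | h
  · exact iff_of_true (h hu) (h hv)
  · exact iff_of_false (h.notMem_of_mem_left hu) (h.notMem_of_mem_left hv)

/-- A set that is a union of classes of `r` and is not left by an edge of `ω` is a union of
clusters. -/
lemma conn_mem_iff {r : Setoid (ℤ × ℤ)} {ω : Set Edge} {K : Set (ℤ × ℤ)}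
    (hr : r ≤ Setoid.ker fun v => v ∈ K) (hω : ∀ e ∈ ω, (src e ∈ K ↔ tgt e ∈ K)) {u v : ℤ × ℤ}
    (h : conn r ω u v) : u ∈ K ↔ v ∈ K :=
  setoid_mem_iff (conn_le.2 ⟨hr, fun e he => propext (hω e he)⟩) h

lemma conn_bot_mem_iff {ω : Set Edge} {K : Set (ℤ × ℤ)}
    (hω : ∀ e ∈ ω, (src e ∈ K ↔ tgt e ∈ K)) {u v : ℤ × ℤ} (h : conn ⊥ ω u v) : u ∈ K ↔ v ∈ K :=
  conn_mem_iff bot_le hω h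

/-- The number of classes of `s` that meet `V`. -/
def ncl (V : Finset (ℤ × ℤ)) (s : Setoid (ℤ × ℤ)) : ℕ := (V.image (Quotient.mk s)).card

lemma sup_link_of_rel {s : Setoid (ℤ × ℤ)} {a b : ℤ × ℤ} (h : s a b) : s ⊔ link a b = s :=
  sup_eq_left.2 (link_le.2 h)

lemma ncl_sup_link {V : Finset (ℤ × ℤ)} {s : Setoid (ℤ × ℤ)} {a b : ℤ × ℤ} (ha : a ∈ V)
    (hb : b ∈ V) (h : ¬ s a b) : ncl V (s ⊔ link a b) + 1 = ncl V s := by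
  set s' := s ⊔ link a b with hs'
  have hle : s ≤ s' := le_sup_left
  let g : Quotient s → Quotient s := fun c => if c = Quotient.mk s b then Quotient.mk s a else c
  have hker : s' ≤ Setoid.ker fun v => g (Quotient.mk s v) := by
    refine sup_le (fun u v huv => ?_) (link_le.2 ?_)
    · rw [Setoid.ker_def, (Quotient.eq (r := s)).2 huv]
    · rw [Setoid.ker_def]; simp [g]
  let f : Quotient s → Quotient s' := Quotient.map id fun _ _ h => hle h
  have himg : V.image (Quotient.mk s') = ((V.image (Quotient.mk s)).erase (Quotient.mk s b)).image f := by
    ext c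
    simp only [Finset.mem_image, Finset.mem_erase]
    constructor
    · rintro ⟨v, hv, rfl⟩
      by_cases hvb : Quotient.mk s v = Quotient.mk s b
      · refine ⟨Quotient.mk s a, ⟨fun h' => h ((Quotient.eq (r := s)).1 h'), a, ha, rfl⟩, ?_⟩
        have h1 : s' v b := hle ((Quotient.eq (r := s)).1 hvb)
        have h2 : s' a b := link_le.1 (le_sup_right)
        exact (Quotient.eq (r := s')).2 (s'.trans h2 (s'.symm h1))
      · exact ⟨_, ⟨hvb, v, hv, rfl⟩, rfl⟩
    · rintro ⟨_, ⟨_, v, hv, rfl⟩, rfl⟩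
      exact ⟨v, hv, rfl⟩
  have hinj : Set.InjOn f ((V.image (Quotient.mk s)).erase (Quotient.mk s b)) := by
    intro c hc c' hc' hcc
    simp only [Finset.coe_erase, Set.mem_sdiff, Set.mem_singleton_iff] at hc hc'
    induction c using Quotient.ind with | _ u => ?_
    induction c' using Quotient.ind with | _ v => ?_
    have h1 : g (Quotient.mk s u) = g (Quotient.mk s v) := hker ((Quotient.eq (r := s')).1 hcc)
    simpa [g, hc.2, hc'.2] using h1
  unfold ncl
  rw [himg, Finset.card_image_of_injOn hinj, Finset.card_erase_add_one]
  exact Finset.mem_image_of_mem _ hb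

/-! ### Weights of configurations -/

/-- The weight of a configuration at the self-dual point, up to a constant, in terms of
`x = √q`. -/
def wt (V : Finset (ℤ × ℤ)) (r : Setoid (ℤ × ℤ)) (x : ℝ) (ω : Finset Edge) : ℝ :=
  x ^ (ω.card + 2 * ncl V (conn r ω))

/-- All ends of edges of `S` belong to `V`. -/
def EndsIn (V : Finset (ℤ × ℤ)) (S : Finset Edge) : Prop := ∀ e ∈ S, src e ∈ V ∧ tgt e ∈ V

lemma EndsIn.mono {V : Finset (ℤ × ℤ)} {S T : Finset Edge} (h : EndsIn V T) (hS : S ⊆ T) :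
    EndsIn V S := fun e he => h e (hS he)

lemma wt_pos (V : Finset (ℤ × ℤ)) (r : Setoid (ℤ × ℤ)) {x : ℝ} (hx : 1 ≤ x) (ω : Finset Edge) :
    0 < wt V r x ω := by unfold wt; positivity

lemma wt_insert_of_conn {V : Finset (ℤ × ℤ)} {r : Setoid (ℤ × ℤ)} (x : ℝ) {ω : Finset Edge}
    {e : Edge} (he : e ∉ ω) (h : conn r ω (src e) (tgt e)) :
    wt V r x (insert e ω) = x * wt V r x ω := by
  unfold wt
  rw [Finset.coe_insert, conn_insert, sup_link_of_rel h, Finset.card_insert_of_notMem he]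
  ring

lemma wt_insert_of_not_conn {V : Finset (ℤ × ℤ)} {r : Setoid (ℤ × ℤ)} (x : ℝ)
    {ω : Finset Edge} {e : Edge} (hs : src e ∈ V) (ht : tgt e ∈ V) (he : e ∉ ω)
    (h : ¬ conn r ω (src e) (tgt e)) : x * wt V r x (insert e ω) = wt V r x ω := by
  unfold wt
  rw [Finset.coe_insert, conn_insert, Finset.card_insert_of_notMem he, ← ncl_sup_link hs ht h]
  ring

lemma wt_le_mul_wt_insert {V : Finset (ℤ × ℤ)} {r : Setoid (ℤ × ℤ)} {x : ℝ} (hx : 1 ≤ x)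
    {ω : Finset Edge} {e : Edge} (hs : src e ∈ V) (ht : tgt e ∈ V) (he : e ∉ ω) :
    wt V r x ω ≤ x * wt V r x (insert e ω) := by
  by_cases h : conn r ω (src e) (tgt e)
  · rw [wt_insert_of_conn x he h]
    have := wt_pos V r hx ω
    nlinarith [mul_le_mul_of_nonneg_right hx this.le]
  · rw [wt_insert_of_not_conn x hs ht he h]

lemma wt_insert_le {V : Finset (ℤ × ℤ)} {r : Setoid (ℤ × ℤ)} {x : ℝ} (hx : 1 ≤ x)
    {ω : Finset Edge} {e : Edge} (hs : src e ∈ V) (ht : tgt e ∈ V) (he : e ∉ ω) :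
    wt V r x (insert e ω) ≤ x * wt V r x ω := by
  by_cases h : conn r ω (src e) (tgt e)
  · rw [wt_insert_of_conn x he h]
  · rw [← wt_insert_of_not_conn x hs ht he h]
    have := wt_pos V r hx (insert e ω)
    nlinarith [mul_le_mul_of_nonneg_right hx this.le, mul_le_mul_of_nonneg_left hx this.le]

lemma wt_union (V : Finset (ℤ × ℤ)) (r : Setoid (ℤ × ℤ)) (x : ℝ) {η ψ : Finset Edge}
    (h : Disjoint η ψ) : wt V r x (η ∪ ψ) = x ^ η.card * wt V (conn r η) x ψ := by
  unfold wt
  rw [conn_conn, Finset.card_union_of_disjoint h, ← pow_add, Finset.coe_union, add_assoc]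

/-! ### Stochastic domination and positive association -/

/-- A local comparison of ratios of weights implies a global one. -/
lemma mul_le_of_local {S₀ S : Finset Edge} {w₁ w₂ : Finset Edge → ℝ}
    (h₂ : ∀ ω, 0 < w₂ ω) (hS : S₀ ⊆ S)
    (h : ∀ ω₁ ⊆ S₀, ∀ ω₂ ⊆ S, ω₁ ⊆ ω₂ → ∀ e ∈ S₀, e ∉ ω₂ →
      w₁ (insert e ω₁) * w₂ ω₂ ≤ w₁ ω₁ * w₂ (insert e ω₂))
    {s t : Finset Edge} (hs : s ⊆ S₀) (ht : t ⊆ S) :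
    w₁ s * w₂ t ≤ w₁ (s ∩ t) * w₂ (s ∪ t) := by
  have key : ∀ D : Finset Edge, D ⊆ S₀ → Disjoint D t →
      w₁ ((s ∩ t) ∪ D) * w₂ t ≤ w₁ (s ∩ t) * w₂ (t ∪ D) := by
    intro D
    induction D using Finset.induction_on with
    | empty => intro _ _; simp
    | insert e D he ih =>
      intro hD hdis
      rw [Finset.insert_subset_iff] at hD
      rw [Finset.disjoint_insert_left] at hdis
      have IH := ih hD.2 hdis.2
      have hst : s ∩ t ∪ D ⊆ S₀ := Finset.union_subset (Finset.inter_subset_left.trans hs) hD.2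
      have loc := h (s ∩ t ∪ D) hst (t ∪ D) (Finset.union_subset ht (hD.2.trans hS))
        (Finset.union_subset_union_left Finset.inter_subset_right) e hD.1
        (by simp [hdis.1, he])
      rw [Finset.union_insert, Finset.union_insert]
      have hp := h₂ (t ∪ D)
      refine le_of_mul_le_mul_right ?_ hp
      calc w₁ (insert e (s ∩ t ∪ D)) * w₂ t * w₂ (t ∪ D)
          = w₁ (insert e (s ∩ t ∪ D)) * w₂ (t ∪ D) * w₂ t := by ring
        _ ≤ w₁ (s ∩ t ∪ D) * w₂ (insert e (t ∪ D)) * w₂ t :=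
            mul_le_mul_of_nonneg_right loc (h₂ _).le
        _ = w₁ (s ∩ t ∪ D) * w₂ t * w₂ (insert e (t ∪ D)) := by ring
        _ ≤ w₁ (s ∩ t) * w₂ (t ∪ D) * w₂ (insert e (t ∪ D)) :=
            mul_le_mul_of_nonneg_right IH (h₂ _).le
        _ = w₁ (s ∩ t) * w₂ (insert e (t ∪ D)) * w₂ (t ∪ D) := by ring
  have := key (s \ t) (Finset.sdiff_subset.trans hs) Finset.sdiff_disjoint
  rwa [show s ∩ t ∪ s \ t = s by grind, show t ∪ s \ t = s ∪ t by grind] at this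

/-- The total weight of the subsets of `S` that belong to `A`. -/
def wsum (S : Finset Edge) (w : Finset Edge → ℝ) (A : Set (Set Edge)) : ℝ :=
  ∑ ω ∈ S.powerset, if (ω : Set Edge) ∈ A then w ω else 0

lemma sum_le_sum_of_sup {S : Finset Edge} {f : Finset Edge → ℝ} (hf : ∀ ω, 0 ≤ f ω)
    {𝒞 : Finset (Finset Edge)} (h : 𝒞 ⊆ S.powerset) :
    ∑ ω ∈ 𝒞, f ω ≤ ∑ ω ∈ S.powerset, f ω :=
  Finset.sum_le_sum_of_subset_of_nonneg h fun _ _ _ => hf _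

open scoped FinsetFamily in
/-- Holley's criterion: stochastic domination follows from a comparison of the cost of opening
an edge. The dominated measure may live on fewer edges. -/
theorem holley_of_local {S₀ S : Finset Edge} {w₁ w₂ : Finset Edge → ℝ}
    (h₁ : ∀ ω, 0 ≤ w₁ ω) (h₂ : ∀ ω, 0 < w₂ ω) (hS : S₀ ⊆ S)
    (h : ∀ ω₁ ⊆ S₀, ∀ ω₂ ⊆ S, ω₁ ⊆ ω₂ → ∀ e ∈ S₀, e ∉ ω₂ →
      w₁ (insert e ω₁) * w₂ ω₂ ≤ w₁ ω₁ * w₂ (insert e ω₂))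
    {A : Set (Set Edge)} (hA : IsUpperSet A) :
    wsum S₀ w₁ A * wsum S w₂ Set.univ ≤ wsum S₀ w₁ Set.univ * wsum S w₂ A := by
  let g₁ : Finset Edge → ℝ := fun ω => if (ω : Set Edge) ∈ A then w₁ ω else 0
  let g₂ : Finset Edge → ℝ := fun ω => if (ω : Set Edge) ∈ A then w₂ ω else 0
  have hg₁ : ∀ ω, 0 ≤ g₁ ω := fun ω => by simp only [g₁]; split_ifs <;> simp [h₁]
  have hg₂ : ∀ ω, 0 ≤ g₂ ω := fun ω => by simp only [g₂]; split_ifs <;> simp [(h₂ _).le]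
  -- the four functions theorem needs the inequality for all subsets of `S`
  let k : (Finset Edge → ℝ) → Finset Edge → ℝ := fun f ω => if ω ⊆ S₀ then f ω else 0
  have hk : ∀ f : Finset Edge → ℝ, (∀ ω, 0 ≤ f ω) → ∀ ω, 0 ≤ k f ω := fun f hf ω => by
    simp only [k]; split_ifs <;> simp [hf]
  have main := Finset.four_functions_theorem S (f₁ := k g₁) (f₂ := w₂) (f₃ := k w₁) (f₄ := g₂)
    (fun ω => hk _ hg₁ ω) (fun ω => (h₂ ω).le) (fun ω => hk _ h₁ ω) (fun ω => hg₂ ω)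
    (by
      intro s hs t ht
      by_cases hs0 : s ⊆ S₀
      · have hst : s ∩ t ⊆ S₀ := Finset.inter_subset_left.trans hs0
        simp only [k, hs0, hst, if_true, g₁, g₂]
        by_cases hsA : (s : Set Edge) ∈ A
        · have : ((s ∪ t : Finset Edge) : Set Edge) ∈ A := hA (by simp) hsA
          rw [if_pos hsA, if_pos this]
          exact mul_le_of_local h₂ hS h hs0 ht
        · rw [if_neg hsA, zero_mul]
          exact mul_nonneg (h₁ _) (hg₂ _)
      · simp only [k, hs0, if_false, zero_mul]
        exact mul_nonneg (hk _ h₁ _) (hg₂ _))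
    (𝒜 := S₀.powerset) (ℬ := S.powerset) (Finset.powerset_mono.2 hS) subset_rfl
  have e1 : ∑ s ∈ S₀.powerset, k g₁ s = wsum S₀ w₁ A := by
    refine Finset.sum_congr rfl fun s hs => ?_
    simp [k, Finset.mem_powerset.1 hs, g₁]
  have e2 : ∑ s ∈ S.powerset, w₂ s = wsum S w₂ Set.univ := by simp [wsum]
  have e3 : ∑ s ∈ S₀.powerset ⊼ S.powerset, k w₁ s ≤ wsum S₀ w₁ Set.univ := by
    have : ∑ s ∈ S₀.powerset, k w₁ s = wsum S₀ w₁ Set.univ := by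
      refine Finset.sum_congr rfl fun s hs => ?_
      simp [k, Finset.mem_powerset.1 hs]
    rw [← this]
    refine sum_le_sum_of_sup (hk _ h₁) fun s hs => ?_
    obtain ⟨a, ha, b, hb, rfl⟩ := Finset.mem_infs.1 hs
    exact Finset.mem_powerset.2 (Finset.inter_subset_left.trans (Finset.mem_powerset.1 ha))
  have e4 : ∑ s ∈ S₀.powerset ⊻ S.powerset, g₂ s ≤ wsum S w₂ A := by
    refine sum_le_sum_of_sup hg₂ fun s hs => ?_
    obtain ⟨a, ha, b, hb, rfl⟩ := Finset.mem_sups.1 hs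
    exact Finset.mem_powerset.2 (Finset.union_subset ((Finset.mem_powerset.1 ha).trans hS)
      (Finset.mem_powerset.1 hb))
  rw [e1, e2] at main
  exact main.trans (mul_le_mul e3 e4 (Finset.sum_nonneg fun _ _ => hg₂ _)
    (Finset.sum_nonneg fun ω _ => by split_ifs <;> simp [h₁]))

open scoped FinsetFamily in
/-- The FKG inequality for a weight that satisfies the lattice condition locally. -/
theorem fkg_of_local {S : Finset Edge} {w : Finset Edge → ℝ} (hw : ∀ ω, 0 < w ω)
    (h : ∀ ω₁ ⊆ S, ∀ ω₂ ⊆ S, ω₁ ⊆ ω₂ → ∀ e ∈ S, e ∉ ω₂ →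
      w (insert e ω₁) * w ω₂ ≤ w ω₁ * w (insert e ω₂))
    {A B : Set (Set Edge)} (hA : IsUpperSet A) (hB : IsUpperSet B) :
    wsum S w A * wsum S w B ≤ wsum S w Set.univ * wsum S w (A ∩ B) := by
  let g : Set (Set Edge) → Finset Edge → ℝ := fun A ω => if (ω : Set Edge) ∈ A then w ω else 0
  have hg : ∀ A ω, 0 ≤ g A ω := fun A ω => by simp only [g]; split_ifs <;> simp [(hw _).le]
  have main := Finset.four_functions_theorem S (f₁ := g A) (f₂ := g B) (f₃ := w)
    (f₄ := g (A ∩ B)) (hg A) (hg B) (fun ω => (hw ω).le) (hg _)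
    (by
      intro s hs t ht
      have h4 := mul_le_of_local hw subset_rfl h hs ht
      have h5 := mul_nonneg (hw (s ∩ t)).le (hg (A ∩ B) (s ∪ t))
      by_cases hsA : (s : Set Edge) ∈ A
      · by_cases htB : (t : Set Edge) ∈ B
        · have : ((s ∪ t : Finset Edge) : Set Edge) ∈ A ∩ B :=
            ⟨hA (by simp) hsA, hB (by simp) htB⟩
          simpa only [g, if_pos hsA, if_pos htB, if_pos this] using h4
        · simpa only [g, if_neg htB, mul_zero] using h5
      · simpa only [g, if_neg hsA, zero_mul] using h5)
    (𝒜 := S.powerset) (ℬ := S.powerset) subset_rfl subset_rfl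
  refine main.trans (mul_le_mul ?_ ?_ (Finset.sum_nonneg fun _ _ => hg _ _) ?_)
  · have : wsum S w Set.univ = ∑ ω ∈ S.powerset, w ω := by simp [wsum]
    rw [this]
    refine sum_le_sum_of_sup (fun ω => (hw ω).le) fun s hs => ?_
    obtain ⟨a, ha, b, hb, rfl⟩ := Finset.mem_infs.1 hs
    exact Finset.mem_powerset.2 (Finset.inter_subset_left.trans (Finset.mem_powerset.1 ha))
  · refine sum_le_sum_of_sup (hg _) fun s hs => ?_
    obtain ⟨a, ha, b, hb, rfl⟩ := Finset.mem_sups.1 hs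
    exact Finset.mem_powerset.2 (Finset.union_subset (Finset.mem_powerset.1 ha)
      (Finset.mem_powerset.1 hb))
  · exact Finset.sum_nonneg fun ω _ => by split_ifs <;> simp [(hw _).le]

/-- Monotonicity in the boundary condition of the cost of opening an edge. -/
lemma wt_local {V : Finset (ℤ × ℤ)} {r s : Setoid (ℤ × ℤ)} (hrs : r ≤ s) {x : ℝ} (hx : 1 ≤ x)
    {ω₁ ω₂ : Finset Edge} (h : ω₁ ⊆ ω₂) {e : Edge} (hs : src e ∈ V) (ht : tgt e ∈ V)
    (he : e ∉ ω₂) :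
    wt V r x (insert e ω₁) * wt V s x ω₂ ≤ wt V r x ω₁ * wt V s x (insert e ω₂) := by
  have he₁ : e ∉ ω₁ := fun h' => he (h h')
  have p1 := wt_pos V r hx ω₁
  have p2 := wt_pos V r hx (insert e ω₁)
  have p3 := wt_pos V s hx ω₂
  by_cases hc : conn s ω₂ (src e) (tgt e)
  · rw [wt_insert_of_conn x he hc]
    have := mul_le_mul_of_nonneg_right (wt_insert_le (r := r) hx hs ht he₁) p3.le
    linarith
  · have hc' : ¬ conn r ω₁ (src e) (tgt e) := fun h' =>
      hc (conn_mono hrs (Finset.coe_subset.2 h) h')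
    rw [← wt_insert_of_not_conn x hs ht he hc, ← wt_insert_of_not_conn x hs ht he₁ hc']
    apply le_of_eq; ring

/-! ### Dual maps of the edge set and the crossing principle -/

/-- A bijection of the edge set of the lattice that behaves like the composition of planar duality
with an isometry: it maps the edges around a vertex to the edges around a face, and so does its
inverse. Only the orthogonality of stars and images of cuts is recorded. -/
structure DualMap where
  /-- The bijection of the edges. -/
  t : Edge ≃ Edge
  par : ∀ (C : ℤ × ℤ → ZMod 2) (v : ℤ × ℤ), ∑ e ∈ star v, cob C (t e) = 0
  par_symm : ∀ (C : ℤ × ℤ → ZMod 2) (v : ℤ × ℤ), ∑ e ∈ star v, cob C (t.symm e) = 0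

lemma ind_union {K L : Set (ℤ × ℤ)} (h : Disjoint K L) : ind (K ∪ L) = ind K + ind L := by
  ext v
  have := fun h1 : v ∈ K => h.notMem_of_mem_left h1
  simp only [ind, Pi.add_apply, Set.mem_union]
  split_ifs <;> simp_all

lemma ind_symmDiff (K A : Set (ℤ × ℤ)) : ind K = ind A + ind (symmDiff K A) := by
  ext v
  simp only [ind, Pi.add_apply, Set.mem_symmDiff]
  by_cases h1 : v ∈ K <;> by_cases h2 : v ∈ A <;> simp [h1, h2, CharTwo.add_self_eq_zero]

lemma cob_add (C C' : ℤ × ℤ → ZMod 2) (e : Edge) : cob (C + C') e = cob C e + cob C' e := by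
  simp only [cob, Pi.add_apply]; ring

lemma cob_ind_support {K : Set (ℤ × ℤ)} (hK : K.Finite) :
    (Function.support (cob (ind K))).Finite := by
  refine (hK.biUnion fun v _ => (star v).finite_toSet).subset fun e he => ?_
  simp only [Set.mem_iUnion, Finset.mem_coe, mem_star]
  rw [Function.mem_support, Ne, cob_ind_eq_zero] at he
  by_cases h : src e ∈ K
  exacts [⟨_, h, Or.inl rfl⟩, ⟨tgt e, by tauto, Or.inr rfl⟩]

/-- A finite cut is orthogonal to every chain with even degrees. -/
lemma finsum_cob_ind_mul {K : Set (ℤ × ℤ)} (hK : K.Finite) {g : Edge → ZMod 2}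
    (hg : ∀ v, ∑ e ∈ star v, g e = 0) : ∑ᶠ e, cob (ind K) e * g e = 0 := by
  induction K, hK using Set.Finite.induction_on with
  | empty => simp [ind, cob]
  | @insert v K hv hK ih =>
    have h1 : ind (insert v K) = ind {v} + ind K := by
      rw [Set.insert_eq, ind_union (Set.disjoint_singleton_left.2 hv)]
    have h2 : ∀ e, cob (ind (insert v K)) e * g e
        = cob (ind {v}) e * g e + cob (ind K) e * g e := by
      intro e; rw [h1, cob_add, add_mul]
    have hs : ∀ L : Set (ℤ × ℤ), L.Finite →
        (Function.support fun e => cob (ind L) e * g e).Finite := fun L hL =>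
      (cob_ind_support hL).subset (Function.support_mul_subset_left _ _)
    rw [finsum_congr h2, finsum_add_distrib (hs _ (Set.finite_singleton v)) (hs _ hK), ih,
      add_zero, finsum_eq_sum_of_support_subset (s := star v), ← hg v]
    · refine Finset.sum_congr rfl fun e he => ?_
      rw [cob_ind_eq_one, one_mul]
      have := src_ne_tgt e
      rw [mem_star] at he
      simp only [Set.mem_singleton_iff]
      grind
    · intro e he
      rw [Finset.mem_coe, mem_star]
      have h3 : cob (ind {v}) e ≠ 0 := left_ne_zero_of_mul he
      rw [Ne, cob_ind_eq_zero] at h3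
      simp only [Set.mem_singleton_iff] at h3
      tauto

/-- The intersection number of two cuts, the second one being transported by a dual map, does not
change when the two sets change by finitely many points. -/
lemma finsum_cob_congr (D : DualMap) {K A X B : Set (ℤ × ℤ)} (hK : (symmDiff K A).Finite)
    (hX : (symmDiff X B).Finite)
    (hs : (Function.support fun e => cob (ind A) e * cob (ind B) (D.t e)).Finite) :
    ∑ᶠ e, cob (ind K) e * cob (ind X) (D.t e) = ∑ᶠ e, cob (ind A) e * cob (ind B) (D.t e) := by
  have hs2 : (Function.support fun e =>
      cob (ind A) e * cob (ind (symmDiff X B)) (D.t e)).Finite :=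
    (((cob_ind_support hX).preimage D.t.injective.injOn).subset fun e he => by
      exact right_ne_zero_of_mul he)
  have e2 : ∑ᶠ e, cob (ind A) e * cob (ind (symmDiff X B)) (D.t e) = 0 := by
    rw [← finsum_comp_equiv D.t.symm, ← finsum_cob_ind_mul hX (D.par_symm (ind A))]
    exact finsum_congr fun e => by rw [Equiv.apply_symm_apply, mul_comm]
  have hX' : ∀ e, cob (ind A) e * cob (ind X) (D.t e) = cob (ind A) e * cob (ind B) (D.t e)
      + cob (ind A) e * cob (ind (symmDiff X B)) (D.t e) := fun e => by
    rw [ind_symmDiff X B, cob_add, mul_add]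
  have hs3 : (Function.support fun e => cob (ind A) e * cob (ind X) (D.t e)).Finite := by
    refine (hs.union hs2).subset fun e he => ?_
    by_contra h
    simp only [Set.mem_union, Function.mem_support, not_or, not_not] at h
    exact he ((hX' e).trans (by rw [h.1, h.2, add_zero]))
  have hK' : ∀ e, cob (ind K) e * cob (ind X) (D.t e) = cob (ind A) e * cob (ind X) (D.t e)
      + cob (ind (symmDiff K A)) e * cob (ind X) (D.t e) := fun e => by
    rw [ind_symmDiff K A, cob_add, add_mul]
  have hs4 : (Function.support fun e =>
      cob (ind (symmDiff K A)) e * cob (ind X) (D.t e)).Finite :=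
    (cob_ind_support hK).subset (Function.support_mul_subset_left _ _)
  rw [finsum_congr hK', finsum_add_distrib hs3 hs4,
    finsum_cob_ind_mul hK (D.par (ind X)), add_zero, finsum_congr hX',
    finsum_add_distrib hs hs2, e2, add_zero]

/-- The edge `e` lies neither inside `W₁` nor inside `W₂`. -/
def Free (W₁ W₂ : Set (ℤ × ℤ)) (e : Edge) : Prop :=
  ¬ (src e ∈ W₁ ∧ tgt e ∈ W₁) ∧ ¬ (src e ∈ W₂ ∧ tgt e ∈ W₂)

/-- A domain with two boundary parts `W₁` and `W₂`, together with a dual map. Only the parts `Q₁`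
and `Q₂` of the boundary are seen by the edges `S₀` that are free and whose dual edge is free. -/
structure Cut (D : DualMap) (W₁ W₂ Q₁ Q₂ : Set (ℤ × ℤ)) (S₀ : Finset Edge) : Prop where
  disj : Disjoint W₁ W₂
  fin : (W₁ ∪ W₂)ᶜ.Finite
  mem_iff : ∀ e, e ∈ S₀ ↔ Free W₁ W₂ e ∧ Free W₁ W₂ (D.t e)
  ends₁ : ∀ e ∈ S₀, ∀ f, (f = e ∨ f = D.t e) → ∀ v, (v = src f ∨ v = tgt f) → v ∈ W₁ → v ∈ Q₁
  ends₂ : ∀ e ∈ S₀, ∀ f, (f = e ∨ f = D.t e) → ∀ v, (v = src f ∨ v = tgt f) → v ∈ W₂ → v ∈ Q₂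

namespace Cut
variable {D : DualMap} {W₁ W₂ Q₁ Q₂ : Set (ℤ × ℤ)} {S₀ : Finset Edge}

lemma cob_eq_zero {W₁ W₂ K : Set (ℤ × ℤ)} {e : Edge} (h1 : W₁ ⊆ K ∨ Disjoint W₁ K)
    (h2 : W₂ ⊆ K ∨ Disjoint W₂ K) (he : ¬ Free W₁ W₂ e) : cob (ind K) e = 0 := by
  rw [cob_ind_eq_zero]
  rw [Free, not_and_or, not_not, not_not] at he
  have hd : ∀ W : Set (ℤ × ℤ), (W ⊆ K ∨ Disjoint W K) → src e ∈ W ∧ tgt e ∈ W →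
      (src e ∈ K ↔ tgt e ∈ K) := by
    rintro W (h | h) ⟨ha, hb⟩
    · exact iff_of_true (h ha) (h hb)
    · exact iff_of_false (h.notMem_of_mem_left ha) (h.notMem_of_mem_left hb)
  rcases he with he | he
  exacts [hd W₁ h1 he, hd W₂ h2 he]

/-- If opening `e` joins two clusters of `ω` when `Q₁` and `Q₂` are wired together, then the ends
of the dual edge are connected in the dual of `ω ∪ {e}`. -/
theorem dual_conn (h : Cut D W₁ W₂ Q₁ Q₂ S₀) {ω : Set Edge} (hω : ω ⊆ S₀) {e : Edge}
    (he : e ∈ S₀) (hn : ¬ conn (wire (Q₁ ∪ Q₂)) ω (src e) (tgt e)) :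
    conn (wire Q₁ ⊔ wire Q₂) (D.t '' (S₀ \ insert e ω)) (src (D.t e)) (tgt (D.t e)) := by
  by_contra hcon
  set rJ := wire (Q₁ ∪ Q₂)
  -- one of the two ends of `e` has a cluster that does not meet the boundary
  obtain ⟨a, ha, haQ⟩ : ∃ a, (a = src e ∨ a = tgt e) ∧ ∀ v ∈ Q₁ ∪ Q₂, ¬ conn rJ ω a v := by
    by_contra! hc
    obtain ⟨u, hu, hu'⟩ := hc _ (Or.inl rfl)
    obtain ⟨v, hv, hv'⟩ := hc _ (Or.inr rfl)
    exact hn ((conn rJ ω).trans hu' ((conn rJ ω).trans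
      (le_conn _ _ (Or.inr ⟨hu, hv⟩)) ((conn rJ ω).symm hv')))
  let K : Set (ℤ × ℤ) := {v | conn rJ ω a v}
  have hKQ : Disjoint (Q₁ ∪ Q₂) K := Set.disjoint_left.2 haQ
  have hKω : ∀ e' ∈ ω, (src e' ∈ K ↔ tgt e' ∈ K) := fun e' he' =>
    ⟨fun h' => (conn rJ ω).trans h' (conn_edge he'),
      fun h' => (conn rJ ω).trans h' ((conn rJ ω).symm (conn_edge he'))⟩
  have hend : ∀ e' ∈ S₀, ∀ v, (v = src e' ∨ v = tgt e') → v ∈ K → v ∈ (W₁ ∪ W₂)ᶜ := by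
    rintro e' he' v hv hvK (h1 | h1)
    · exact hKQ.notMem_of_mem_right hvK (Or.inl (h.ends₁ e' he' e' (Or.inl rfl) v hv h1))
    · exact hKQ.notMem_of_mem_right hvK (Or.inr (h.ends₂ e' he' e' (Or.inl rfl) v hv h1))
  have hKU : K ⊆ (W₁ ∪ W₂)ᶜ := by
    intro v hv
    have := (conn_mem_iff (K := K ∩ (W₁ ∪ W₂)ᶜ) (wire_le_ker (Or.inr
      (hKQ.mono_right Set.inter_subset_left))) (fun e' he' => ?_) hv).1
      ⟨(conn rJ ω).refl a, hend e he a ha ((conn rJ ω).refl a)⟩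
    · exact this.2
    · have h1 := hKω e' he'
      have h2 := hend e' (hω he')
      exact ⟨fun h3 => ⟨h1.1 h3.1, h2 _ (Or.inr rfl) (h1.1 h3.1)⟩,
        fun h3 => ⟨h1.2 h3.1, h2 _ (Or.inl rfl) (h1.2 h3.1)⟩⟩
  have hKe : ¬ (src e ∈ K ↔ tgt e ∈ K) := by
    intro h'
    rcases ha with rfl | rfl
    · exact hn (h'.1 ((conn rJ ω).refl _))
    · exact hn ((conn rJ ω).symm (h'.2 ((conn rJ ω).refl _)))
  set rS := wire Q₁ ⊔ wire Q₂
  set Z := D.t '' (S₀ \ insert e ω)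
  let X : Set (ℤ × ℤ) := {v | conn rS Z (src (D.t e)) v}
  have hXZ : ∀ e' ∈ Z, (src e' ∈ X ↔ tgt e' ∈ X) := fun e' he' =>
    ⟨fun h' => (conn rS Z).trans h' (conn_edge he'),
      fun h' => (conn rS Z).trans h' ((conn rS Z).symm (conn_edge he'))⟩
  have hXQ : ∀ Q, wire Q ≤ rS → ∀ u ∈ Q, ∀ v ∈ Q, u ∈ X → v ∈ X := fun Q hQ u hu v hv hx =>
    (conn rS Z).trans hx (le_conn _ _ (hQ (Or.inr ⟨hu, hv⟩)))
  -- `X'` agrees with `X` on the edges that matter, and contains or avoids each boundary part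
  let X' : Set (ℤ × ℤ) := {v | (v ∈ X ∧ v ∈ (W₁ ∪ W₂)ᶜ) ∨ (v ∈ W₁ ∧ (Q₁ ∩ X).Nonempty) ∨
    (v ∈ W₂ ∧ (Q₂ ∩ X).Nonempty)}
  have hXX : ∀ e' ∈ S₀, ∀ v, (v = src (D.t e') ∨ v = tgt (D.t e')) → (v ∈ X' ↔ v ∈ X) := by
    intro e' he' v hv
    have q1 := h.ends₁ e' he' _ (Or.inr rfl) v hv
    have q2 := h.ends₂ e' he' _ (Or.inr rfl) v hv
    have hd := h.disj
    rw [Set.disjoint_left] at hd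
    constructor
    · rintro (h' | ⟨hw, u, huQ, hu⟩ | ⟨hw, u, huQ, hu⟩)
      · exact h'.1
      · exact hXQ Q₁ le_sup_left u huQ v (q1 hw) hu
      · exact hXQ Q₂ le_sup_right u huQ v (q2 hw) hu
    · intro hx
      by_cases h1 : v ∈ W₁
      · exact Or.inr (Or.inl ⟨h1, v, q1 h1, hx⟩)
      by_cases h2 : v ∈ W₂
      · exact Or.inr (Or.inr ⟨h2, v, q2 h2, hx⟩)
      · exact Or.inl ⟨hx, by simp [h1, h2]⟩
  have hX1 : W₁ ⊆ X' ∨ Disjoint W₁ X' := by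
    by_cases hne : (Q₁ ∩ X).Nonempty
    · exact Or.inl fun v hv => Or.inr (Or.inl ⟨hv, hne⟩)
    · refine Or.inr (Set.disjoint_left.2 fun v hv => ?_)
      rintro (h' | h' | h')
      exacts [h'.2 (Or.inl hv), hne h'.2, Set.disjoint_left.1 h.disj hv h'.1]
  have hX2 : W₂ ⊆ X' ∨ Disjoint W₂ X' := by
    by_cases hne : (Q₂ ∩ X).Nonempty
    · exact Or.inl fun v hv => Or.inr (Or.inr ⟨hv, hne⟩)
    · refine Or.inr (Set.disjoint_left.2 fun v hv => ?_)
      rintro (h' | h' | h')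
      exacts [h'.2 (Or.inr hv), Set.disjoint_left.1 h.disj h'.1 hv, hne h'.2]
  have hd1 : ∀ W, W ⊆ W₁ ∪ W₂ → Disjoint W K := fun W hW =>
    Set.disjoint_left.2 fun v hv hvK => hKU hvK (hW hv)
  have hsum := finsum_cob_ind_mul (h.fin.subset hKU) (D.par (ind X'))
  rw [finsum_eq_single _ e] at hsum
  · rw [cob_ind_eq_one hKe, cob_ind_eq_one, one_mul] at hsum
    · exact one_ne_zero hsum
    · rw [hXX e he _ (Or.inl rfl), hXX e he _ (Or.inr rfl)]
      intro h'
      exact hcon (h'.1 ((conn rS Z).refl _))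
  · intro e' hne
    by_cases he' : e' ∈ S₀
    · by_cases heω : e' ∈ ω
      · rw [cob_ind_eq_zero.2 (hKω e' heω), zero_mul]
      · rw [cob_ind_eq_zero (K := X').2, mul_zero]
        rw [hXX e' he' _ (Or.inl rfl), hXX e' he' _ (Or.inr rfl)]
        exact hXZ _ ⟨e', ⟨he', by simp [hne, heω]⟩, rfl⟩
    · rw [h.mem_iff, not_and_or] at he'
      rcases he' with he' | he'
      · rw [cob_eq_zero (Or.inr (hd1 _ Set.subset_union_left))
          (Or.inr (hd1 _ Set.subset_union_right)) he', zero_mul]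
      · rw [cob_eq_zero hX1 hX2 he', mul_zero]

/-- The boundary parts are connected in `ω` or in its dual, provided that the cuts around `W₁` have
odd intersection number with their images under the dual map. -/
theorem conn_or_dual_conn (h : Cut D W₁ W₂ Q₁ Q₂ S₀) {A : Set (ℤ × ℤ)}
    (hA : (symmDiff W₁ A).Finite) {e₀ : Edge}
    (he₀ : cob (ind A) e₀ * cob (ind A) (D.t e₀) = 1)
    (hA' : ∀ e, cob (ind A) e * cob (ind A) (D.t e) ≠ 0 → e = e₀) {ω : Set Edge}
    {a b : ℤ × ℤ} (ha : a ∈ Q₁) (hb : b ∈ Q₂) :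
    conn (wire Q₁ ⊔ wire Q₂) ω a b ∨ conn (wire Q₁ ⊔ wire Q₂) (D.t '' (S₀ \ ω)) a b := by
  by_contra! hcon
  set rS := wire Q₁ ⊔ wire Q₂
  -- the cluster of `Q₁`, completed by `W₁`
  let K : Set Edge → Set (ℤ × ℤ) := fun η => {v | v ∈ W₁ ∨ v ∈ (W₁ ∪ W₂)ᶜ ∧ conn rS η a v}
  have hK1 : ∀ η, W₁ ⊆ K η := fun η v hv => Or.inl hv
  have hK2 : ∀ η, Disjoint W₂ (K η) := fun η => Set.disjoint_left.2 fun v hv => by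
    rintro (h' | h')
    exacts [Set.disjoint_left.1 h.disj h' hv, h'.1 (Or.inr hv)]
  have hKA : ∀ η, (symmDiff (K η) A).Finite := fun η => by
    refine (hA.union h.fin).subset fun v hv => ?_
    simp only [K, Set.mem_symmDiff, Set.mem_ofPred_eq, Set.mem_union] at hv ⊢
    tauto
  have hKv : ∀ η, ¬ conn rS η a b → ∀ e ∈ S₀, ∀ f, (f = e ∨ f = D.t e) →
      ∀ v, (v = src f ∨ v = tgt f) → (v ∈ K η ↔ conn rS η a v) := by
    intro η hη e he f hf v hv
    have q1 := h.ends₁ e he f hf v hv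
    have q2 := h.ends₂ e he f hf v hv
    constructor
    · rintro (h' | h')
      · exact le_conn _ _ ((le_sup_left : wire Q₁ ≤ rS) (Or.inr ⟨ha, q1 h'⟩))
      · exact h'.2
    · intro h'
      by_cases h1 : v ∈ W₁
      · exact Or.inl h1
      by_cases h2 : v ∈ W₂
      · exact absurd ((conn rS η).trans h' (le_conn _ _ ((le_sup_right : wire Q₂ ≤ rS)
          (Or.inr ⟨q2 h2, hb⟩)))) hη
      · exact Or.inr ⟨by simp [h1, h2], h'⟩
  have hKe : ∀ η, ¬ conn rS η a b → ∀ e ∈ S₀, ∀ f, (f = e ∨ f = D.t e) → f ∈ η →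
      cob (ind (K η)) f = 0 := by
    intro η hη e he f hf hfη
    rw [cob_ind_eq_zero, hKv η hη e he f hf _ (Or.inl rfl), hKv η hη e he f hf _ (Or.inr rfl)]
    exact ⟨fun h' => (conn rS η).trans h' (conn_edge hfη),
      fun h' => (conn rS η).trans h' ((conn rS η).symm (conn_edge hfη))⟩
  have hsum := finsum_cob_congr D (hKA ω) (hKA (D.t '' (S₀ \ ω)))
    ((Set.finite_singleton e₀).subset fun e he => hA' e he)
  rw [finsum_eq_single (fun e => cob (ind A) e * cob (ind A) (D.t e)) e₀
    (fun e he => by_contra fun h' => he (hA' e h')), he₀, finsum_eq_zero_of_forall_eq_zero] at hsum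
  · exact one_ne_zero hsum.symm
  · intro e
    by_cases he : e ∈ S₀
    · by_cases heω : e ∈ ω
      · rw [hKe ω hcon.1 e he e (Or.inl rfl) heω, zero_mul]
      · rw [hKe _ hcon.2 e he _ (Or.inr rfl) ⟨e, ⟨he, heω⟩, rfl⟩, mul_zero]
    · rw [h.mem_iff, not_and_or] at he
      rcases he with he | he
      · rw [cob_eq_zero (Or.inl (hK1 _)) (Or.inr (hK2 _)) he, zero_mul]
      · rw [cob_eq_zero (Or.inl (hK1 _)) (Or.inr (hK2 _)) he, mul_zero]

end Cut

lemma wsum_mono {S : Finset Edge} {w : Finset Edge → ℝ} (hw : ∀ ω, 0 ≤ w ω)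
    {A B : Set (Set Edge)} (h : ∀ ω ⊆ S, (ω : Set Edge) ∈ A → (ω : Set Edge) ∈ B) :
    wsum S w A ≤ wsum S w B := by
  refine Finset.sum_le_sum fun ω hω => ?_
  have := h ω (Finset.mem_powerset.1 hω)
  split_ifs <;> simp_all

lemma wsum_nonneg {S : Finset Edge} {w : Finset Edge → ℝ} (hw : ∀ ω, 0 ≤ w ω)
    (A : Set (Set Edge)) : 0 ≤ wsum S w A :=
  Finset.sum_nonneg fun ω _ => by split_ifs <;> simp [hw]

lemma wsum_univ (S : Finset Edge) (w : Finset Edge → ℝ) :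
    wsum S w Set.univ = ∑ ω ∈ S.powerset, w ω := by simp [wsum]

lemma wsum_univ_pos {S : Finset Edge} {w : Finset Edge → ℝ} (hw : ∀ ω, 0 < w ω) :
    0 < wsum S w Set.univ := by
  rw [wsum_univ]
  exact Finset.sum_pos (fun ω _ => hw ω) ⟨∅, Finset.empty_mem_powerset S⟩

lemma wsum_add_compl (S : Finset Edge) (w : Finset Edge → ℝ) (A : Set (Set Edge)) :
    wsum S w A + wsum S w Aᶜ = wsum S w Set.univ := by
  rw [wsum_univ, wsum, wsum, ← Finset.sum_add_distrib]
  refine Finset.sum_congr rfl fun ω _ => ?_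
  by_cases h : (ω : Set Edge) ∈ A <;> simp [h]

lemma wsum_congr {S : Finset Edge} {w w' : Finset Edge → ℝ} {A B : Set (Set Edge)}
    (h : ∀ ω ⊆ S, ((ω : Set Edge) ∈ A ↔ (ω : Set Edge) ∈ B))
    (h' : ∀ ω ⊆ S, (ω : Set Edge) ∈ B → w ω = w' ω) : wsum S w A = wsum S w' B := by
  refine Finset.sum_congr rfl fun ω hω => ?_
  have := h ω (Finset.mem_powerset.1 hω)
  have h2 := h' ω (Finset.mem_powerset.1 hω)
  by_cases hB : (ω : Set Edge) ∈ B <;> simp [this, hB, h2]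

lemma wsum_const_mul (S : Finset Edge) (w : Finset Edge → ℝ) (c : ℝ) (A : Set (Set Edge)) :
    wsum S (fun ω => c * w ω) A = c * wsum S w A := by
  simp [wsum, Finset.mul_sum, mul_ite]

/-- Change of variables from a configuration on `S` to its image under duality. -/
lemma wsum_dual (t : Edge ≃ Edge) (S : Finset Edge) (w : Finset Edge → ℝ) (A : Set (Set Edge)) :
    wsum (S.map t.toEmbedding) (fun ω' => w {e ∈ S | t e ∉ ω'}) A
      = wsum S w {ω | t '' (S \ ω) ∈ A} := by
  refine Finset.sum_nbij' (fun ω' => {e ∈ S | t e ∉ ω'}) (fun ω => (S \ ω).map t.toEmbedding)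
    ?_ ?_ ?_ ?_ ?_
  · intro ω' _; simp
  · intro ω _
    exact Finset.mem_powerset.2 (Finset.map_subset_map.2 Finset.sdiff_subset)
  · intro ω' hω'
    rw [Finset.mem_powerset] at hω'
    ext f
    simp only [Finset.mem_map, Finset.mem_sdiff, Finset.mem_filter, Equiv.coe_toEmbedding]
    constructor
    · rintro ⟨e, ⟨h1, h2⟩, rfl⟩; tauto
    · intro hf
      obtain ⟨e, he, rfl⟩ := Finset.mem_map.1 (hω' hf)
      exact ⟨e, ⟨he, fun h => h.2 hf⟩, rfl⟩
  · intro ω hω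
    rw [Finset.mem_powerset] at hω
    ext e
    simp only [Finset.mem_filter, Finset.mem_map, Finset.mem_sdiff, Equiv.coe_toEmbedding,
      EmbeddingLike.apply_eq_iff_eq, exists_eq_right, not_and, not_not]
    exact ⟨fun h => h.2 h.1, fun h => ⟨hω h, fun _ => h⟩⟩
  · intro ω' hω'
    rw [Finset.mem_powerset] at hω'
    have : t '' ((S : Set Edge) \ ({e ∈ S | t e ∉ ω'} : Finset Edge)) = (ω' : Set Edge) := by
      ext f
      simp only [Set.mem_image, Set.mem_sdiff, Finset.mem_coe, Finset.mem_filter]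
      constructor
      · rintro ⟨e, ⟨h1, h2⟩, rfl⟩; tauto
      · intro hf
        obtain ⟨e, he, rfl⟩ := Finset.mem_map.1 (hω' hf)
        exact ⟨e, ⟨he, fun h => h.2 hf⟩, rfl⟩
    simp only [Set.mem_ofPred_eq, this]

namespace Cut
variable {D : DualMap} {W₁ W₂ Q₁ Q₂ : Set (ℤ × ℤ)} {S₀ : Finset Edge}

/-- The event that `Q₁` and `Q₂`, represented by `a` and `b`, are connected by edges of `S₀` and
their dual edges, each of `Q₁` and `Q₂` being considered as connected. -/
def Joined (D : DualMap) (Q₁ Q₂ : Set (ℤ × ℤ)) (S₀ : Finset Edge) (a b : ℤ × ℤ) :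
    Set (Set Edge) :=
  {ψ | conn (wire Q₁ ⊔ wire Q₂) (ψ ∩ (S₀ ∪ D.t '' S₀)) a b}

lemma isUpperSet_joined (a b : ℤ × ℤ) : IsUpperSet (Joined D Q₁ Q₂ S₀ a b) :=
  fun _ _ h h' => conn_mono le_rfl (Set.inter_subset_inter_left _ h) h'

/-- The dual of the measure in which `Q₁` and `Q₂` are wired together is dominated by any measure
in which each of them is wired. -/
lemma dual_dom (h : Cut D W₁ W₂ Q₁ Q₂ S₀) {x : ℝ} (hx : 1 ≤ x) {V : Finset (ℤ × ℤ)}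
    {r : Setoid (ℤ × ℤ)} {S : Finset Edge} (hV : EndsIn V S) (hS : S₀ ⊆ S)
    (hS' : S₀.map D.t.toEmbedding ⊆ S) (hr : wire Q₁ ⊔ wire Q₂ ≤ r)
    {E : Set (Set Edge)} (hE : IsUpperSet E) :
    wsum S₀ (wt V (wire (Q₁ ∪ Q₂)) x) {ω | D.t '' (S₀ \ ω) ∈ E} * wsum S (wt V r x) Set.univ ≤
      wsum S₀ (wt V (wire (Q₁ ∪ Q₂)) x) Set.univ * wsum S (wt V r x) E := by
  set rJ := wire (Q₁ ∪ Q₂)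
  rw [← wsum_dual, show (Set.univ : Set (Set Edge)) = {ω | D.t '' (S₀ \ ω) ∈ Set.univ} by simp,
    ← wsum_dual]
  simp only [Set.mem_univ]
  refine holley_of_local (fun ω => (wt_pos V rJ hx _).le) (wt_pos V r hx) hS' ?_ hE
  intro ω₁ hω₁ ω₂ hω₂ h12 f hf hf2
  obtain ⟨e, he, rfl⟩ := Finset.mem_map.1 hf
  simp only [Equiv.coe_toEmbedding] at hf hf2 ⊢
  set ω : Finset Edge := {e' ∈ S₀ | D.t e' ∉ insert (D.t e) ω₁} with hω
  have heω : e ∉ ω := by simp [hω]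
  have hins : ({e' ∈ S₀ | D.t e' ∉ ω₁} : Finset Edge) = insert e ω := by
    ext e'
    simp only [hω, Finset.mem_filter, Finset.mem_insert, EmbeddingLike.apply_eq_iff_eq, not_or]
    by_cases hee : e' = e
    · have : D.t e ∉ ω₁ := fun h' => hf2 (h12 h')
      simp [hee, he, this]
    · simp [hee]
  rw [hins]
  have hVS := hV _ (hS he)
  have hVS' := hV _ (hS' hf)
  have p1 := wt_pos V rJ hx ω
  have p2 := wt_pos V r hx ω₂
  by_cases hc : conn rJ ω (src e) (tgt e)
  · rw [wt_insert_of_conn x heω hc]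
    have := wt_le_mul_wt_insert (r := r) hx hVS'.1 hVS'.2 hf2
    nlinarith [mul_le_mul_of_nonneg_left this p1.le]
  · have hω0 : (ω : Set Edge) ⊆ S₀ := Finset.coe_subset.2 (Finset.filter_subset _ _)
    have hd := h.dual_conn hω0 he hc
    have hsub : D.t '' ((S₀ : Set Edge) \ insert e (ω : Set Edge)) ⊆ ω₂ := by
      rintro _ ⟨e', ⟨he', hne⟩, rfl⟩
      rw [← Finset.coe_insert, ← hins] at hne
      simp only [Finset.coe_filter, Set.mem_ofPred_eq, not_and, not_not] at hne
      exact h12 (hne he')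
    rw [wt_insert_of_conn x hf2 (conn_mono hr hsub hd),
      ← wt_insert_of_not_conn x hVS.1 hVS.2 heω hc]
    apply le_of_eq; ring

/-- The crossing principle: at the self-dual point, two wired parts of the boundary are connected
with probability at least `1 / (1 + q)`. -/
theorem wsum_le (h : Cut D W₁ W₂ Q₁ Q₂ S₀) {A : Set (ℤ × ℤ)}
    (hA : (symmDiff W₁ A).Finite) {e₀ : Edge}
    (he₀ : cob (ind A) e₀ * cob (ind A) (D.t e₀) = 1)
    (hA' : ∀ e, cob (ind A) e * cob (ind A) (D.t e) ≠ 0 → e = e₀) {x : ℝ} (hx : 1 ≤ x)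
    {V : Finset (ℤ × ℤ)} {r : Setoid (ℤ × ℤ)} {S : Finset Edge} (hV : EndsIn V S) (hS : S₀ ⊆ S)
    (hS' : S₀.map D.t.toEmbedding ⊆ S) (hr : wire Q₁ ⊔ wire Q₂ ≤ r) {a b : ℤ × ℤ} (ha : a ∈ Q₁)
    (hb : b ∈ Q₂) (haV : a ∈ V) (hbV : b ∈ V) :
    wsum S (wt V r x) Set.univ ≤
      (1 + x ^ 2) * wsum S (wt V r x) (Joined D Q₁ Q₂ S₀ a b) := by
  set E := Joined D Q₁ Q₂ S₀ a b
  set rJ := wire (Q₁ ∪ Q₂)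
  set rS := wire Q₁ ⊔ wire Q₂
  have hJ : rJ = rS ⊔ link a b := by
    apply le_antisymm
    · refine wire_le fun u hu v hv => ?_
      have hab : (rS ⊔ link a b) a b := link_le.1 le_sup_right
      have h1 : ∀ u ∈ Q₁, (rS ⊔ link a b) u a := fun u hu =>
        (le_sup_left : rS ≤ _) ((le_sup_left : wire Q₁ ≤ rS) (Or.inr ⟨hu, ha⟩))
      have h2 : ∀ u ∈ Q₂, (rS ⊔ link a b) u a := fun u hu =>
        (rS ⊔ link a b).trans
          ((le_sup_left : rS ≤ _) ((le_sup_right : wire Q₂ ≤ rS) (Or.inr ⟨hu, hb⟩)))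
          ((rS ⊔ link a b).symm hab)
      exact (rS ⊔ link a b).trans (hu.elim (h1 u) (h2 u))
        ((rS ⊔ link a b).symm (hv.elim (h1 v) (h2 v)))
    · refine sup_le (sup_le (wire_le fun u hu v hv => ?_) (wire_le fun u hu v hv => ?_))
        (link_le.2 ?_)
      exacts [Or.inr ⟨Or.inl hu, Or.inl hv⟩, Or.inr ⟨Or.inr hu, Or.inr hv⟩,
        Or.inr ⟨Or.inl ha, Or.inr hb⟩]
  have hEiff : ∀ ω ⊆ S₀, ((ω : Set Edge) ∈ E ↔ conn rS ω a b) := by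
    intro ω hω
    change conn rS _ a b ↔ _
    rw [Set.inter_eq_left.2 (Set.subset_union_of_subset_left (Finset.coe_subset.2 hω) _)]
  have hEdual : ∀ ω : Set Edge, D.t '' (S₀ \ ω) ∈ E ↔ conn rS (D.t '' (S₀ \ ω)) a b := by
    intro ω
    change conn rS _ a b ↔ _
    rw [Set.inter_eq_left.2 (Set.subset_union_of_subset_right
      (Set.image_mono Set.sdiff_subset) _)]
  have hwE : ∀ ω ⊆ S₀, (ω : Set Edge) ∈ E → wt V rJ x ω = wt V rS x ω := by
    intro ω hω hωE
    rw [hEiff ω hω] at hωE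
    unfold wt
    rw [hJ, conn_sup rS (link a b), sup_link_of_rel hωE]
  have hwE' : ∀ ω ⊆ S₀, (ω : Set Edge) ∈ Eᶜ → wt V rS x ω = x ^ 2 * wt V rJ x ω := by
    intro ω hω hωE
    rw [Set.mem_compl_iff, hEiff ω hω] at hωE
    unfold wt
    rw [hJ, conn_sup rS (link a b), ← ncl_sup_link haV hbV hωE]
    ring
  set C := wsum S₀ (wt V rS x) E
  set B := wsum S₀ (wt V rJ x) Eᶜ
  set s := wsum S (wt V r x) E
  set Z := wsum S (wt V r x) Set.univ
  have hB : wsum S₀ (wt V rS x) Eᶜ = x ^ 2 * B := by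
    rw [← wsum_const_mul]
    exact wsum_congr (fun _ _ => Iff.rfl) hwE'
  have hC : wsum S₀ (wt V rJ x) E = C := wsum_congr (fun _ _ => Iff.rfl) hwE
  have hZJ := wsum_add_compl S₀ (wt V rJ x) E
  have hZS := wsum_add_compl S₀ (wt V rS x) E
  rw [hC] at hZJ
  rw [hB] at hZS
  have d1 := h.dual_dom hx hV hS hS' hr (isUpperSet_joined a b : IsUpperSet E)
  have d2 := holley_of_local (S₀ := S₀) (fun ω => (wt_pos V rS hx ω).le) (wt_pos V r hx) hS
    (fun ω₁ _ ω₂ _ h12 e he he2 => wt_local hr hx h12 (hV e (hS he)).1 (hV e (hS he)).2 he2)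
    (isUpperSet_joined a b : IsUpperSet E)
  have hle : B ≤ wsum S₀ (wt V rJ x) {ω | D.t '' (S₀ \ ω) ∈ E} := by
    refine wsum_mono (fun ω => (wt_pos V rJ hx ω).le) fun ω hω hωE => ?_
    rw [Set.mem_compl_iff, hEiff ω hω] at hωE
    exact (hEdual ω).2 ((h.conn_or_dual_conn hA he₀ hA' ha hb).resolve_left hωE)
  have hZ : 0 < Z := wsum_univ_pos (wt_pos V r hx)
  have hs : 0 ≤ s := wsum_nonneg (fun ω => (wt_pos V r hx ω).le) _
  have hB0 : 0 ≤ B := wsum_nonneg (fun ω => (wt_pos V rJ hx ω).le) _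
  have hC0 : 0 ≤ C := wsum_nonneg (fun ω => (wt_pos V rS hx ω).le) _
  have hCB : 0 < C + x ^ 2 * B := hZS ▸ wsum_univ_pos (wt_pos V rS hx)
  have hx2 : 1 ≤ x ^ 2 := one_le_pow₀ hx
  have e1 : B * Z ≤ (C + B) * s :=
    (mul_le_mul_of_nonneg_right hle hZ.le).trans (hZJ ▸ d1)
  have e2 : C * Z ≤ (C + x ^ 2 * B) * s := hZS ▸ d2
  refine le_of_mul_le_mul_left ?_ hCB
  have e3 := mul_le_mul_of_nonneg_left e1 (zero_le_one.trans hx2)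
  have e4 : 0 ≤ x ^ 2 * B * s := by positivity
  have e5 := mul_le_mul_of_nonneg_right hx2 e4
  nlinarith

end Cut

/-! ### Crossings of rectangles and planarity -/

/-- The vertices of the rectangle `[a, b] × [c, d]`. -/
def box (a b c d : ℤ) : Set (ℤ × ℤ) := {v | a ≤ v.1 ∧ v.1 ≤ b ∧ c ≤ v.2 ∧ v.2 ≤ d}

lemma mem_box {a b c d : ℤ} {v : ℤ × ℤ} :
    v ∈ box a b c d ↔ a ≤ v.1 ∧ v.1 ≤ b ∧ c ≤ v.2 ∧ v.2 ≤ d := Iff.rfl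

/-- The edges with both ends in `W`. -/
def inside (W : Set (ℤ × ℤ)) : Set Edge := {e | src e ∈ W ∧ tgt e ∈ W}

lemma inside_mono {W W' : Set (ℤ × ℤ)} (h : W ⊆ W') : inside W ⊆ inside W' :=
  fun _ he => ⟨h he.1, h he.2⟩

/-- `A` is connected to `A'` by open edges inside `B`. -/
def Crossed (B A A' : Set (ℤ × ℤ)) : Set (Set Edge) :=
  {ω | ∃ u ∈ A, ∃ v ∈ A', conn ⊥ (ω ∩ inside B) u v}

lemma isUpperSet_crossed (B A A' : Set (ℤ × ℤ)) : IsUpperSet (Crossed B A A') := by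
  rintro ω ω' h ⟨u, hu, v, hv, huv⟩
  exact ⟨u, hu, v, hv, conn_mono le_rfl (Set.inter_subset_inter_left _ h) huv⟩

/-- The rectangle `[a, b] × [c, d]` is crossed from left to right. -/
def HCross (a b c d : ℤ) : Set (Set Edge) :=
  Crossed (box a b c d) {v ∈ box a b c d | v.1 = a} {v ∈ box a b c d | v.1 = b}

/-- The rectangle `[a, b] × [c, d]` is crossed from bottom to top. -/
def VCross (a b c d : ℤ) : Set (Set Edge) :=
  Crossed (box a b c d) {v ∈ box a b c d | v.2 = c} {v ∈ box a b c d | v.2 = d}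

/-- The edge dual to `e`, where the face `[x, x + 1] × [y, y + 1]` is encoded by `(x, y)`. -/
def plDual : Edge → Edge
  | (false, x, y) => eV x (y - 1)
  | (true, x, y) => eH (x - 1) y

@[simp] lemma plDual_eH (x y : ℤ) : plDual (false, x, y) = eV x (y - 1) := rfl
@[simp] lemma plDual_eV (x y : ℤ) : plDual (true, x, y) = eH (x - 1) y := rfl

/-- The dual configuration. -/
def dualSet (ω : Set Edge) : Set Edge := plDual '' ωᶜ

/-- The flux of the chain `p` through the vertical edges at height `y` and abscissa in `[a, x]`. -/
def flux (p : Edge → ZMod 2) (a x y : ℤ) : ZMod 2 := ∑ x' ∈ Finset.Icc a x, p (eV x' y)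

lemma sum_Icc_succ {M : Type*} [AddCommMonoid M] (g : ℤ → M) {a x : ℤ} (h : a ≤ x) :
    ∑ z ∈ Finset.Icc a x, g z = ∑ z ∈ Finset.Icc a (x - 1), g z + g x := by
  have : Finset.Icc a x = insert x (Finset.Icc a (x - 1)) := by
    ext z; simp only [Finset.mem_Icc, Finset.mem_insert]; omega
  rw [this, Finset.sum_insert (by simp), add_comm]

lemma flux_of_lt (p : Edge → ZMod 2) {a x : ℤ} (y : ℤ) (h : x < a) : flux p a x y = 0 := by
  simp [flux, h]

lemma flux_succ (p : Edge → ZMod 2) {a x : ℤ} (y : ℤ) (h : a ≤ x) :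
    flux p a x y = flux p a (x - 1) y + p (eV x y) := sum_Icc_succ _ h

lemma sum_telescope (g : ℤ → ZMod 2) {a x : ℤ} (h : a - 1 ≤ x) :
    ∑ z ∈ Finset.Icc a x, (g z + g (z - 1)) = g x + g (a - 1) := by
  induction x, h using Int.leInduction with
  | base => simp [CharTwo.add_self_eq_zero]
  | succ x hx ih =>
    rw [sum_Icc_succ _ (by omega), show x + 1 - 1 = x by ring, ih]
    linear_combination CharTwo.add_self_eq_zero (g x)

/-- Conservation of the flux of a chain. -/
lemma flux_row (p : Edge → ZMod 2) {a x : ℤ} (y : ℤ) (h : a - 1 ≤ x) :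
    flux p a x y + flux p a x (y - 1) + (p (eH x y) + p (eH (a - 1) y))
      = ∑ z ∈ Finset.Icc a x, ∑ e ∈ star (z, y), p e := by
  simp only [sum_star]
  rw [← sum_telescope (fun z => p (eH z y)) h, flux, flux, ← Finset.sum_add_distrib,
    ← Finset.sum_add_distrib]
  exact Finset.sum_congr rfl fun z _ => by ring

/-- A connection supports a chain with boundary its two end points. -/
lemma exists_chain {ω : Set Edge} {u v : ℤ × ℤ} (h : conn ⊥ ω u v) :
    ∃ p : Edge → ZMod 2, (∀ e, p e ≠ 0 → e ∈ ω ∧ conn ⊥ ω u (src e)) ∧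
      ∀ w, ∑ e ∈ star w, p e = ind {u} w + ind {v} w := by
  let T : Set (ℤ × ℤ) := {v | conn ⊥ ω u v ∧ ∃ p : Edge → ZMod 2,
    (∀ e, p e ≠ 0 → e ∈ ω ∧ conn ⊥ ω u (src e)) ∧
      ∀ w, ∑ e ∈ star w, p e = ind {u} w + ind {v} w}
  have hstep : ∀ e ∈ ω, ∀ w w' : ℤ × ℤ, (w = src e ∧ w' = tgt e ∨ w' = src e ∧ w = tgt e) →
      w ∈ T → w' ∈ T := by
    rintro e he w w' hw ⟨hc, p, hp, hp'⟩
    have hcs : conn ⊥ ω u (src e) := by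
      rcases hw with ⟨rfl, -⟩ | ⟨-, rfl⟩
      exacts [hc, (conn ⊥ ω).trans hc ((conn ⊥ ω).symm (conn_edge he))]
    refine ⟨?_, fun e' => p e' + if e' = e then 1 else 0, fun e' he' => ?_, fun z => ?_⟩
    · rcases hw with ⟨-, rfl⟩ | ⟨rfl, -⟩
      exacts [(conn ⊥ ω).trans hcs (conn_edge he), hcs]
    · by_cases hee : e' = e
      · subst hee; exact ⟨he, hcs⟩
      · exact hp e' (by simpa [hee] using he')
    · rw [Finset.sum_add_distrib, hp' z, Finset.sum_ite_eq']
      have hne := src_ne_tgt e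
      simp only [mem_star, ind, Set.mem_singleton_iff]
      have h11 : (1 : ZMod 2) + 1 = 0 := CharTwo.add_self_eq_zero 1
      have : ∀ s t : ℤ × ℤ, s ≠ t → (if z = s then (1 : ZMod 2) else 0) + (if s = z ∨ t = z then 1 else 0)
          = if z = t then 1 else 0 := by
        intro s t hst
        by_cases h1 : s = z
        · have h2 : ¬ z = t := fun h2 => hst (h1.trans h2)
          simp [h1, h2, h11]
        · have h2 : ¬ z = s := fun h2 => h1 h2.symm
          simp [h1, h2, eq_comm]
      rcases hw with ⟨rfl, rfl⟩ | ⟨rfl, rfl⟩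
      · rw [add_assoc, this _ _ hne]
      · have h3 := this _ _ hne.symm
        simp only [or_comm (a := tgt e = z)] at h3
        rw [add_assoc, h3]
  have hu : u ∈ T := ⟨(conn ⊥ ω).refl u, 0, by simp, fun w => by
    simp [CharTwo.add_self_eq_zero]⟩
  have := (conn_bot_mem_iff (K := T) (fun e he => ⟨hstep e he _ _ (Or.inl ⟨rfl, rfl⟩),
    hstep e he _ _ (Or.inr ⟨rfl, rfl⟩)⟩) h).1 hu
  exact this.2

/-- The chain of a vertical crossing defines a colouring of the faces of the rectangle, equal to `0`
on the left and to `1` on the right, which changes only across the edges of the chain. -/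
lemma VCross_flux {a b c d : ℤ} (hcd : c < d) {p : Edge → ZMod 2}
    (hp : ∀ e, p e ≠ 0 → e ∈ inside (box a b c d)) {u v : ℤ × ℤ}
    (hu : u ∈ box a b c d) (huc : u.2 = c) (hvd : v.2 = d)
    (hb : ∀ w, ∑ e ∈ star w, p e = ind {u} w + ind {v} w) :
    (∀ x y, c < y → y < d → a - 1 ≤ x → flux p a x y + flux p a x (y - 1) = p (eH x y)) ∧
      ∀ y, c ≤ y → y < d → flux p a b y = 1 := by
  have hab : a ≤ b := hu.1.trans hu.2.1
  have hpa : ∀ y, p (eH (a - 1) y) = 0 := fun y => by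
    by_contra h
    have := (hp _ h).1
    simp [box] at this
  have hpb : ∀ y, p (eH b y) = 0 := fun y => by
    by_contra h
    have := (hp _ h).2
    simp [box] at this
  have h1 : ∀ x y, c < y → y < d → a - 1 ≤ x →
      flux p a x y + flux p a x (y - 1) = p (eH x y) := by
    intro x y hy hy' hx
    have := flux_row p y hx
    rw [Finset.sum_eq_zero, hpa] at this
    · have h2 := CharTwo.add_self_eq_zero (p (eH x y))
      linear_combination this - h2
    · intro z _
      rw [hb]
      have e1 : (z, y) ≠ u := by rintro rfl; simp at huc; omega
      have e2 : (z, y) ≠ v := by rintro rfl; simp at hvd; omega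
      simp [ind, e1, e2]
  refine ⟨h1, fun y hy => ?_⟩
  induction y, hy using Int.leInduction with
  | base =>
    intro _
    have := flux_row p (a := a) (x := b) c (by omega)
    have h0 : flux p a b (c - 1) = 0 := Finset.sum_eq_zero fun x _ => by
      by_contra h
      have := (hp _ h).1
      simp [box] at this
    rw [h0, hpa, hpb, Finset.sum_congr rfl fun z _ => hb (z, c), Finset.sum_eq_single u.1] at this
    · have e1 : (u.1, c) = u := by rw [← huc]
      have e2 : u ≠ v := by rintro rfl; omega
      rw [e1] at this
      simpa [ind, e2] using this
    · intro z _ hz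
      have e1 : (z, c) ≠ u := by rintro rfl; exact hz rfl
      have e2 : (z, c) ≠ v := by rintro rfl; simp at hvd; omega
      simp [ind, e1, e2]
    · intro h
      exact absurd (Finset.mem_Icc.2 ⟨hu.1, hu.2.1⟩) h
  | succ y hy ih =>
    intro hyd
    have h2 := h1 b (y + 1) (by omega) hyd (by omega)
    rw [hpb, show y + 1 - 1 = y by ring, ih (by omega)] at h2
    have h11 : (1 : ZMod 2) + 1 = 0 := CharTwo.add_self_eq_zero 1
    linear_combination h2 - h11

/-- A vertical crossing prevents a horizontal crossing of the dual rectangle by dual edges. -/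
theorem not_dual_HCross_of_VCross {a b c d : ℤ} (hcd : c < d) {ω : Set Edge}
    (h : ω ∈ VCross a b c d) : dualSet ω ∉ HCross (a - 1) b c (d - 1) := by
  obtain ⟨u, ⟨hu, huc⟩, v, ⟨-, hvd⟩, huv⟩ := h
  obtain ⟨p, hp, hpb⟩ := exists_chain huv
  obtain ⟨f1, f2⟩ := VCross_flux hcd (fun e he => (hp e he).1.2) hu huc hvd hpb
  have hpω : ∀ e ∉ ω, p e = 0 := fun e he => by_contra fun h' => he (hp e h').1.1
  rintro ⟨l, ⟨hl, hla⟩, r, ⟨hr, hrb⟩, hlr⟩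
  have key := conn_bot_mem_iff (K := {w | flux p a w.1 w.2 = 0}) ?_ hlr
  · have e1 : flux p a l.1 l.2 = 0 := flux_of_lt _ _ (by omega)
    have e2 : flux p a r.1 r.2 = 1 := by
      rw [hrb]; exact f2 _ hr.2.2.1 (by have := hr.2.2.2; omega)
    have := key.1 e1
    rw [Set.mem_ofPred_eq, e2] at this
    exact one_ne_zero this
  · rintro _ ⟨⟨e, he, rfl⟩, hs, ht⟩
    have h0 := hpω e he
    rcases e with ⟨_ | _, x, y⟩
    · simp only [plDual_eH, src_eV, tgt_eV, sub_add_cancel, mem_box] at hs ht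
      have := f1 x y (by omega) (by omega) (by omega)
      rw [h0] at this
      simp only [plDual_eH, src_eV, tgt_eV, sub_add_cancel, Set.mem_ofPred_eq]
      rw [CharTwo.add_eq_zero.1 this]
    · simp only [plDual_eV, src_eH, tgt_eH, sub_add_cancel, mem_box] at hs ht
      simp only [plDual_eV, src_eH, tgt_eH, sub_add_cancel, Set.mem_ofPred_eq]
      rw [flux_succ p y (x := x) (by omega), h0, add_zero]

/-- A horizontal and a vertical crossing of a rectangle are connected to each other. -/
theorem conn_of_cross {a b c d : ℤ} (hcd : c < d) {η : Set Edge}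
    (hη : η ⊆ inside (box a b c d)) {u v l r : ℤ × ℤ} (hu : u ∈ box a b c d)
    (hl : l ∈ box a b c d) (hr : r ∈ box a b c d) (huc : u.2 = c) (hvd : v.2 = d) (hla : l.1 = a)
    (hrb : r.1 = b) (huv : conn ⊥ η u v) (hlr : conn ⊥ η l r) : conn ⊥ η u l := by
  obtain ⟨p, hp, hpb⟩ := exists_chain huv
  obtain ⟨f1, f2⟩ := VCross_flux hcd (fun e he => hη (hp e he).1) hu huc hvd hpb
  by_contra hul
  -- the colour of a vertex that is not on the vertical crossing
  let F : ℤ × ℤ → ZMod 2 := fun w => flux p a w.1 (min w.2 (d - 1))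
  have hp0 : ∀ e w, (w = src e ∨ w = tgt e) → conn ⊥ η l w → p e = 0 := by
    intro e w hw hlw
    by_contra h
    obtain ⟨h1, h2⟩ := hp e h
    apply hul
    rcases hw with rfl | rfl
    · exact (conn ⊥ η).trans h2 ((conn ⊥ η).symm hlw)
    · exact (conn ⊥ η).trans h2 ((conn ⊥ η).trans (conn_edge h1) ((conn ⊥ η).symm hlw))
  have hV : ∀ x y, c ≤ y → y ≤ d → conn ⊥ η l (x, y) → p (eV x (min y (d - 1))) = 0 := by
    intro x y h1 h2 h3
    rcases le_or_gt y (d - 1) with h | h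
    · rw [min_eq_left h]; exact hp0 _ _ (Or.inl rfl) h3
    · rw [min_eq_right h.le]
      exact hp0 _ _ (Or.inr (by simp; omega)) h3
  have hlF : F l = 0 := by
    have := hV l.1 l.2 hl.2.2.1 hl.2.2.2 ((conn ⊥ η).refl l)
    simp only [F]
    rw [flux_succ _ _ (by omega), this, flux_of_lt _ _ (by omega), add_zero]
  have hrF : F r = 1 := by
    simp only [F]; rw [hrb]; exact f2 _ (by have := hr.2.2.1; omega) (by omega)
  have key := (conn_bot_mem_iff (K := {w | conn ⊥ η l w ∧ F w = 0}) ?_ hlr).1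
    ⟨(conn ⊥ η).refl l, hlF⟩
  · rw [Set.mem_ofPred_eq, hrF] at key
    exact one_ne_zero key.2
  · intro e he
    have hin := hη he
    have hc : conn ⊥ η l (src e) ↔ conn ⊥ η l (tgt e) :=
      ⟨fun h => (conn ⊥ η).trans h (conn_edge he),
        fun h => (conn ⊥ η).trans h ((conn ⊥ η).symm (conn_edge he))⟩
    have hF : conn ⊥ η l (src e) → F (src e) = F (tgt e) := by
      intro h
      have h' := hc.1 h
      rcases e with ⟨_ | _, x, y⟩
      · simp only [inside, box, src_eH, tgt_eH, Set.mem_ofPred_eq] at hin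
        have h2 := hV _ _ (by omega) (by omega) h'
        simp only [F, src_eH, tgt_eH]
        rw [flux_succ p _ (x := x + 1) (by omega), h2, add_sub_cancel_right, add_zero]
      · simp only [inside, box, src_eV, tgt_eV, Set.mem_ofPred_eq] at hin
        simp only [F, src_eV, tgt_eV]
        rcases le_or_gt (y + 1) (d - 1) with h3 | h3
        · have h4 : p (eH x (y + 1)) = 0 := hp0 _ _ (Or.inl rfl) h'
          have h5 := f1 x (y + 1) (by omega) (by omega) (by omega)
          rw [h4, add_sub_cancel_right] at h5
          rw [min_eq_left h3, min_eq_left (by omega)]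
          exact (CharTwo.add_eq_zero.1 h5).symm
        · rw [min_eq_right h3.le, show min y (d - 1) = d - 1 by omega]
    simp only [Set.mem_ofPred_eq]
    by_cases h : conn ⊥ η l (src e)
    · rw [← hc, hF h]
    · rw [← hc]; simp [h]

/-! ### The leftmost crossing -/

/-- The edges between the faces in `R` and the other faces, in the faces of height in `[c, d)`. -/
def bd (c d : ℤ) (R : Set (ℤ × ℤ)) : Set Edge :=
  {e | c ≤ (src (plDual e)).2 ∧ (tgt (plDual e)).2 < d ∧
    ¬ (src (plDual e) ∈ R ↔ tgt (plDual e) ∈ R)}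

lemma mem_bd_eH {c d x y : ℤ} {R : Set (ℤ × ℤ)} : ((false, x, y) : Edge) ∈ bd c d R ↔
    c < y ∧ y < d ∧ ¬ ((x, y - 1) ∈ R ↔ (x, y) ∈ R) := by
  simp [bd]

lemma mem_bd_eV {c d x y : ℤ} {R : Set (ℤ × ℤ)} : ((true, x, y) : Edge) ∈ bd c d R ↔
    c ≤ y ∧ y < d ∧ ¬ ((x - 1, y) ∈ R ↔ (x, y) ∈ R) := by
  simp [bd]

/-- A set of faces that contains the left side and not the right side can be completed into a
set whose boundary is a connected part of the initial boundary. -/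
theorem exists_contour {a b c d : ℤ} (hab : a ≤ b) (hcd : c < d) {A : Set (ℤ × ℤ)}
    (hA : ∀ x y, x < a → (x, y) ∈ A) (hA' : ∀ x y, b ≤ x → (x, y) ∉ A) :
    ∃ R : Set (ℤ × ℤ), (∀ x y, x < a → (x, y) ∈ R) ∧
      (∀ y, c ≤ y → y < d → (b, y) ∉ R) ∧ bd c d R ⊆ bd c d A ∧
      ∀ e ∈ bd c d R, ∀ f ∈ bd c d R, conn ⊥ (bd c d R) (src e) (src f) := by
  let p : Edge → ZMod 2 := fun e => if e ∈ bd c d A then 1 else 0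
  have hpV : ∀ x y, c ≤ y → y < d → p (eV x y) = ind A (x - 1, y) + ind A (x, y) := by
    intro x y h1 h2
    simp only [p, mem_bd_eV, h1, h2, true_and, ind]
    by_cases h3 : (x - 1, y) ∈ A <;> by_cases h4 : (x, y) ∈ A <;>
      simp [h3, h4, CharTwo.add_self_eq_zero]
  have hpH : ∀ x y, c < y → y < d → p (eH x y) = ind A (x, y - 1) + ind A (x, y) := by
    intro x y h1 h2
    simp only [p, mem_bd_eH, h1, h2, true_and, ind]
    by_cases h3 : (x, y - 1) ∈ A <;> by_cases h4 : (x, y) ∈ A <;>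
      simp [h3, h4, CharTwo.add_self_eq_zero]
  have hp0 : ∀ e, p e ≠ 0 → e ∈ bd c d A := fun e he => by
    by_contra h; exact he (if_neg h)
  have hVx : ∀ x y, p (eV x y) ≠ 0 → a ≤ x ∧ x ≤ b := by
    intro x y h
    have := (mem_bd_eV.1 (hp0 _ h)).2.2
    by_contra h'
    rcases not_and_or.1 h' with h' | h'
    · exact this (iff_of_true (hA _ _ (by omega)) (hA _ _ (by omega)))
    · exact this (iff_of_false (hA' _ _ (by omega)) (hA' _ _ (by omega)))
  have hHx : ∀ x y, p (eH x y) ≠ 0 → a ≤ x ∧ x < b := by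
    intro x y h
    have := (mem_bd_eH.1 (hp0 _ h)).2.2
    by_contra h'
    rcases not_and_or.1 h' with h' | h'
    · exact this (iff_of_true (hA _ _ (by omega)) (hA _ _ (by omega)))
    · exact this (iff_of_false (hA' _ _ (by omega)) (hA' _ _ (by omega)))
  have heven : ∀ x y, c < y → y < d → ∑ e ∈ star (x, y), p e = 0 := by
    intro x y h1 h2
    rw [sum_star, hpV _ _ h1.le h2, hpV _ _ (by omega) (by omega), hpH _ _ h1 h2,
      hpH _ _ h1 h2]
    have t : ∀ z : ZMod 2, z + z = 0 := CharTwo.add_self_eq_zero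
    linear_combination t (ind A (x, y - 1)) + t (ind A (x, y)) + t (ind A (x - 1, y))
      + t (ind A (x - 1, y - 1))
  -- a component of the boundary that leaves the bottom side an odd number of times
  set s := conn ⊥ (bd c d A)
  obtain ⟨x₀, hx₀⟩ : ∃ x₀ : ℤ,
      ∑ x ∈ Finset.Icc a b, (if s (x₀, c) (x, c) then p (eV x c) else 0) ≠ 0 := by
    by_contra! hc
    have htot : ∑ x ∈ Finset.Icc a b, p (eV x c) = 1 := by
      have h1 : ∀ x ∈ Finset.Icc a b, p (eV x c) = ind A (x, c) + ind A (x - 1, c) :=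
        fun x _ => by rw [hpV x c le_rfl hcd, add_comm]
      rw [Finset.sum_congr rfl h1, sum_telescope (fun z => ind A (z, c)) (by omega)]
      simp [ind, hA (a - 1) c (by omega), hA' b c le_rfl]
    rw [← Finset.sum_fiberwise_of_maps_to (g := fun x : ℤ => Quotient.mk s (x, c))
      (t := (Finset.Icc a b).image fun x : ℤ => Quotient.mk s (x, c))
      (fun x hx => Finset.mem_image_of_mem _ hx), Finset.sum_eq_zero] at htot
    · exact zero_ne_one htot
    · intro k hk
      obtain ⟨z, hz, rfl⟩ := Finset.mem_image.1 hk
      rw [Finset.sum_filter]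
      refine (Finset.sum_congr rfl fun x _ => ?_).trans (hc z)
      have : (Quotient.mk s (x, c) = Quotient.mk s (z, c)) ↔ s (z, c) (x, c) :=
        (Quotient.eq (r := s)).trans ⟨s.symm, s.symm⟩
      simp only [this]
  let pQ : Edge → ZMod 2 := fun e => if s (x₀, c) (src e) then p e else 0
  have hpQ : ∀ e, pQ e ≠ 0 → s (x₀, c) (src e) ∧ e ∈ bd c d A := by
    intro e he
    by_cases h : s (x₀, c) (src e)
    · refine ⟨h, hp0 e ?_⟩; simpa [pQ, h] using he
    · simp [pQ, h] at he
  have hpQ' : ∀ e, p e = 0 → pQ e = 0 := fun e he => by simp [pQ, he]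
  have hevenQ : ∀ x y, c < y → y < d → ∑ e ∈ star (x, y), pQ e = 0 := by
    intro x y h1 h2
    by_cases h : s (x₀, c) (x, y)
    · rw [← heven x y h1 h2]
      refine Finset.sum_congr rfl fun e he => ?_
      by_cases hpe : p e = 0
      · rw [hpe, hpQ' e hpe]
      · refine if_pos ?_
        rcases mem_star.1 he with he | he
        · rwa [he]
        · exact s.trans h (he ▸ s.symm (conn_edge (hp0 e hpe)))
    · refine Finset.sum_eq_zero fun e he => ?_
      by_contra hpe
      obtain ⟨h3, h4⟩ := hpQ e hpe
      rcases mem_star.1 he with he | he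
      · exact h (he ▸ h3)
      · exact h (he ▸ s.trans h3 (conn_edge h4))
  have hVQ : ∀ x y, x < a ∨ b < x → pQ (eV x y) = 0 := fun x y h => hpQ' _ (by
    by_contra h'; have := hVx x y h'; omega)
  have hHQ : ∀ x y, x < a ∨ b ≤ x → pQ (eH x y) = 0 := fun x y h => hpQ' _ (by
    by_contra h'; have := hHx x y h'; omega)
  have hfV : ∀ x y, flux pQ a x y = flux pQ a (x - 1) y + pQ (eV x y) := by
    intro x y
    rcases le_or_gt a x with h | h
    · exact flux_succ _ _ h
    · rw [flux_of_lt _ _ h, flux_of_lt _ _ (by omega), hVQ _ _ (Or.inl h), add_zero]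
  have hfH : ∀ x y, c < y → y < d → flux pQ a x y + flux pQ a x (y - 1) = pQ (eH x y) := by
    intro x y h1 h2
    rcases le_or_gt (a - 1) x with h | h
    · have := flux_row pQ y h
      rw [Finset.sum_eq_zero fun z _ => hevenQ z y h1 h2, hHQ (a - 1) y (by omega)] at this
      have h3 := CharTwo.add_self_eq_zero (pQ (eH x y))
      linear_combination this - h3
    · rw [flux_of_lt _ _ (by omega), flux_of_lt _ _ (by omega), hHQ _ _ (Or.inl (by omega)),
        add_zero]
  have hfb : ∀ y, c ≤ y → y < d → flux pQ a b y = 1 := by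
    intro y hy
    induction y, hy using Int.leInduction with
    | base => intro _; exact (zmod_two_cases _).resolve_left hx₀
    | succ y hy ih =>
      intro hyd
      have h2 := hfH b (y + 1) (by omega) hyd
      rw [hHQ _ _ (Or.inr le_rfl), show y + 1 - 1 = y by ring, ih (by omega)] at h2
      have h11 : (1 : ZMod 2) + 1 = 0 := CharTwo.add_self_eq_zero 1
      linear_combination h2 - h11
  have hbd : ∀ e, e ∈ bd c d {w | flux pQ a w.1 w.2 = 0} →
      pQ e ≠ 0 := by
    rintro ⟨_ | _, x, y⟩ he h0
    · rw [mem_bd_eH] at he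
      have := hfH x y he.1 he.2.1
      rw [h0, CharTwo.add_eq_zero] at this
      exact he.2.2 (by simp only [Set.mem_ofPred_eq, this])
    · rw [mem_bd_eV] at he
      have := hfV x y
      rw [h0, add_zero] at this
      exact he.2.2 (by simp only [Set.mem_ofPred_eq, this])
  have hbd' : ∀ e, pQ e ≠ 0 → e ∈ bd c d {w | flux pQ a w.1 w.2 = 0} := by
    intro e h0
    have h1 := (hpQ e h0).2
    rcases e with ⟨_ | _, x, y⟩
    · rw [mem_bd_eH] at h1 ⊢
      refine ⟨h1.1, h1.2.1, fun h => h0 ?_⟩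
      simp only [Set.mem_ofPred_eq] at h
      rw [← hfH x y h1.1 h1.2.1]
      rcases zmod_two_cases (flux pQ a x y) with h3 | h3 <;>
        rcases zmod_two_cases (flux pQ a x (y - 1)) with h4 | h4 <;>
        simp [h3, h4, CharTwo.add_self_eq_zero] at h ⊢
    · rw [mem_bd_eV] at h1 ⊢
      refine ⟨h1.1, h1.2.1, fun h => h0 ?_⟩
      simp only [Set.mem_ofPred_eq] at h
      have := hfV x y
      rcases zmod_two_cases (flux pQ a x y) with h3 | h3 <;>
        rcases zmod_two_cases (flux pQ a (x - 1) y) with h4 | h4 <;>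
        simp [h3, h4] at h this ⊢
      · exact this.symm
      · exact this
  refine ⟨{w | flux pQ a w.1 w.2 = 0}, fun x y hx => flux_of_lt _ _ hx, fun y h1 h2 h => ?_,
    fun e he => (hpQ e (hbd e he)).2, fun e he f hf => ?_⟩
  · simp only [Set.mem_ofPred_eq, hfb y h1 h2] at h
    exact one_ne_zero h
  · set η := bd c d {w | flux pQ a w.1 w.2 = 0}
    have hse := (hpQ e (hbd e he)).1
    have hsf := (hpQ f (hbd f hf)).1
    have h2 : s (src e) (src f) := s.trans (s.symm hse) hsf
    refine ((conn_bot_mem_iff (K := {v | s (src e) v ∧ conn ⊥ η (src e) v}) ?_ h2).1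
      ⟨s.refl _, (conn ⊥ η).refl _⟩).2
    intro e' he'
    have hmem : s (src e) (src e') → e' ∈ η := fun h => hbd' e' (by
      simp only [pQ, p, if_pos (s.trans hse h), if_pos he']; exact one_ne_zero)
    have hs' : s (src e) (src e') ↔ s (src e) (tgt e') :=
      ⟨fun h => s.trans h (conn_edge he'), fun h => s.trans h (s.symm (conn_edge he'))⟩
    constructor
    · rintro ⟨h3, h4⟩
      exact ⟨hs'.1 h3, (conn ⊥ η).trans h4 (conn_edge (hmem h3))⟩
    · rintro ⟨h3, h4⟩
      exact ⟨hs'.2 h3, (conn ⊥ η).trans h4 ((conn ⊥ η).symm (conn_edge (hmem (hs'.2 h3))))⟩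

/-- The faces of `[a, b] × [c, d]` that are reached from the left side without crossing an open
edge, completed by all faces on the left of the rectangle. -/
def reached (a b c d : ℤ) (ω : Set Edge) : Set (ℤ × ℤ) :=
  {f | f.1 < a ∨ f.1 < b ∧ f ∈ box (a - 1) b c (d - 1) ∧
    ∃ l ∈ box (a - 1) b c (d - 1), l.1 = a - 1 ∧ conn ⊥ (dualSet ω ∩ inside (box (a - 1) b c (d - 1))) l f}

/-- A set of faces with connected boundary that contains all the faces reached from the left. -/
def hull (a b c d : ℤ) (ω : Set Edge) : Set (ℤ × ℤ) :=
  Classical.epsilon fun R => (∀ x y, x < a → (x, y) ∈ R) ∧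
      (∀ y, c ≤ y → y < d → (b, y) ∉ R) ∧ bd c d R ⊆ bd c d (reached a b c d ω) ∧
      ∀ e ∈ bd c d R, ∀ f ∈ bd c d R, conn ⊥ (bd c d R) (src e) (src f)

/-- The vertices of the rectangle on the left of the leftmost vertical crossing, or on it. -/
def leftOf (a b c d : ℤ) (ω : Set Edge) : Set (ℤ × ℤ) :=
  {v ∈ box a b c d | ∃ f ∈ hull a b c d ω, (f.1 = v.1 ∨ f.1 = v.1 - 1) ∧
    (f.2 = v.2 ∨ f.2 = v.2 - 1) ∧ c ≤ f.2 ∧ f.2 < d}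

/-- The vertices of the leftmost vertical crossing. -/
def leftmost (a b c d : ℤ) (ω : Set Edge) : Set (ℤ × ℤ) :=
  {v | ∃ e ∈ bd c d (hull a b c d ω), v = src e ∨ v = tgt e}

section leftmost
variable {a b c d : ℤ} {ω : Set Edge}

lemma hull_spec (hab : a ≤ b) (hcd : c < d) (ω : Set Edge) :
    (∀ x y, x < a → (x, y) ∈ hull a b c d ω) ∧
      (∀ y, c ≤ y → y < d → (b, y) ∉ hull a b c d ω) ∧
      bd c d (hull a b c d ω) ⊆ bd c d (reached a b c d ω) ∧
      ∀ e ∈ bd c d (hull a b c d ω), ∀ f ∈ bd c d (hull a b c d ω),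
        conn ⊥ (bd c d (hull a b c d ω)) (src e) (src f) :=
  Classical.epsilon_spec (p := fun R => (∀ x y, x < a → (x, y) ∈ R) ∧
      (∀ y, c ≤ y → y < d → (b, y) ∉ R) ∧ bd c d R ⊆ bd c d (reached a b c d ω) ∧
      ∀ e ∈ bd c d R, ∀ f ∈ bd c d R, conn ⊥ (bd c d R) (src e) (src f))
    (exists_contour hab hcd (fun x y h => Or.inl h) (fun x y h h' => by
      rcases h' with h' | ⟨h', -⟩ <;> simp at h' <;> omega))

lemma mem_reached (hn : dualSet ω ∉ HCross (a - 1) b c (d - 1)) {f : ℤ × ℤ}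
    (hf : f ∈ box (a - 1) b c (d - 1)) : f ∈ reached a b c d ω ↔
      ∃ l ∈ box (a - 1) b c (d - 1), l.1 = a - 1 ∧
        conn ⊥ (dualSet ω ∩ inside (box (a - 1) b c (d - 1))) l f := by
  constructor
  · rintro (h | h)
    · exact ⟨f, hf, by have := hf.1; omega, (conn ⊥ _).refl f⟩
    · exact h.2.2
  · rintro ⟨l, hl, hla, hlf⟩
    by_cases h : f.1 = b
    · exact absurd ⟨l, ⟨hl, hla⟩, f, ⟨hf, h⟩, hlf⟩ hn
    · exact Or.inr ⟨by have := hf.2.1; omega, hf, l, hl, hla, hlf⟩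

lemma reached_iff_of_dual (hn : dualSet ω ∉ HCross (a - 1) b c (d - 1)) {e : Edge} (he : e ∉ ω)
    (hin : plDual e ∈ inside (box (a - 1) b c (d - 1))) :
    src (plDual e) ∈ reached a b c d ω ↔ tgt (plDual e) ∈ reached a b c d ω := by
  rw [mem_reached hn hin.1, mem_reached hn hin.2]
  have : conn ⊥ (dualSet ω ∩ inside (box (a - 1) b c (d - 1))) (src (plDual e))
      (tgt (plDual e)) := conn_edge ⟨⟨e, he, rfl⟩, hin⟩
  exact ⟨fun ⟨l, h1, h2, h3⟩ => ⟨l, h1, h2, (conn ⊥ _).trans h3 this⟩,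
    fun ⟨l, h1, h2, h3⟩ => ⟨l, h1, h2, (conn ⊥ _).trans h3 ((conn ⊥ _).symm this)⟩⟩

lemma bd_reached_box (hab : a ≤ b) {e : Edge} (he : e ∈ bd c d (reached a b c d ω)) :
    e ∈ inside (box a b c d) ∧ plDual e ∈ inside (box (a - 1) b c (d - 1)) := by
  have hA : ∀ x y, x < a → (x, y) ∈ reached a b c d ω := fun x y h => Or.inl h
  have hA' : ∀ x y, b ≤ x → (x, y) ∉ reached a b c d ω := fun x y h h' => by
    rcases h' with h' | ⟨h', -⟩ <;> simp at h' <;> omega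
  rcases e with ⟨_ | _, x, y⟩
  · rw [mem_bd_eH] at he
    have h1 : a ≤ x := by
      by_contra h; exact he.2.2 (iff_of_true (hA _ _ (by omega)) (hA _ _ (by omega)))
    have h2 : x < b := by
      by_contra h; exact he.2.2 (iff_of_false (hA' _ _ (by omega)) (hA' _ _ (by omega)))
    simp only [inside, box, Set.mem_ofPred_eq, plDual_eH, src_eH, tgt_eH, src_eV, tgt_eV]
    omega
  · rw [mem_bd_eV] at he
    have h1 : a ≤ x := by
      by_contra h; exact he.2.2 (iff_of_true (hA _ _ (by omega)) (hA _ _ (by omega)))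
    have h2 : x ≤ b := by
      by_contra h; exact he.2.2 (iff_of_false (hA' _ _ (by omega)) (hA' _ _ (by omega)))
    simp only [inside, box, Set.mem_ofPred_eq, plDual_eV, src_eH, tgt_eH, src_eV, tgt_eV]
    omega

lemma bd_reached_subset (hab : a ≤ b) (hn : dualSet ω ∉ HCross (a - 1) b c (d - 1)) :
    bd c d (reached a b c d ω) ⊆ ω := fun e he => by
  by_contra h
  exact he.2.2 (reached_iff_of_dual hn h (bd_reached_box hab he).2)

lemma mem_bd_of_inside {R : Set (ℤ × ℤ)} {e : Edge}
    (hin : plDual e ∈ inside (box (a - 1) b c (d - 1)))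
    (h : ¬ (src (plDual e) ∈ R ↔ tgt (plDual e) ∈ R)) : e ∈ bd c d R :=
  ⟨hin.1.2.2.1, by have := hin.2.2.2.2; omega, h⟩

lemma reached_subset_hull (hab : a ≤ b) (hcd : c < d)
    (hn : dualSet ω ∉ HCross (a - 1) b c (d - 1)) {f : ℤ × ℤ}
    (hf : f ∈ box (a - 1) b c (d - 1)) (h : f ∈ reached a b c d ω) : f ∈ hull a b c d ω := by
  obtain ⟨h1, h2, h3, h4⟩ := hull_spec hab hcd ω
  obtain ⟨l, hl, hla, hlf⟩ := (mem_reached hn hf).1 h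
  refine (conn_bot_mem_iff ?_ hlf).1 (h1 l.1 l.2 (by omega))
  rintro _ ⟨⟨e, he, rfl⟩, hin⟩
  by_contra h5
  exact he (bd_reached_subset hab hn (h3 (mem_bd_of_inside hin h5)))

/-- The edges around a face on the left of the leftmost crossing lie on the left of it. -/
lemma inside_leftOf {e : Edge} (he : e ∈ inside (box a b c d))
    (hin : plDual e ∈ inside (box (a - 1) b c (d - 1))) {f : ℤ × ℤ}
    (hf : f = src (plDual e) ∨ f = tgt (plDual e)) (h : f ∈ hull a b c d ω) :
    e ∈ inside (leftOf a b c d ω) := by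
  refine ⟨⟨he.1, f, h, ?_⟩, ⟨he.2, f, h, ?_⟩⟩ <;>
  · rcases e with ⟨_ | _, x, y⟩ <;> rcases hf with rfl | rfl <;>
      simp only [inside, box, Set.mem_ofPred_eq, plDual_eH, plDual_eV, src_eH, tgt_eH, src_eV,
        tgt_eV, true_or, or_true, true_and] at hin ⊢ <;> omega

lemma mem_leftmost_of_face {v f : ℤ × ℤ} (hv : v ∈ leftOf a b c d ω)
    (hf : f ∉ hull a b c d ω) (h1 : f.1 = v.1 ∨ f.1 = v.1 - 1) (h2 : f.2 = v.2 ∨ f.2 = v.2 - 1)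
    (h3 : c ≤ f.2) (h4 : f.2 < d) : v ∈ leftmost a b c d ω := by
  obtain ⟨hvB, g, hg, g1, g2, g3, g4⟩ := hv
  obtain ⟨x, y⟩ := v
  obtain ⟨fx, fy⟩ := f
  obtain ⟨gx, gy⟩ := g
  simp only at h1 h2 h3 h4 g1 g2 g3 g4
  by_contra hQ
  -- moving from one face at `v` to an adjacent one crosses an edge at `v`
  have hH : ∀ z, (z = x ∨ z = x - 1) → c < y → y < d →
      ((z, y - 1) ∈ hull a b c d ω ↔ (z, y) ∈ hull a b c d ω) := by
    intro z hz hy hy'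
    by_contra h
    refine hQ ⟨eH z y, mem_bd_eH.2 ⟨hy, hy', h⟩, ?_⟩
    rcases hz with rfl | rfl <;> simp
  have hV : ∀ z, (z = y ∨ z = y - 1) → c ≤ z → z < d →
      ((x - 1, z) ∈ hull a b c d ω ↔ (x, z) ∈ hull a b c d ω) := by
    intro z hz hy hy'
    by_contra h
    refine hQ ⟨eV x z, mem_bd_eV.2 ⟨hy, hy', h⟩, ?_⟩
    rcases hz with rfl | rfl <;> simp
  have hx : ∀ z, (z = y ∨ z = y - 1) → c ≤ z → z < d → ∀ s t, (s = x ∨ s = x - 1) →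
      (t = x ∨ t = x - 1) → (s, z) ∈ hull a b c d ω → (t, z) ∈ hull a b c d ω := by
    rintro z hz hz1 hz2 s t (rfl | rfl) (rfl | rfl) h
    exacts [h, (hV z hz hz1 hz2).2 h, (hV z hz hz1 hz2).1 h, h]
  have hg' := hx gy g2 g3 g4 gx fx g1 h1 hg
  rcases g2 with rfl | rfl <;> rcases h2 with rfl | rfl
  · exact hf hg'
  · exact hf ((hH fx h1 (by omega) g4).2 hg')
  · exact hf ((hH fx h1 (by omega) h4).1 hg')
  · exact hf hg'

end leftmost

/-- An exploration of the rectangle `B` that starts from its part `near`, in search of a crossing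
between `s₁` and `s₂`. When `ω` belongs to the event `G` the search is successful, `W ω` is the
explored set of vertices and `Q ω` the crossing that was found: it separates the explored vertices
from the others, and `W ω` and `Q ω` are determined by the edges inside `W ω`. -/
structure IsExploration (B near far s₁ s₂ : Set (ℤ × ℤ)) (W Q : Set Edge → Set (ℤ × ℤ))
    (G : Set (Set Edge)) : Prop where
  sub_box : ∀ ω ∈ G, W ω ⊆ B
  sub : ∀ ω ∈ G, Q ω ⊆ W ω
  near : ∀ ω ∈ G, near ⊆ W ω
  far : ∀ ω ∈ G, ∀ v ∈ far, v ∈ W ω → v ∈ Q ω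
  step : ∀ ω ∈ G, ∀ e ∈ inside B, ∀ v w, (v = src e ∧ w = tgt e ∨ v = tgt e ∧ w = src e) →
    v ∈ W ω → v ∉ Q ω → w ∈ W ω
  conn : ∀ ω ∈ G, ∀ u ∈ Q ω, ∀ v ∈ Q ω, conn ⊥ (ω ∩ inside (Q ω)) u v
  start : ∀ ω ∈ G, (Q ω ∩ s₁).Nonempty
  goal : ∀ ω ∈ G, (Q ω ∩ s₂).Nonempty
  stopping : ∀ ω ∈ G, ∀ ω', ω' ∩ inside (W ω) = ω ∩ inside (W ω) →
    ω' ∈ G ∧ W ω' = W ω ∧ Q ω' = Q ω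

theorem isExploration_leftmost {a b c d : ℤ} (hab : a ≤ b) (hcd : c < d) :
    IsExploration (box a b c d) {v ∈ box a b c d | v.1 = a} {v ∈ box a b c d | v.1 = b}
      {v ∈ box a b c d | v.2 = c} {v ∈ box a b c d | v.2 = d} (leftOf a b c d)
      (leftmost a b c d) {ω | dualSet ω ∉ HCross (a - 1) b c (d - 1)} := by
  have hQW : ∀ ω, leftmost a b c d ω ⊆ leftOf a b c d ω := by
    rintro ω v ⟨e, he, hv⟩
    have h1 := bd_reached_box hab ((hull_spec hab hcd ω).2.2.1 he)
    have h2 : ∃ f, (f = src (plDual e) ∨ f = tgt (plDual e)) ∧ f ∈ hull a b c d ω := by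
      have := he.2.2
      by_cases h : src (plDual e) ∈ hull a b c d ω
      exacts [⟨_, Or.inl rfl, h⟩, ⟨_, Or.inr rfl, by tauto⟩]
    obtain ⟨f, hf, hfh⟩ := h2
    have h3 := inside_leftOf h1.1 h1.2 hf hfh
    rcases hv with rfl | rfl
    exacts [h3.1, h3.2]
  have hexists : ∀ ω y, c ≤ y → y < d → ∃ x, eV x y ∈ bd c d (hull a b c d ω) := by
    intro ω y hy hy'
    by_contra! hne
    obtain ⟨h1, h2, -, -⟩ := hull_spec hab hcd ω
    have : ∀ x, a - 1 ≤ x → (x, y) ∈ hull a b c d ω := by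
      intro x hx
      induction x, hx using Int.leInduction with
      | base => exact h1 _ _ (by omega)
      | succ x hx ih =>
        have := hne (x + 1)
        rw [mem_bd_eV] at this
        simp only [hy, hy', true_and, add_sub_cancel_right, not_not] at this
        exact this.1 ih
    exact h2 y hy hy' (this b (by omega))
  refine ⟨fun ω _ v hv => hv.1, fun ω _ => hQW ω, ?_, ?_, ?_, ?_, ?_, ?_, ?_⟩
  · rintro ω - ⟨x, y⟩ ⟨hv, hx⟩
    simp only at hx
    subst hx
    refine ⟨hv, (x - 1, min y (d - 1)), (hull_spec hab hcd ω).1 _ _ (by omega), ?_⟩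
    simp only [mem_box] at hv
    refine ⟨Or.inr rfl, ?_, ?_, ?_⟩ <;> simp only <;> omega
  · rintro ω - ⟨x, y⟩ ⟨hv, hx⟩ hW
    simp only at hx
    subst hx
    have hb := hv
    simp only [mem_box] at hb
    exact mem_leftmost_of_face (f := (x, min y (d - 1))) hW
      ((hull_spec hab hcd ω).2.1 _ (by omega) (by omega)) (Or.inl rfl) (by simp only; omega)
      (by simp only; omega) (by simp only; omega)
  · rintro ω - e he v w hvw hv hvQ
    have hwB : w ∈ box a b c d := by
      rcases hvw with ⟨-, rfl⟩ | ⟨-, rfl⟩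
      exacts [he.2, he.1]
    have hface : ∀ f : ℤ × ℤ, (f.1 = v.1 ∨ f.1 = v.1 - 1) → (f.2 = v.2 ∨ f.2 = v.2 - 1) →
        c ≤ f.2 → f.2 < d → f ∈ hull a b c d ω := fun f h1 h2 h3 h4 => by
      by_contra h
      exact hvQ (mem_leftmost_of_face hv h h1 h2 h3 h4)
    have hs : ∃ f : ℤ × ℤ, (f.1 = v.1 ∨ f.1 = v.1 - 1) ∧ (f.2 = v.2 ∨ f.2 = v.2 - 1) ∧
        c ≤ f.2 ∧ f.2 < d ∧ (f.1 = w.1 ∨ f.1 = w.1 - 1) ∧ (f.2 = w.2 ∨ f.2 = w.2 - 1) := by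
      refine ⟨((src e).1, min (src e).2 (d - 1)), ?_⟩
      rcases e with ⟨_ | _, x, y⟩ <;> rcases hvw with ⟨rfl, rfl⟩ | ⟨rfl, rfl⟩ <;>
        simp only [inside, box, Set.mem_ofPred_eq, src_eH, tgt_eH, src_eV, tgt_eV, true_or,
          true_and] at he ⊢ <;> omega
    obtain ⟨f, h1, h2, h3, h4, h5, h6⟩ := hs
    exact ⟨hwB, f, hface f h1 h2 h3 h4, h5, h6, h3, h4⟩
  · intro ω hn u hu v hv
    obtain ⟨-, -, h3, h4⟩ := hull_spec hab hcd ω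
    have hsub : bd c d (hull a b c d ω) ⊆ ω ∩ inside (leftmost a b c d ω) := fun e he =>
      ⟨bd_reached_subset hab hn (h3 he), ⟨e, he, Or.inl rfl⟩, ⟨e, he, Or.inr rfl⟩⟩
    refine conn_mono le_rfl hsub ?_
    have key : ∀ u ∈ leftmost a b c d ω, ∃ e ∈ bd c d (hull a b c d ω),
        FKStrip.conn ⊥ (bd c d (hull a b c d ω)) (src e) u := by
      rintro u ⟨e, he, rfl | rfl⟩
      exacts [⟨e, he, Setoid.refl' _ _⟩, ⟨e, he, conn_edge he⟩]
    obtain ⟨e, he, heu⟩ := key u hu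
    obtain ⟨f, hf, hfv⟩ := key v hv
    exact Setoid.trans' _ (Setoid.symm' _ heu) (Setoid.trans' _ (h4 e he f hf) hfv)
  · intro ω hn
    obtain ⟨x, hx⟩ := hexists ω c le_rfl hcd
    exact ⟨(x, c), ⟨_, hx, Or.inl rfl⟩, (hQW ω ⟨_, hx, Or.inl rfl⟩).1, rfl⟩
  · intro ω hn
    obtain ⟨x, hx⟩ := hexists ω (d - 1) (by omega) (by omega)
    have h1 : (x, d) = tgt (eV x (d - 1)) := by simp
    exact ⟨(x, d), ⟨_, hx, Or.inr h1⟩, (hQW ω ⟨_, hx, Or.inr h1⟩).1, rfl⟩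
  · intro ω hn ω' hω'
    set F := box (a - 1) b c (d - 1)
    -- an edge around a reached face is open for `ω` if it is open for `ω'`
    have hkey : ∀ e ∈ inside (box a b c d), plDual e ∈ inside F → ∀ f,
        (f = src (plDual e) ∨ f = tgt (plDual e)) → f ∈ reached a b c d ω →
        (e ∈ ω' ↔ e ∈ ω) := by
      intro e he hin f hf hfr
      have hfF : f ∈ F := by rcases hf with rfl | rfl; exacts [hin.1, hin.2]
      have h1 := inside_leftOf he hin hf (reached_subset_hull hab hcd hn hfF hfr)
      have h2 : e ∈ ω' ∩ inside (leftOf a b c d ω) ↔ e ∈ ω ∩ inside (leftOf a b c d ω) := by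
        rw [hω']
      simpa [h1] using h2
    have hsub : ∀ l ∈ F, l.1 = a - 1 → ∀ f, conn ⊥ (dualSet ω' ∩ inside F) l f →
        f ∈ reached a b c d ω := by
      intro l hl hla f hlf
      refine (conn_bot_mem_iff ?_ hlf).1 (Or.inl (by omega))
      rintro _ ⟨⟨e, he, rfl⟩, hin⟩
      by_contra h
      have h1 := mem_bd_of_inside hin h
      have h2 : ∃ f, (f = src (plDual e) ∨ f = tgt (plDual e)) ∧ f ∈ reached a b c d ω := by
        by_cases h' : src (plDual e) ∈ reached a b c d ω
        exacts [⟨_, Or.inl rfl, h'⟩, ⟨_, Or.inr rfl, by_contra fun h'' => h (iff_of_false h' h'')⟩]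
      obtain ⟨f, hf, hfr⟩ := h2
      exact he ((hkey e (bd_reached_box hab h1).1 hin f hf hfr).2
        (bd_reached_subset hab hn h1))
    have hn' : dualSet ω' ∉ HCross (a - 1) b c (d - 1) := by
      rintro ⟨l, ⟨hl, hla⟩, r, ⟨hr, hrb⟩, hlr⟩
      rcases hsub l hl hla r hlr with h | h <;> omega
    have heq : reached a b c d ω' = reached a b c d ω := by
      have hF : ∀ f ∈ F, f ∈ reached a b c d ω' ↔ f ∈ reached a b c d ω := by
        intro f hf
        constructor
        · intro h
          obtain ⟨l, hl, hla, hlf⟩ := (mem_reached hn' hf).1 h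
          exact hsub l hl hla f hlf
        · intro h
          obtain ⟨l, hl, hla, hlf⟩ := (mem_reached hn hf).1 h
          refine (conn_bot_mem_iff ?_ hlf).1 (Or.inl (by omega))
          rintro _ ⟨⟨e, he, rfl⟩, hin⟩
          by_contra h
          have h1 := mem_bd_of_inside hin h
          have h2 : ∃ f ∈ F, (f = src (plDual e) ∨ f = tgt (plDual e)) ∧
              f ∈ reached a b c d ω' := by
            by_cases h' : src (plDual e) ∈ reached a b c d ω'
            exacts [⟨_, hin.1, Or.inl rfl, h'⟩, ⟨_, hin.2, Or.inr rfl,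
              by_contra fun h'' => h (iff_of_false h' h'')⟩]
          obtain ⟨f, hfF, hf, hfr⟩ := h2
          obtain ⟨l', hl', hla', hlf'⟩ := (mem_reached hn' hfF).1 hfr
          exact he ((hkey e (bd_reached_box hab h1).1 hin f hf (hsub l' hl' hla' f hlf')).1
            (bd_reached_subset hab hn' h1))
      ext f
      by_cases hf : f ∈ F
      · exact hF f hf
      · constructor <;> rintro (h | h)
        exacts [Or.inl h, absurd h.2.1 hf, Or.inl h, absurd h.2.1 hf]
    have hhull : hull a b c d ω' = hull a b c d ω := by unfold hull; rw [heq]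
    exact ⟨hn', by unfold leftOf; rw [hhull], by unfold leftmost; rw [hhull]⟩

/-- A rectangle is crossed vertically if and only if the dual rectangle is not crossed horizontally
by dual edges. -/
theorem VCross_iff {a b c d : ℤ} (hab : a ≤ b) (hcd : c < d) {ω : Set Edge} :
    ω ∈ VCross a b c d ↔ dualSet ω ∉ HCross (a - 1) b c (d - 1) := by
  refine ⟨not_dual_HCross_of_VCross hcd, fun h => ?_⟩
  have hE := isExploration_leftmost hab hcd
  obtain ⟨u, hu, hu'⟩ := hE.start ω h
  obtain ⟨v, hv, hv'⟩ := hE.goal ω h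
  exact ⟨u, hu', v, hv', conn_mono le_rfl (Set.inter_subset_inter_right _
    (inside_mono ((hE.sub ω h).trans (hE.sub_box ω h)))) (hE.conn ω h u hu v hv)⟩

/-- The configuration in the rectangle with an additional row at the bottom, where the edges
between this row and the initial rectangle are open at the abscissas at least `g`. -/
def gated (c g : ℤ) (ω : Set Edge) : Set Edge :=
  {e ∈ ω | c ≤ (src e).2} ∪ {e | ∃ x, g ≤ x ∧ e = eV x (c - 1)}

/-- The leftmost crossing from the part of the bottom side with abscissa at least `g` to the
top side can be explored from the left. -/
theorem exists_exploration_gated {a b c d g : ℤ} (hag : a ≤ g) (hgb : g ≤ b) (hcd : c < d) :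
    ∃ W Q, IsExploration (box a b c d)
      {v ∈ box a b c d | v.1 = a ∨ v.2 = c ∧ v.1 ≤ g} {v ∈ box a b c d | v.1 = b}
      {v ∈ box a b c d | v.2 = c ∧ g ≤ v.1} {v ∈ box a b c d | v.2 = d} W Q
      (Crossed (box a b c d) {v ∈ box a b c d | v.2 = c ∧ g ≤ v.1}
        {v ∈ box a b c d | v.2 = d}) := by
  have hE := isExploration_leftmost (a := a) (b := b) (c := c - 1) (d := d) (by omega) (by omega)
  set B := box a b c d
  set B' := box a b (c - 1) d
  set G' : Set (Set Edge) := {ω | dualSet ω ∉ HCross (a - 1) b (c - 1) (d - 1)} with hG'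
  set W := leftOf a b (c - 1) d
  set Q := leftmost a b (c - 1) d
  have hBB : ∀ v ∈ B', c ≤ v.2 → v ∈ B := fun v hv h => ⟨hv.1, hv.2.1, h, hv.2.2.2⟩
  have hBB' : B ⊆ B' := fun v hv => ⟨hv.1, hv.2.1, by have := hv.2.2.1; omega, hv.2.2.2⟩
  have htgt : ∀ e : Edge, (src e).2 ≤ (tgt e).2 := by
    rintro ⟨_ | _, x, y⟩ <;> simp
  -- a point of the crossing in the additional row lies below another one
  have hpend : ∀ ω, gated c g ω ∈ G' → ∀ w ∈ Q (gated c g ω), w.2 = c - 1 →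
      g ≤ w.1 ∧ (w.1, c) ∈ Q (gated c g ω) := by
    intro ω hω w hw hwc
    obtain ⟨v, hv, -, hvd⟩ := hE.goal _ hω
    by_contra hcon
    have key := (conn_bot_mem_iff (K := {w}) ?_ (hE.conn _ hω w hw v hv)).1 rfl
    · rw [Set.mem_singleton_iff] at key
      subst key; omega
    · rintro e ⟨he | ⟨x, hx, rfl⟩, hin⟩
      · have h1 := he.2
        have h2 := htgt e
        refine iff_of_false ?_ ?_
        · rintro rfl; omega
        · rintro rfl; omega
      · refine iff_of_false ?_ ?_
        · rintro rfl
          refine hcon ⟨hx, ?_⟩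
          have := hin.2
          simpa using this
        · rintro rfl; simp at hwc; omega
  have hconn : ∀ ω, gated c g ω ∈ G' → ∀ u ∈ Q (gated c g ω), ∀ v ∈ Q (gated c g ω),
      conn ⊥ (ω ∩ inside (Q (gated c g ω) ∩ B)) (u.1, max u.2 c) (v.1, max v.2 c) := by
    intro ω hω u hu v hv
    have h1 := hE.conn _ hω u hu v hv
    have : conn ⊥ (gated c g ω ∩ inside (Q (gated c g ω))) ≤
        (conn ⊥ (ω ∩ inside (Q (gated c g ω) ∩ B))).comap
          fun v : ℤ × ℤ => (v.1, max v.2 c) := by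
      refine conn_le.2 ⟨bot_le, ?_⟩
      rintro e ⟨he | ⟨x, hx, rfl⟩, hin⟩
      · have h2 := he.2
        have h3 := htgt e
        have h4 := hE.sub_box _ hω (hE.sub _ hω hin.1)
        have h5 := hE.sub_box _ hω (hE.sub _ hω hin.2)
        rw [Setoid.comap_rel, max_eq_left h2, max_eq_left (h2.trans h3)]
        exact conn_edge ⟨he.1, ⟨hin.1, hBB _ h4 h2⟩, ⟨hin.2, hBB _ h5 (h2.trans h3)⟩⟩
      · rw [Setoid.comap_rel]
        simp only [src_eV, tgt_eV, sub_add_cancel, max_self]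
        rw [max_eq_right (by omega)]
    exact this h1
  have hGG : ∀ ω, ω ∈ Crossed B {v ∈ B | v.2 = c ∧ g ≤ v.1} {v ∈ B | v.2 = d} ↔
      gated c g ω ∈ G' := by
    intro ω
    constructor
    · rintro ⟨u, ⟨hu, huc, hug⟩, v, ⟨hv, hvd⟩, huv⟩
      refine not_dual_HCross_of_VCross (by omega) ⟨(u.1, c - 1), ⟨⟨hu.1, hu.2.1, le_rfl, ?_⟩, rfl⟩,
        v, ⟨hBB' hv, hvd⟩, ?_⟩
      · simp only; omega
      · have h1 : conn ⊥ (gated c g ω ∩ inside B') (u.1, c - 1) u := by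
          have h3 : eV u.1 (c - 1) ∈ gated c g ω ∩ inside B' := by
            refine ⟨Or.inr ⟨u.1, hug, rfl⟩, ?_⟩
            have := hu.1; have := hu.2.1
            simp only [inside, Set.mem_ofPred_eq, src_eV, tgt_eV, B', mem_box]
            omega
          have h2 := conn_edge (r := ⊥) h3
          have h4 : tgt (eV u.1 (c - 1)) = u := by
            rw [tgt_eV, sub_add_cancel, ← huc]
          rwa [h4] at h2
        refine Setoid.trans' _ h1 (conn_mono le_rfl ?_ huv)
        rintro e ⟨he, hin⟩
        exact ⟨Or.inl ⟨he, hin.1.2.2.1⟩, inside_mono hBB' hin⟩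
    · intro hω
      obtain ⟨w, hw, hwB, hwc⟩ := hE.start _ hω
      obtain ⟨v, hv, hvB, hvd⟩ := hE.goal _ hω
      obtain ⟨h1, h2⟩ := hpend ω hω w hw hwc
      have h3 := hconn ω hω _ h2 v hv
      have h4 := hE.sub_box _ hω (hE.sub _ hω h2)
      simp only [max_self] at h3
      rw [max_eq_left (by omega)] at h3
      exact ⟨(w.1, c), ⟨hBB _ h4 le_rfl, rfl, h1⟩, v, ⟨hBB _ hvB (by omega), hvd⟩,
        conn_mono le_rfl (Set.inter_subset_inter_right _ (inside_mono Set.inter_subset_right)) h3⟩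
  refine ⟨fun ω => W (gated c g ω) ∩ B, fun ω => Q (gated c g ω) ∩ B,
    fun ω _ => Set.inter_subset_right, fun ω hω =>
      Set.inter_subset_inter_left _ (hE.sub _ ((hGG ω).1 hω)), ?_, ?_, ?_, ?_, ?_, ?_, ?_⟩
  · rintro ω hω ⟨x, y⟩ ⟨hv, hv'⟩
    rw [hGG] at hω
    refine ⟨?_, hv⟩
    rcases hv' with hv' | ⟨hy, hxg⟩
    · exact hE.near _ hω ⟨hBB' hv, hv'⟩
    · simp only at hy hxg
      subst hy
      simp only [B, mem_box] at hv
      have hrow : ∀ z, a ≤ z → z ≤ g → (z, y - 1) ∈ W (gated y g ω) := by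
        intro z hz
        induction z, hz using Int.leInduction with
        | base =>
          intro _
          refine hE.near _ hω ⟨?_, rfl⟩
          simp only [B', mem_box]; omega
        | succ z hz ih =>
          intro hzg
          refine hE.step _ hω (eH z (y - 1)) ?_ _ _ (Or.inl ⟨rfl, rfl⟩) (ih (by omega)) ?_
          · simp only [inside, B', mem_box, Set.mem_ofPred_eq, src_eH, tgt_eH]; omega
          · intro h
            have := (hpend ω hω _ h rfl).1
            simp only [src_eH] at this
            omega
      by_cases hxQ : (x, y - 1) ∈ Q (gated y g ω)
      · exact hE.sub _ hω (hpend ω hω _ hxQ rfl).2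
      · refine hE.step _ hω (eV x (y - 1)) ?_ _ _ (Or.inl ⟨rfl, ?_⟩) (hrow x hv.1 hxg) hxQ
        · simp only [inside, B', mem_box, Set.mem_ofPred_eq, src_eV, tgt_eV]; omega
        · simp
  · rintro ω hω v ⟨hv, hvb⟩ hvW
    rw [hGG] at hω
    exact ⟨hE.far _ hω v ⟨hBB' hv, hvb⟩ hvW.1, hv⟩
  · rintro ω hω e he v w hvw hv hvQ
    rw [hGG] at hω
    refine ⟨hE.step _ hω e (inside_mono hBB' he) v w hvw hv.1 fun h => hvQ ⟨h, hv.2⟩, ?_⟩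
    rcases hvw with ⟨-, rfl⟩ | ⟨-, rfl⟩
    exacts [he.2, he.1]
  · intro ω hω u hu v hv
    rw [hGG] at hω
    have := hconn ω hω u hu.1 v hv.1
    rwa [max_eq_left hu.2.2.2.1, max_eq_left hv.2.2.2.1] at this
  · intro ω hω
    rw [hGG] at hω
    obtain ⟨w, hw, hwB, hwc⟩ := hE.start _ hω
    obtain ⟨h1, h2⟩ := hpend ω hω w hw hwc
    have h4 := hBB _ (hE.sub_box _ hω (hE.sub _ hω h2)) le_rfl
    exact ⟨(w.1, c), ⟨h2, h4⟩, h4, rfl, h1⟩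
  · intro ω hω
    rw [hGG] at hω
    obtain ⟨v, hv, hvB, hvd⟩ := hE.goal _ hω
    have h4 := hBB _ hvB (by omega)
    exact ⟨v, ⟨hv, h4⟩, h4, hvd⟩
  · intro ω hω ω' hω'
    rw [hGG] at hω
    have heq : gated c g ω' ∩ inside (W (gated c g ω)) =
        gated c g ω ∩ inside (W (gated c g ω)) := by
      have hiff : ∀ e ∈ inside (W (gated c g ω)), c ≤ (src e).2 → (e ∈ ω' ↔ e ∈ ω) := by
        intro e he hc
        have h1 : e ∈ inside (W (gated c g ω) ∩ B) :=
          ⟨⟨he.1, hBB _ (hE.sub_box _ hω he.1) hc⟩,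
            ⟨he.2, hBB _ (hE.sub_box _ hω he.2) (hc.trans (htgt e))⟩⟩
        have h2 : e ∈ ω' ∩ inside (W (gated c g ω) ∩ B) ↔
            e ∈ ω ∩ inside (W (gated c g ω) ∩ B) := by rw [hω']
        simpa [h1] using h2
      ext e
      constructor
      · rintro ⟨he | he, hin⟩
        exacts [⟨Or.inl ⟨(hiff e hin he.2).1 he.1, he.2⟩, hin⟩, ⟨Or.inr he, hin⟩]
      · rintro ⟨he | he, hin⟩
        exacts [⟨Or.inl ⟨(hiff e hin he.2).2 he.1, he.2⟩, hin⟩, ⟨Or.inr he, hin⟩]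
    obtain ⟨h1, h2, h3⟩ := hE.stopping _ hω _ heq
    exact ⟨(hGG ω').2 h1, by simp only [W, h2], by simp only [Q, h3]⟩

/-! ### Isometries -/

/-- An automorphism of the square lattice, with its action on edges. -/
structure LatticeIso where
  /-- The action on vertices. -/
  σ : ℤ × ℤ ≃ ℤ × ℤ
  /-- The action on edges. -/
  τ : Edge ≃ Edge
  ends : ∀ e, (src (τ e) = σ (src e) ∧ tgt (τ e) = σ (tgt e)) ∨
    (src (τ e) = σ (tgt e) ∧ tgt (τ e) = σ (src e))

namespace LatticeIso

/-- The inverse automorphism. -/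
def symm (I : LatticeIso) : LatticeIso where
  σ := I.σ.symm
  τ := I.τ.symm
  ends e := by
    have := I.ends (I.τ.symm e)
    rw [Equiv.apply_symm_apply] at this
    rcases this with ⟨h1, h2⟩ | ⟨h1, h2⟩
    · exact Or.inl ⟨by rw [h1, Equiv.symm_apply_apply], by rw [h2, Equiv.symm_apply_apply]⟩
    · exact Or.inr ⟨by rw [h2, Equiv.symm_apply_apply], by rw [h1, Equiv.symm_apply_apply]⟩

lemma conn_image_aux (I : LatticeIso) {r s : Setoid (ℤ × ℤ)} (h : r ≤ s.comap I.σ)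
    (ω : Set Edge) : conn r ω ≤ (conn s (I.τ '' ω)).comap I.σ := by
  refine conn_le.2 ⟨fun u v huv => le_conn _ _ (h huv), fun e he => ?_⟩
  have h1 : conn s (I.τ '' ω) (src (I.τ e)) (tgt (I.τ e)) := conn_edge ⟨e, he, rfl⟩
  rw [Setoid.comap_rel]
  rcases I.ends e with ⟨h2, h3⟩ | ⟨h2, h3⟩
  · rwa [← h2, ← h3]
  · rw [← h2, ← h3]; exact Setoid.symm' _ h1

lemma conn_image (I : LatticeIso) {r s : Setoid (ℤ × ℤ)}
    (h : ∀ u v, s (I.σ u) (I.σ v) ↔ r u v) (ω : Set Edge) (u v : ℤ × ℤ) :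
    conn s (I.τ '' ω) (I.σ u) (I.σ v) ↔ conn r ω u v := by
  constructor
  · intro h'
    have h1 : s ≤ r.comap I.symm.σ := fun u v huv => by
      rw [Setoid.comap_rel, ← h]
      simpa [symm] using huv
    have := conn_image_aux I.symm h1 (I.τ '' ω) h'
    rw [Setoid.comap_rel] at this
    have e1 : I.symm.τ '' (I.τ '' ω) = ω := by
      rw [← Set.image_comp]; simp [symm]
    rw [e1] at this
    simpa [symm] using this
  · exact fun h' => conn_image_aux I (fun u v huv => (h u v).2 huv) ω h'

lemma conn_bot_image (I : LatticeIso) (ω : Set Edge) (u v : ℤ × ℤ) :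
    conn ⊥ (I.τ '' ω) (I.σ u) (I.σ v) ↔ conn ⊥ ω u v :=
  I.conn_image (fun u v => by simp) ω u v

lemma mem_inside (I : LatticeIso) {W : Set (ℤ × ℤ)} {e : Edge} :
    I.τ e ∈ inside W ↔ e ∈ inside (I.σ ⁻¹' W) := by
  unfold inside
  simp only [Set.mem_ofPred_eq, Set.mem_preimage]
  rcases I.ends e with ⟨h2, h3⟩ | ⟨h2, h3⟩ <;> rw [h2, h3]
  exact and_comm

lemma image_inter_inside (I : LatticeIso) (ω : Set Edge) (W : Set (ℤ × ℤ)) :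
    I.τ '' (ω ∩ inside (I.σ ⁻¹' W)) = I.τ '' ω ∩ inside W := by
  ext f
  constructor
  · rintro ⟨e, ⟨he, hin⟩, rfl⟩
    exact ⟨⟨e, he, rfl⟩, I.mem_inside.2 hin⟩
  · rintro ⟨⟨e, he, rfl⟩, hin⟩
    exact ⟨e, ⟨he, I.mem_inside.1 hin⟩, rfl⟩

lemma image_mem_crossed (I : LatticeIso) {B A A' : Set (ℤ × ℤ)} {ω : Set Edge} :
    I.τ '' ω ∈ Crossed B A A' ↔ ω ∈ Crossed (I.σ ⁻¹' B) (I.σ ⁻¹' A) (I.σ ⁻¹' A') := by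
  constructor
  · rintro ⟨u, hu, v, hv, huv⟩
    refine ⟨I.σ.symm u, by simpa using hu, I.σ.symm v, by simpa using hv, ?_⟩
    rw [← I.conn_bot_image, I.image_inter_inside]
    simpa using huv
  · rintro ⟨u, hu, v, hv, huv⟩
    rw [← I.conn_bot_image, I.image_inter_inside] at huv
    exact ⟨_, hu, _, hv, huv⟩

end LatticeIso

theorem IsExploration.preimage {B near far s₁ s₂ : Set (ℤ × ℤ)} {W Q : Set Edge → Set (ℤ × ℤ)}
    {G : Set (Set Edge)} (h : IsExploration B near far s₁ s₂ W Q G) (I : LatticeIso) :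
    IsExploration (I.σ ⁻¹' B) (I.σ ⁻¹' near) (I.σ ⁻¹' far) (I.σ ⁻¹' s₁) (I.σ ⁻¹' s₂)
      (fun ω => I.σ ⁻¹' W (I.τ '' ω)) (fun ω => I.σ ⁻¹' Q (I.τ '' ω)) {ω | I.τ '' ω ∈ G} := by
  refine ⟨fun ω hω => Set.preimage_mono (h.sub_box _ hω), fun ω hω =>
    Set.preimage_mono (h.sub _ hω), fun ω hω => Set.preimage_mono (h.near _ hω),
    fun ω hω v hv hv' => h.far _ hω _ hv hv', ?_, ?_, ?_, ?_, ?_⟩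
  · intro ω hω e he v w hvw hv hvQ
    refine h.step _ hω (I.τ e) (I.mem_inside.2 he) (I.σ v) (I.σ w) ?_ hv hvQ
    rcases I.ends e with ⟨h2, h3⟩ | ⟨h2, h3⟩ <;> rcases hvw with ⟨rfl, rfl⟩ | ⟨rfl, rfl⟩ <;>
      simp [h2, h3]
  · intro ω hω u hu v hv
    rw [← I.conn_bot_image, I.image_inter_inside]
    exact h.conn _ hω _ hu _ hv
  · intro ω hω
    obtain ⟨u, hu⟩ := h.start _ hω
    exact ⟨I.σ.symm u, by simpa using hu⟩
  · intro ω hω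
    obtain ⟨u, hu⟩ := h.goal _ hω
    exact ⟨I.σ.symm u, by simpa using hu⟩
  · intro ω hω ω' hω'
    have := h.stopping _ hω (I.τ '' ω') (by
      rw [← I.image_inter_inside, ← I.image_inter_inside]
      exact congrArg (I.τ '' ·) hω')
    exact ⟨this.1, by simp only [this.2.1], by simp only [this.2.2]⟩

/-! ### Probabilities in finite volume -/

/-- The event `A` depends only on the edges of `F`. -/
def DepOn (F : Set Edge) (A : Set (Set Edge)) : Prop :=
  ∀ ω ω' : Set Edge, ω ∩ F = ω' ∩ F → (ω ∈ A ↔ ω' ∈ A)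

lemma DepOn.mono {F F' : Set Edge} {A : Set (Set Edge)} (h : DepOn F A) (hF : F ⊆ F') :
    DepOn F' A := fun ω ω' h' => h ω ω' (by
  rw [← Set.inter_eq_right.2 hF, ← Set.inter_assoc, ← Set.inter_assoc, h'])

lemma DepOn.compl {F : Set Edge} {A : Set (Set Edge)} (h : DepOn F A) : DepOn F Aᶜ :=
  fun ω ω' h' => not_congr (h ω ω' h')

lemma DepOn.inter {F : Set Edge} {A B : Set (Set Edge)} (h : DepOn F A) (h' : DepOn F B) :
    DepOn F (A ∩ B) := fun ω ω' h'' => and_congr (h ω ω' h'') (h' ω ω' h'')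

lemma depOn_crossed (B A A' : Set (ℤ × ℤ)) : DepOn (inside B) (Crossed B A A') := by
  intro ω ω' h
  unfold Crossed
  rw [Set.mem_ofPred_eq, Set.mem_ofPred_eq, h]

/-- The ends of the edges of `E`. -/
def ends (E : Finset Edge) : Finset (ℤ × ℤ) := E.image src ∪ E.image tgt

lemma endsIn_ends (E : Finset Edge) : EndsIn (ends E) E := fun _ he =>
  ⟨Finset.mem_union_left _ (Finset.mem_image_of_mem _ he),
    Finset.mem_union_right _ (Finset.mem_image_of_mem _ he)⟩

/-- The probability of `A` for the measure on the edges `E` with boundary condition `r`, at the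
self-dual point; `x` is the square root of `q`. -/
def pr (x : ℝ) (E : Finset Edge) (r : Setoid (ℤ × ℤ)) (A : Set (Set Edge)) : ℝ :=
  wsum E (wt (ends E) r x) A / wsum E (wt (ends E) r x) Set.univ

lemma wsum_map (τ : Edge ≃ Edge) (E : Finset Edge) (w : Finset Edge → ℝ) (A : Set (Set Edge)) :
    wsum (E.map τ.toEmbedding) w A =
      wsum E (fun ω => w (ω.map τ.toEmbedding)) {ω | τ '' ω ∈ A} := by
  unfold wsum
  refine (Finset.sum_nbij' (fun ω => ω.map τ.toEmbedding) (fun ω => ω.map τ.symm.toEmbedding)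
    ?_ ?_ ?_ ?_ ?_).symm
  · intro ω hω
    exact Finset.mem_powerset.2 (Finset.map_subset_map.2 (Finset.mem_powerset.1 hω))
  · intro ω hω
    have := Finset.map_subset_map (f := τ.symm.toEmbedding).2 (Finset.mem_powerset.1 hω)
    rw [Finset.map_map] at this
    simpa using this
  · intro ω _; rw [Finset.map_map]; simp
  · intro ω _; rw [Finset.map_map]; simp
  · intro ω _
    simp

lemma wt_eq_of_conn_iff (τ : Edge ≃ Edge) {V V' : Finset (ℤ × ℤ)} {r r' : Setoid (ℤ × ℤ)}
    (x : ℝ) (hx : 1 ≤ x) {E : Finset Edge} (hV : EndsIn V E)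
    (hV' : EndsIn V' (E.map τ.toEmbedding))
    (h : ∀ ω ⊆ E, ∀ e ∈ E, conn r ω (src e) (tgt e) ↔
      conn r' (τ '' ω) (src (τ e)) (tgt (τ e))) {ω : Finset Edge} (hω : ω ⊆ E) :
    wt V r x ω * wt V' r' x ∅ = wt V r x ∅ * wt V' r' x (ω.map τ.toEmbedding) := by
  induction ω using Finset.induction_on with
  | empty => simp
  | insert e ω he ih =>
    rw [Finset.insert_subset_iff] at hω
    have IH := ih hω.2
    have hV1 := hV e hω.1
    have hV2 := hV' (τ e) (Finset.mem_map_of_mem _ hω.1)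
    have he' : τ e ∉ ω.map τ.toEmbedding := by simpa using he
    have hcoe : ((ω.map τ.toEmbedding : Finset Edge) : Set Edge) = τ '' ω := by simp
    have hi := h ω hω.2 e hω.1
    have hins : (insert e ω).map τ.toEmbedding = insert (τ e) (ω.map τ.toEmbedding) := by
      rw [Finset.map_insert]; rfl
    rw [hins]
    have hx0 : x ≠ 0 := by positivity
    by_cases hc : conn r ω (src e) (tgt e)
    · rw [wt_insert_of_conn x he hc, wt_insert_of_conn x he' (by rw [hcoe]; exact hi.1 hc)]
      linear_combination x * IH
    · have h1 := wt_insert_of_not_conn x hV1.1 hV1.2 he hc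
      have h2 := wt_insert_of_not_conn (V := V') (r := r') x hV2.1 hV2.2 he'
        (by rw [hcoe]; exact fun h' => hc (hi.2 h'))
      rw [← h1, ← h2] at IH
      refine mul_left_cancel₀ hx0 ?_
      linear_combination IH

lemma wsum_div_eq (τ : Edge ≃ Edge) {V V' : Finset (ℤ × ℤ)} {r r' : Setoid (ℤ × ℤ)}
    {x : ℝ} (hx : 1 ≤ x) {E : Finset Edge} (hV : EndsIn V E)
    (hV' : EndsIn V' (E.map τ.toEmbedding))
    (h : ∀ ω ⊆ E, ∀ e ∈ E, conn r ω (src e) (tgt e) ↔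
      conn r' (τ '' ω) (src (τ e)) (tgt (τ e))) (A : Set (Set Edge)) :
    wsum (E.map τ.toEmbedding) (wt V' r' x) A / wsum (E.map τ.toEmbedding) (wt V' r' x) Set.univ
      = wsum E (wt V r x) {ω | τ '' ω ∈ A} / wsum E (wt V r x) Set.univ := by
  have p1 := wt_pos V r hx ∅
  have p2 := wt_pos V' r' hx ∅
  have key : ∀ B, wt V r x ∅ * wsum (E.map τ.toEmbedding) (wt V' r' x) B
      = wt V' r' x ∅ * wsum E (wt V r x) {ω | τ '' ω ∈ B} := by
    intro B
    rw [wsum_map, ← wsum_const_mul, ← wsum_const_mul]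
    refine wsum_congr (fun _ _ => Iff.rfl) fun ω hω _ => ?_
    rw [← wt_eq_of_conn_iff τ x hx hV hV' h hω, mul_comm]
  have k1 := key A
  have k2 := key Set.univ
  have e1 : {ω : Set Edge | τ '' ω ∈ Set.univ} = Set.univ := by simp
  rw [e1] at k2
  have z1 : 0 < wsum E (wt V r x) Set.univ := wsum_univ_pos (wt_pos V r hx)
  have z2 : 0 < wsum (E.map τ.toEmbedding) (wt V' r' x) Set.univ :=
    wsum_univ_pos (wt_pos V' r' hx)
  rw [div_eq_div_iff z2.ne' z1.ne']
  refine mul_left_cancel₀ (mul_pos p1 p2).ne' ?_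
  linear_combination (wt V' r' x ∅ * wsum E (wt V r x) Set.univ) * k1
    - (wt V' r' x ∅ * wsum E (wt V r x) {ω | τ '' ω ∈ A}) * k2

lemma pr_map (τ : Edge ≃ Edge) {r r' : Setoid (ℤ × ℤ)} {x : ℝ} (hx : 1 ≤ x) {E : Finset Edge}
    (h : ∀ ω ⊆ E, ∀ e ∈ E, conn r ω (src e) (tgt e) ↔
      conn r' (τ '' ω) (src (τ e)) (tgt (τ e))) (A : Set (Set Edge)) :
    pr x (E.map τ.toEmbedding) r' A = pr x E r {ω | τ '' ω ∈ A} :=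
  wsum_div_eq τ hx (endsIn_ends _) (endsIn_ends _) h A

lemma pr_eq {V : Finset (ℤ × ℤ)} {x : ℝ} (hx : 1 ≤ x) {E : Finset Edge} (hV : EndsIn V E)
    (r : Setoid (ℤ × ℤ)) (A : Set (Set Edge)) :
    pr x E r A = wsum E (wt V r x) A / wsum E (wt V r x) Set.univ := by
  have := wsum_div_eq (Equiv.refl Edge) (V := V) (V' := ends E) (r := r) (r' := r) hx hV
    (by simpa using endsIn_ends E) (fun ω _ e _ => by rw [Equiv.coe_refl, Set.image_id]; rfl) A
  simpa [pr] using this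

lemma pr_congr {r r' : Setoid (ℤ × ℤ)} {x : ℝ} (hx : 1 ≤ x) {E : Finset Edge}
    (h : ∀ ω ⊆ E, ∀ e ∈ E, conn r ω (src e) (tgt e) ↔ conn r' ω (src e) (tgt e))
    (A : Set (Set Edge)) : pr x E r A = pr x E r' A := by
  have := pr_map (Equiv.refl Edge) (r := r') (r' := r) hx (E := E)
    (fun ω hω e he => by rw [Equiv.coe_refl, Set.image_id]; exact (h ω hω e he).symm) A
  simpa using this

section pr
variable {x : ℝ} (hx : 1 ≤ x) {E : Finset Edge} {r : Setoid (ℤ × ℤ)}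
include hx

lemma pr_mono {A B : Set (Set Edge)} (h : ∀ ω ⊆ (E : Set Edge), ω ∈ A → ω ∈ B) :
    pr x E r A ≤ pr x E r B :=
  div_le_div_of_nonneg_right (wsum_mono (fun ω => (wt_pos _ r hx ω).le) fun ω hω =>
    h ω (Finset.coe_subset.2 hω)) (wsum_nonneg (fun ω => (wt_pos _ r hx ω).le) _)

lemma pr_nonneg (A : Set (Set Edge)) : 0 ≤ pr x E r A :=
  div_nonneg (wsum_nonneg (fun ω => (wt_pos _ r hx ω).le) _)
    (wsum_nonneg (fun ω => (wt_pos _ r hx ω).le) _)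

lemma pr_univ : pr x E r Set.univ = 1 :=
  div_self (wsum_univ_pos (wt_pos _ r hx)).ne'

lemma pr_add_compl (A : Set (Set Edge)) : pr x E r A + pr x E r Aᶜ = 1 := by
  rw [pr, pr, ← add_div, wsum_add_compl]
  exact pr_univ hx

lemma pr_le_one (A : Set (Set Edge)) : pr x E r A ≤ 1 := by
  have := pr_add_compl hx (E := E) (r := r) A
  have := pr_nonneg hx (E := E) (r := r) Aᶜ
  linarith

/-- The FKG inequality. -/
lemma pr_fkg {A B : Set (Set Edge)} (hA : IsUpperSet A) (hB : IsUpperSet B) :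
    pr x E r A * pr x E r B ≤ pr x E r (A ∩ B) := by
  have h := fkg_of_local (S := E) (wt_pos (ends E) r hx)
    (fun ω₁ _ ω₂ _ h12 e he he2 => wt_local le_rfl hx h12 (endsIn_ends E e he).1
      (endsIn_ends E e he).2 he2) hA hB
  have hz := wsum_univ_pos (S := E) (wt_pos (ends E) r hx)
  unfold pr
  rw [div_mul_div_comm, div_le_div_iff₀ (mul_pos hz hz) hz]
  nlinarith [mul_le_mul_of_nonneg_right h hz.le]

end pr

/-! ### The domain Markov property -/

lemma wsum_union {E F : Finset Edge} (h : Disjoint E F) (w : Finset Edge → ℝ)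
    (A : Set (Set Edge)) : wsum (E ∪ F) w A =
      ∑ ψ ∈ F.powerset, wsum E (fun ω => w (ψ ∪ ω)) {ω | (ψ : Set Edge) ∪ ω ∈ A} := by
  unfold wsum
  rw [Finset.sum_sigma']
  refine (Finset.sum_nbij' (fun p : (_ : Finset Edge) × Finset Edge => p.1 ∪ p.2)
    (fun ω => ⟨ω ∩ F, ω ∩ E⟩) ?_ ?_ ?_ ?_ ?_).symm
  · rintro ⟨ψ, ω⟩ hp
    simp only [Finset.mem_sigma, Finset.mem_powerset] at hp ⊢
    exact Finset.union_subset (hp.1.trans Finset.subset_union_right)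
      (hp.2.trans Finset.subset_union_left)
  · intro ω _
    simp
  · rintro ⟨ψ, ω⟩ hp
    simp only [Finset.mem_sigma, Finset.mem_powerset] at hp
    have hd := Finset.disjoint_left.1 h
    have e1 : (ψ ∪ ω) ∩ F = ψ := by
      ext e; simp only [Finset.mem_inter, Finset.mem_union]
      exact ⟨fun ⟨h1, h2⟩ => h1.resolve_right fun h3 => hd (hp.2 h3) h2,
        fun h1 => ⟨Or.inl h1, hp.1 h1⟩⟩
    have e2 : (ψ ∪ ω) ∩ E = ω := by
      ext e; simp only [Finset.mem_inter, Finset.mem_union]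
      exact ⟨fun ⟨h1, h2⟩ => h1.resolve_left fun h3 => hd h2 (hp.1 h3),
        fun h1 => ⟨Or.inr h1, hp.2 h1⟩⟩
    simp only [e1, e2]
  · intro ω hω
    rw [Finset.mem_powerset] at hω
    simp only
    rw [← Finset.inter_union_distrib_left, Finset.union_comm F E, Finset.inter_eq_left.2 hω]
  · rintro ⟨ψ, ω⟩ _
    simp

lemma wsum_insert_le {x : ℝ} (hx : 1 ≤ x) {V : Finset (ℤ × ℤ)} {r : Setoid (ℤ × ℤ)}
    {E F : Finset Edge} (h : Disjoint E F) (hV : EndsIn V (E ∪ F)) :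
    wsum (E ∪ F) (wt V r x) Set.univ ≤ (1 + x) ^ F.card * wsum E (wt V r x) Set.univ := by
  induction F using Finset.induction_on with
  | empty => simp
  | insert e F he ih =>
    rw [Finset.disjoint_insert_right] at h
    have heEF : e ∉ E ∪ F := by simp [h.1, he]
    have hVe := hV e (by simp)
    rw [Finset.union_insert, wsum_univ, Finset.sum_powerset_insert heEF, ← wsum_univ,
      Finset.card_insert_of_notMem he, pow_succ]
    have IH := ih h.2 (hV.mono (by rw [Finset.union_insert]; exact Finset.subset_insert _ _))
    have : ∑ ω ∈ (E ∪ F).powerset, wt V r x (insert e ω)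
        ≤ x * wsum (E ∪ F) (wt V r x) Set.univ := by
      rw [wsum_univ, Finset.mul_sum]
      refine Finset.sum_le_sum fun ω hω => ?_
      exact wt_insert_le hx hVe.1 hVe.2 fun h' => heEF (Finset.mem_powerset.1 hω h')
    have h1 : (0 : ℝ) ≤ 1 + x := by linarith
    calc _ ≤ (1 + x) * wsum (E ∪ F) (wt V r x) Set.univ := by linarith
      _ ≤ (1 + x) * ((1 + x) ^ F.card * wsum E (wt V r x) Set.univ) :=
        mul_le_mul_of_nonneg_left IH h1
      _ = _ := by ring

/-- The probability of an event that depends on the edges of `E` is an average over the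
configurations outside of `E`, and all the edges outside of `E` are closed with a probability
bounded below. -/
lemma pr_union_mem {x : ℝ} (hx : 1 ≤ x) {E F : Finset Edge} (h : Disjoint E F)
    {r : Setoid (ℤ × ℤ)} {A : Set (Set Edge)} (hA : DepOn E A) {m M ε : ℝ}
    (hm : ∀ ψ ⊆ F, m ≤ pr x E (conn r ψ) A ∧ pr x E (conn r ψ) A ≤ M)
    (hε : ε * (1 + x) ^ F.card ≤ 1) :
    m + ε * (pr x E r A - m) ≤ pr x (E ∪ F) r A ∧
      pr x (E ∪ F) r A ≤ M - ε * (M - pr x E r A) := by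
  set V := ends (E ∪ F)
  have hV : EndsIn V (E ∪ F) := endsIn_ends _
  have hVE : EndsIn V E := hV.mono Finset.subset_union_left
  let z : Finset Edge → ℝ := fun ψ => x ^ ψ.card * wsum E (wt V (conn r ψ) x) Set.univ
  have hz : ∀ ψ, 0 < z ψ := fun ψ => mul_pos (by positivity) (wsum_univ_pos (wt_pos _ _ hx))
  have hsum : ∀ B, DepOn E B → wsum (E ∪ F) (wt V r x) B =
      ∑ ψ ∈ F.powerset, z ψ * pr x E (conn r ψ) B := by
    intro B hB
    rw [wsum_union h]
    refine Finset.sum_congr rfl fun ψ hψ => ?_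
    have hψE : Disjoint (ψ : Set Edge) E := by
      rw [Finset.disjoint_coe]
      exact (h.mono_right (Finset.mem_powerset.1 hψ)).symm
    rw [pr_eq hx hVE, mul_div_assoc', mul_right_comm, mul_div_assoc,
      div_self (wsum_univ_pos (wt_pos _ _ hx)).ne', mul_one, ← wsum_const_mul]
    refine wsum_congr (fun ω hω => hB _ _ ?_) fun ω hω _ => ?_
    · rw [Set.union_inter_distrib_right, hψE.inter_eq, Set.empty_union]
    · exact wt_union V r x ((h.mono_left hω).mono_right (Finset.mem_powerset.1 hψ)).symm
  set Z := wsum (E ∪ F) (wt V r x) Set.univ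
  have hZ : 0 < Z := wsum_univ_pos (wt_pos _ _ hx)
  have hZs : Z = ∑ ψ ∈ F.powerset, z ψ := by
    rw [show Z = _ from hsum Set.univ fun _ _ _ => by simp]
    exact Finset.sum_congr rfl fun ψ _ => by rw [pr_univ hx, mul_one]
  have hz0 : ε * Z ≤ z ∅ := by
    have h1 := wsum_insert_le (r := r) hx h hV
    have h2 : z ∅ = wsum E (wt V r x) Set.univ := by
      simp only [z, Finset.card_empty, pow_zero, one_mul, Finset.coe_empty]
      rw [show conn r ∅ = r from le_antisymm (conn_le.2 ⟨le_rfl, by simp⟩) (le_conn _ _)]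
    rw [h2]
    rcases le_or_gt ε 0 with h3 | h3
    · exact (mul_nonpos_of_nonpos_of_nonneg h3 hZ.le).trans
        (wsum_nonneg (fun ω => (wt_pos _ _ hx ω).le) _)
    · calc ε * Z ≤ ε * ((1 + x) ^ F.card * wsum E (wt V r x) Set.univ) :=
            mul_le_mul_of_nonneg_left h1 h3.le
        _ = ε * (1 + x) ^ F.card * wsum E (wt V r x) Set.univ := by ring
        _ ≤ 1 * wsum E (wt V r x) Set.univ :=
            mul_le_mul_of_nonneg_right hε (wsum_nonneg (fun ω => (wt_pos _ _ hx ω).le) _)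
        _ = _ := one_mul _
  have hr : conn r ((∅ : Finset Edge) : Set Edge) = r := by
    rw [Finset.coe_empty]
    exact le_antisymm (conn_le.2 ⟨le_rfl, by simp⟩) (le_conn _ _)
  have hg := hm ∅ (Finset.empty_subset _)
  rw [hr] at hg
  have hpr : pr x (E ∪ F) r A * Z = ∑ ψ ∈ F.powerset, z ψ * pr x E (conn r ψ) A := by
    rw [← hsum A hA, pr, div_mul_cancel₀ _ hZ.ne']
  have hmem : (∅ : Finset Edge) ∈ F.powerset := Finset.empty_mem_powerset F
  constructor
  · refine le_of_mul_le_mul_right ?_ hZ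
    rw [hpr]
    have h1 : z ∅ * (pr x E r A - m) ≤ ∑ ψ ∈ F.powerset, z ψ * (pr x E (conn r ψ) A - m) := by
      have := Finset.single_le_sum (f := fun ψ : Finset Edge => z ψ * (pr x E (conn r ψ) A - m))
        (fun ψ hψ => mul_nonneg (hz ψ).le
          (sub_nonneg.2 (hm ψ (Finset.mem_powerset.1 hψ)).1)) hmem
      simpa only [hr] using this
    have h2 : ∑ ψ ∈ F.powerset, z ψ * (pr x E (conn r ψ) A - m)
        = ∑ ψ ∈ F.powerset, z ψ * pr x E (conn r ψ) A - m * Z := by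
      rw [hZs, Finset.mul_sum, ← Finset.sum_sub_distrib]
      exact Finset.sum_congr rfl fun ψ _ => by ring
    nlinarith [mul_le_mul_of_nonneg_right hz0 (sub_nonneg.2 hg.1)]
  · refine le_of_mul_le_mul_right ?_ hZ
    rw [hpr]
    have h1 : z ∅ * (M - pr x E r A) ≤ ∑ ψ ∈ F.powerset, z ψ * (M - pr x E (conn r ψ) A) := by
      have := Finset.single_le_sum (f := fun ψ : Finset Edge => z ψ * (M - pr x E (conn r ψ) A))
        (fun ψ hψ => mul_nonneg (hz ψ).le
          (sub_nonneg.2 (hm ψ (Finset.mem_powerset.1 hψ)).2)) hmem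
      simpa only [hr] using this
    have h2 : ∑ ψ ∈ F.powerset, z ψ * (M - pr x E (conn r ψ) A)
        = M * Z - ∑ ψ ∈ F.powerset, z ψ * pr x E (conn r ψ) A := by
      rw [hZs, Finset.mul_sum, ← Finset.sum_sub_distrib]
      exact Finset.sum_congr rfl fun ψ _ => by ring
    nlinarith [mul_le_mul_of_nonneg_right hz0 (sub_nonneg.2 hg.2)]

/-! ### The measure on the strip -/

/-- The edges of the rectangle `[-K, K] × [-N, N]`. -/
def rectE (K N : ℕ) : Finset Edge :=
  ((Finset.univ : Finset Bool) ×ˢ rect K N).filter fun e => e ∈ inside (rect K N)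

lemma mem_rectE {K N : ℕ} {e : Edge} : e ∈ rectE K N ↔ e ∈ inside (rect K N) := by
  unfold rectE
  rw [Finset.mem_filter, and_iff_right_iff_imp]
  intro h
  exact Finset.mem_product.2 ⟨Finset.mem_univ _, h.1⟩

lemma mem_rect {K N : ℕ} {v : ℤ × ℤ} :
    v ∈ rect K N ↔ -(K : ℤ) ≤ v.1 ∧ v.1 ≤ K ∧ -(N : ℤ) ≤ v.2 ∧ v.2 ≤ N := by
  simp [rect, and_assoc]

lemma rect_mono {K L N : ℕ} (h : K ≤ L) : rect K N ⊆ rect L N := fun v hv => by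
  rw [mem_rect] at hv ⊢; omega

lemma rectE_mono {K L N : ℕ} (h : K ≤ L) : rectE K N ⊆ rectE L N := fun e he => by
  rw [mem_rectE] at he ⊢
  exact inside_mono (Finset.coe_subset.2 (rect_mono h)) he

/-- The edges of the strip `ℤ × [-N, N]`. -/
def stripE (N : ℕ) : Set Edge := inside {v | -(N : ℤ) ≤ v.2 ∧ v.2 ≤ N}

lemma rectE_subset_stripE (K N : ℕ) : (rectE K N : Set Edge) ⊆ stripE N := fun e he => by
  rw [Finset.mem_coe, mem_rectE] at he
  exact inside_mono (fun v hv => (mem_rect.1 (Finset.mem_coe.1 hv)).2.2) he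

/-- In the rectangle `[-K, K] × [-N, N]`, the partition `r` wires the top side, and a vertex that is
neither on the top side nor on a lateral side is alone in its class. -/
def Adm (K N : ℕ) (r : Setoid (ℤ × ℤ)) : Prop :=
  (∀ u ∈ rect K N, ∀ v ∈ rect K N, u.2 = N → v.2 = N → r u v) ∧
    ∀ u ∈ rect K N, -(K : ℤ) < u.1 → u.1 < K → u.2 < N → ∀ v, r u v → v = u

/-- The partition in which the points at height `N` are wired. -/
def wireTop (N : ℕ) : Setoid (ℤ × ℤ) := wire {v | v.2 = N}

lemma adm_wireTop (K N : ℕ) : Adm K N (wireTop N) :=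
  ⟨fun u _ v _ hu hv => Or.inr ⟨hu, hv⟩, fun u _ _ _ hu v huv => by
    rcases huv with h | h
    · exact h.symm
    · exact absurd h.1 hu.ne⟩

lemma Adm.mono {K L N : ℕ} (h : K ≤ L) {r : Setoid (ℤ × ℤ)} (hr : Adm L N r) : Adm K N r :=
  ⟨fun u hu v hv => hr.1 u (rect_mono h hu) v (rect_mono h hv),
    fun u hu h1 h2 => hr.2 u (rect_mono h hu) (by omega) (by omega)⟩

/-- Opening edges outside of the rectangle preserves the class of boundary conditions. -/
lemma Adm.conn {K N : ℕ} {r : Setoid (ℤ × ℤ)} (hr : Adm K N r) {ψ : Set Edge}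
    (h1 : ψ ⊆ stripE N) (h2 : Disjoint ψ (rectE K N)) : Adm K N (conn r ψ) := by
  refine ⟨fun u hu v hv hu' hv' => le_conn _ _ (hr.1 u hu v hv hu' hv'),
    fun u hu hu1 hu2 hu3 v huv => ?_⟩
  have hr2 := hr.2 u hu hu1 hu2 hu3
  refine (conn_mem_iff (K := {u}) ?_ ?_ huv).1 rfl
  · intro a b hab
    rw [Setoid.ker_def, eq_iff_iff]
    constructor
    · rintro rfl; exact hr2 _ hab
    · rintro rfl; exact hr2 _ (r.symm hab)
  · intro e he
    have h3 : e ∉ inside (rect K N : Set (ℤ × ℤ)) := fun h =>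
      Set.disjoint_left.1 h2 he (Finset.mem_coe.2 (mem_rectE.2 h))
    have h4 := h1 he
    rw [mem_rect] at hu
    have : src e ≠ u ∧ tgt e ≠ u := by
      constructor <;> rintro rfl <;> rcases e with ⟨_ | _, x, y⟩ <;> apply h3 <;>
        simp only [inside, Set.mem_ofPred_eq, Finset.mem_coe, mem_rect, src_eH, src_eV, tgt_eH,
          tgt_eV, stripE] at hu hu1 hu2 hu3 h4 ⊢ <;> omega
    exact iff_of_false this.1 this.2

lemma conn_iff_of_agree {r r' : Setoid (ℤ × ℤ)} {V : Set (ℤ × ℤ)}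
    (h : ∀ u ∈ V, ∀ v ∈ V, r u v → r' u v) {ω : Set Edge} (hω : ω ⊆ inside V) {u v : ℤ × ℤ}
    (hu : u ∈ V) (hv : v ∈ V) (huv : conn r ω u v) : conn r' ω u v := by
  have key := (conn_mem_iff (K := {w | ∃ w' ∈ V, r w w' ∧ conn r' ω u w'}) ?_ ?_ huv).1
    ⟨u, hu, r.refl u, Setoid.refl' _ u⟩
  · obtain ⟨w', hw', h1, h2⟩ := key
    exact Setoid.trans' _ h2 (le_conn _ _ (h _ hw' _ hv (r.symm h1)))
  · intro a b hab
    rw [Setoid.ker_def, eq_iff_iff]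
    exact ⟨fun ⟨w', h1, h2, h3⟩ => ⟨w', h1, r.trans (r.symm hab) h2, h3⟩,
      fun ⟨w', h1, h2, h3⟩ => ⟨w', h1, r.trans hab h2, h3⟩⟩
  · intro e he
    have hin := hω he
    constructor
    · rintro ⟨w', h1, h2, h3⟩
      exact ⟨tgt e, hin.2, r.refl _, Setoid.trans' _ (Setoid.trans' _ h3
        (le_conn _ _ (h _ h1 _ hin.1 (r.symm h2)))) (conn_edge he)⟩
    · rintro ⟨w', h1, h2, h3⟩
      exact ⟨src e, hin.1, r.refl _, Setoid.trans' _ (Setoid.trans' _ h3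
        (le_conn _ _ (h _ h1 _ hin.2 (r.symm h2)))) (Setoid.symm' _ (conn_edge he))⟩

lemma Adm.pr_eq {K N : ℕ} {r : Setoid (ℤ × ℤ)} (hr : Adm (K + 1) N r) {x : ℝ} (hx : 1 ≤ x)
    (A : Set (Set Edge)) : pr x (rectE K N) r A = pr x (rectE K N) (wireTop N) A := by
  have h1 : ∀ u ∈ (rect K N : Set (ℤ × ℤ)), ∀ v ∈ (rect K N : Set (ℤ × ℤ)),
      r u v ↔ wireTop N u v := by
    intro u hu v hv
    have hu' := mem_rect.1 (Finset.mem_coe.1 hu)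
    have hv' := mem_rect.1 (Finset.mem_coe.1 hv)
    constructor
    · intro huv
      by_cases h2 : u.2 < N
      · exact Or.inl (hr.2 u (rect_mono (by omega) hu) (by push_cast; omega)
          (by push_cast; omega) h2 v huv).symm
      by_cases h3 : v.2 < N
      · exact Or.inl (hr.2 v (rect_mono (by omega) hv) (by push_cast; omega)
          (by push_cast; omega) h3 u (r.symm huv))
      · exact Or.inr ⟨by simp only [Set.mem_ofPred_eq]; omega,
          by simp only [Set.mem_ofPred_eq]; omega⟩
    · rintro (rfl | ⟨h2, h3⟩)
      · exact r.refl u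
      · exact hr.1 u (rect_mono (by omega) hu) v (rect_mono (by omega) hv) h2 h3
  refine pr_congr hx (fun ω hω e he => ?_) A
  have hin := mem_rectE.1 he
  have hω' : (ω : Set Edge) ⊆ inside (rect K N : Set (ℤ × ℤ)) := fun e he => mem_rectE.1 (hω he)
  exact ⟨conn_iff_of_agree (fun u hu v hv => (h1 u hu v hv).1) hω' hin.1 hin.2,
    conn_iff_of_agree (fun u hu v hv => (h1 u hu v hv).2) hω' hin.1 hin.2⟩

lemma card_rectE_succ_sdiff (K N : ℕ) :
    (rectE (K + 1) N \ rectE K N).card ≤ 6 * (2 * N + 1) := by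
  have hsub : rectE (K + 1) N \ rectE K N ⊆ (Finset.univ : Finset Bool) ×ˢ
      (({-(K : ℤ) - 1, (K : ℤ), (K : ℤ) + 1} : Finset ℤ) ×ˢ Finset.Icc (-(N : ℤ)) N) := by
    intro e he
    rw [Finset.mem_sdiff, mem_rectE, mem_rectE] at he
    rcases e with ⟨_ | _, x, y⟩ <;>
      simp only [inside, Set.mem_ofPred_eq, Finset.mem_coe, mem_rect, src_eH, src_eV, tgt_eH,
        tgt_eV, Finset.mem_product, Finset.mem_univ, Finset.mem_insert, Finset.mem_singleton,
        Finset.mem_Icc, true_and] at he ⊢ <;> push_cast at he <;> omega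
  refine (Finset.card_le_card hsub).trans ?_
  rw [Finset.card_product, Finset.card_product, Finset.card_univ, Fintype.card_bool]
  have h1 : ({-(K : ℤ) - 1, (K : ℤ), (K : ℤ) + 1} : Finset ℤ).card ≤ 3 := Finset.card_le_three
  have h2 : (Finset.Icc (-(N : ℤ)) N).card = 2 * N + 1 := by
    rw [Int.card_Icc]; omega
  rw [h2]
  nlinarith

lemma pr_mem_of_rectE {x : ℝ} (hx : 1 ≤ x) {K N : ℕ} {A : Set (Set Edge)}
    (hA : DepOn (rectE K N) A) {m M : ℝ}
    (hm : ∀ r, Adm K N r → m ≤ pr x (rectE K N) r A ∧ pr x (rectE K N) r A ≤ M)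
    {E : Finset Edge} (h1 : rectE K N ⊆ E) (h2 : (E : Set Edge) ⊆ stripE N)
    {r : Setoid (ℤ × ℤ)} (hr : Adm K N r) {ε : ℝ}
    (hε : ε * (1 + x) ^ (E \ rectE K N).card ≤ 1) :
    m + ε * (pr x (rectE K N) r A - m) ≤ pr x E r A ∧
      pr x E r A ≤ M - ε * (M - pr x (rectE K N) r A) := by
  have := pr_union_mem hx (Finset.disjoint_sdiff (s := rectE K N) (t := E)) (r := r) hA
    (m := m) (M := M) (ε := ε) (fun ψ hψ => hm _ (hr.conn ?_ ?_)) hε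
  · rwa [Finset.union_sdiff_of_subset h1] at this
  · exact (Finset.coe_subset.2 (hψ.trans Finset.sdiff_subset)).trans h2
  · rw [Finset.disjoint_coe]
    exact (Finset.disjoint_sdiff.mono_right hψ).symm

/-- Convergence of the probabilities of local events to a limit that depends neither on the
shape of the domain nor on the lateral boundary conditions: a column of closed edges decouples
them, and appears at a positive rate. -/
theorem exists_limit {x : ℝ} (hx : 1 ≤ x) {K₀ N : ℕ} {A : Set (Set Edge)}
    (hA : DepOn (rectE K₀ N) A) :
    ∃ ℓ : ℝ, ∀ δ > 0, ∃ K, K₀ ≤ K ∧ ∀ E : Finset Edge, rectE K N ⊆ E →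
      (E : Set Edge) ⊆ stripE N → ∀ r, Adm K N r → |pr x E r A - ℓ| ≤ δ := by
  set ε : ℝ := ((1 + x) ^ (6 * (2 * N + 1)))⁻¹ with hε
  have hx1 : (1 : ℝ) ≤ 1 + x := by linarith
  have hε0 : 0 < ε := by positivity
  have hε1 : ε ≤ 1 := inv_le_one_of_one_le₀ (one_le_pow₀ hx1)
  have hAK : ∀ K, K₀ ≤ K → DepOn (rectE K N) A := fun K hK =>
    hA.mono (Finset.coe_subset.2 (rectE_mono hK))
  have hstep : ∀ j : ℕ, ∃ m M : ℝ, M - m ≤ (1 - ε) ^ j ∧ ∀ r, Adm (K₀ + j) N r →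
      m ≤ pr x (rectE (K₀ + j) N) r A ∧ pr x (rectE (K₀ + j) N) r A ≤ M := by
    intro j
    induction j with
    | zero => exact ⟨0, 1, by simp, fun r _ => ⟨pr_nonneg hx _, pr_le_one hx _⟩⟩
    | succ j ih =>
      obtain ⟨m, M, hmM, h⟩ := ih
      set γ := pr x (rectE (K₀ + j) N) (wireTop N) A
      refine ⟨m + ε * (γ - m), M - ε * (M - γ), ?_, fun r hr => ?_⟩
      · rw [pow_succ]
        nlinarith [mul_le_mul_of_nonneg_right hmM (sub_nonneg.2 hε1)]
      · have := pr_mem_of_rectE hx (hAK _ (by omega)) h (E := rectE (K₀ + j + 1) N)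
          (rectE_mono (by omega)) (rectE_subset_stripE _ _) (r := r) (hr.mono (by omega)) (ε := ε)
          (by
            rw [hε, inv_mul_le_iff₀ (by positivity), mul_one]
            exact pow_le_pow_right₀ hx1 (card_rectE_succ_sdiff _ _))
        rwa [Adm.pr_eq (K := K₀ + j) hr hx] at this
  choose m M hmM hm using hstep
  have hE : ∀ j, ∀ E : Finset Edge, rectE (K₀ + j) N ⊆ E → (E : Set Edge) ⊆ stripE N →
      ∀ r, Adm (K₀ + j) N r → m j ≤ pr x E r A ∧ pr x E r A ≤ M j := by
    intro j E h1 h2 r hr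
    simpa using pr_mem_of_rectE hx (hAK _ (by omega)) (hm j) h1 h2 hr (ε := 0) (by simp)
  have hlim : Tendsto (fun j : ℕ => (1 - ε) ^ j) atTop (𝓝 0) :=
    tendsto_pow_atTop_nhds_zero_of_lt_one (by linarith) (by linarith)
  let g : ℕ → ℝ := fun j => pr x (rectE (K₀ + j) N) (wireTop N) A
  have hg : ∀ j k, j ≤ k → m j ≤ g k ∧ g k ≤ M j := fun j k hjk =>
    hE j _ (rectE_mono (by omega)) (rectE_subset_stripE _ _) _ (adm_wireTop _ _)
  have hcau : CauchySeq g := by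
    refine cauchySeq_of_le_tendsto_0 (fun j => (1 - ε) ^ j) (fun n k j hn hk => ?_) hlim
    have h1 := hg j n hn
    have h2 := hg j k hk
    have h3 := hmM j
    rw [Real.dist_eq, abs_le]
    constructor <;> linarith
  obtain ⟨ℓ, hℓ⟩ := cauchySeq_tendsto_of_complete hcau
  have hℓm : ∀ j, m j ≤ ℓ ∧ ℓ ≤ M j := fun j =>
    ⟨ge_of_tendsto hℓ (eventually_atTop.2 ⟨j, fun k hk => (hg j k hk).1⟩),
      le_of_tendsto hℓ (eventually_atTop.2 ⟨j, fun k hk => (hg j k hk).2⟩)⟩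
  refine ⟨ℓ, fun δ hδ => ?_⟩
  obtain ⟨j, hj⟩ := ((tendsto_order.1 hlim).2 δ hδ).exists
  refine ⟨K₀ + j, by omega, fun E h1 h2 r hr => ?_⟩
  have h3 := hE j E h1 h2 r hr
  have h4 := hℓm j
  have h5 := hmM j
  rw [abs_le]
  constructor <;> linarith

/-- The probability of a local event in the strip `ℤ × [-N, N]`, wired at the top and free at the
bottom. -/
def strip (x : ℝ) (N : ℕ) (A : Set (Set Edge)) : ℝ :=
  limUnder atTop fun K => pr x (rectE K N) (wireTop N) A

section strip
variable {x : ℝ} (hx : 1 ≤ x) {N : ℕ}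
include hx

theorem strip_spec {K₀ : ℕ} {A : Set (Set Edge)} (hA : DepOn (rectE K₀ N) A) {δ : ℝ}
    (hδ : 0 < δ) : ∃ K, K₀ ≤ K ∧ ∀ E : Finset Edge, rectE K N ⊆ E →
      (E : Set Edge) ⊆ stripE N → ∀ r, Adm K N r → |pr x E r A - strip x N A| ≤ δ := by
  obtain ⟨ℓ, hℓ⟩ := exists_limit hx hA
  have : Tendsto (fun K => pr x (rectE K N) (wireTop N) A) atTop (𝓝 ℓ) := by
    rw [Metric.tendsto_atTop]
    intro ε hε
    obtain ⟨K, -, hK⟩ := hℓ (ε / 2) (by positivity)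
    refine ⟨K, fun L hL => ?_⟩
    rw [Real.dist_eq]
    have := hK _ (rectE_mono hL) (rectE_subset_stripE _ _) _ (adm_wireTop _ _)
    linarith
  rw [strip, this.limUnder_eq]
  exact hℓ δ hδ

lemma tendsto_strip {K₀ : ℕ} {A : Set (Set Edge)} (hA : DepOn (rectE K₀ N) A) :
    Tendsto (fun K => pr x (rectE K N) (wireTop N) A) atTop (𝓝 (strip x N A)) := by
  rw [Metric.tendsto_atTop]
  intro ε hε
  obtain ⟨K, -, hK⟩ := strip_spec hx hA (half_pos hε)
  refine ⟨K, fun L hL => ?_⟩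
  rw [Real.dist_eq]
  have := hK _ (rectE_mono hL) (rectE_subset_stripE _ _) _ (adm_wireTop _ _)
  linarith

lemma strip_add_compl {K₀ : ℕ} {A : Set (Set Edge)} (hA : DepOn (rectE K₀ N) A) :
    strip x N A + strip x N Aᶜ = 1 :=
  tendsto_nhds_unique ((tendsto_strip hx hA).add (tendsto_strip hx hA.compl))
    (by simp [pr_add_compl hx])

/-- Invariance under the automorphisms of the lattice that preserve the strip. -/
lemma strip_image (I : LatticeIso) (hI : ∀ v, (I.σ v).2 = v.2) {K₀ : ℕ} {A : Set (Set Edge)}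
    (hA : DepOn (rectE K₀ N) A) (hA' : DepOn (rectE K₀ N) {ω | I.τ '' ω ∈ A})
    (hK : ∀ K, ∃ L, ∀ v ∈ rect K N, I.σ.symm v ∈ rect L N) :
    strip x N {ω | I.τ '' ω ∈ A} = strip x N A := by
  refine eq_of_abs_sub_le_all fun δ hδ => ?_
  obtain ⟨K, -, h1⟩ := strip_spec hx hA (half_pos hδ)
  obtain ⟨K', -, h2⟩ := strip_spec hx hA' (half_pos hδ)
  obtain ⟨L, hL⟩ := hK K
  set E := rectE (max L K') N
  have e1 := h2 E (rectE_mono (le_max_right _ _)) (rectE_subset_stripE _ _) _ (adm_wireTop _ _)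
  have hmap : pr x (E.map I.τ.toEmbedding) (wireTop N) A
      = pr x E (wireTop N) {ω | I.τ '' ω ∈ A} := by
    refine pr_map I.τ hx (fun ω _ e _ => ?_) A
    have hr : ∀ u v, wireTop N (I.σ u) (I.σ v) ↔ wireTop N u v := fun u v => by
      change (I.σ u = I.σ v ∨ (I.σ u).2 = N ∧ (I.σ v).2 = N) ↔ (u = v ∨ u.2 = N ∧ v.2 = N)
      rw [hI, hI, EmbeddingLike.apply_eq_iff_eq]
    rw [← I.conn_image hr]
    rcases I.ends e with ⟨h3, h4⟩ | ⟨h3, h4⟩ <;> rw [h3, h4]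
    exact ⟨Setoid.symm' _, Setoid.symm' _⟩
  have hstrip : ((E.map I.τ.toEmbedding : Finset Edge) : Set Edge) ⊆ stripE N := by
    intro f hf
    rw [Finset.mem_coe, Finset.mem_map] at hf
    obtain ⟨e, he, rfl⟩ := hf
    have := rectE_subset_stripE _ _ (Finset.mem_coe.2 he)
    have hpre : I.σ ⁻¹' {v : ℤ × ℤ | -(N : ℤ) ≤ v.2 ∧ v.2 ≤ (N : ℤ)} =
        {v : ℤ × ℤ | -(N : ℤ) ≤ v.2 ∧ v.2 ≤ (N : ℤ)} := by
      ext v; simp [hI]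
    rw [Equiv.coe_toEmbedding, stripE, I.mem_inside, hpre]
    exact this
  have hsub : rectE K N ⊆ E.map I.τ.toEmbedding := by
    intro f hf
    rw [Finset.mem_map]
    refine ⟨I.τ.symm f, ?_, by simp⟩
    rw [mem_rectE] at hf ⊢
    refine I.symm.mem_inside.2 (inside_mono (fun v hv => ?_) hf)
    exact Finset.mem_coe.2 (rect_mono (le_max_left _ _) (hL v hv))
  have e2 := h1 _ hsub hstrip _ (adm_wireTop _ _)
  rw [hmap] at e2
  rw [abs_le] at e1 e2 ⊢
  constructor <;> linarith

end strip

/-! ### Self-duality of the measure on the strip -/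

/-- Two edge maps of the shape of a dual map: `f` gives the image of a horizontal edge, which is
vertical, and `g` the image of a vertical edge. -/
def swapEquiv (f g : ℤ × ℤ ≃ ℤ × ℤ) : Edge ≃ Edge where
  toFun e := if e.1 then (false, g e.2) else (true, f e.2)
  invFun e := if e.1 then (false, f.symm e.2) else (true, g.symm e.2)
  left_inv := by rintro ⟨_ | _, x, y⟩ <;> simp
  right_inv := by rintro ⟨_ | _, x, y⟩ <;> simp

/-- Duality followed by the symmetry with respect to a horizontal line that exchanges the bottom side
of the strip, which is free, with its top side, which is wired. -/
def flipDual : DualMap where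
  t := swapEquiv
    ⟨fun v => (v.1, -v.2 - 1), fun v => (v.1, -v.2 - 1), fun v => by simp, fun v => by simp⟩
    ⟨fun v => (v.1 - 1, -v.2 - 1), fun v => (v.1 + 1, -v.2 - 1), fun v => by simp,
      fun v => by simp⟩
  par C v := by
    obtain ⟨x, y⟩ := v
    rw [sum_star]
    simp only [swapEquiv, Equiv.coe_fn_mk, cob, src, tgt, if_true, Bool.false_eq_true, if_false]
    rw [show x - 1 + 1 = x by ring, show -(y - 1) - 1 = -y by ring, show -y - 1 + 1 = -y by ring]
    have h : ∀ z : ZMod 2, z + z = 0 := CharTwo.add_self_eq_zero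
    linear_combination h (C (x, -y - 1)) + h (C (x, -y)) + h (C (x - 1, -y - 1)) + h (C (x - 1, -y))
  par_symm C v := by
    obtain ⟨x, y⟩ := v
    rw [sum_star]
    simp only [swapEquiv, Equiv.coe_fn_symm_mk, cob, src, tgt, if_true, Bool.false_eq_true,
      if_false]
    rw [show x - 1 + 1 = x by ring, show -(y - 1) - 1 = -y by ring, show -y - 1 + 1 = -y by ring]
    have h : ∀ z : ZMod 2, z + z = 0 := CharTwo.add_self_eq_zero
    linear_combination h (C (x, -y - 1)) + h (C (x, -y)) + h (C (x + 1, -y - 1)) + h (C (x + 1, -y))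

@[simp] lemma flipDual_eH (x y : ℤ) : flipDual.t (false, x, y) = (true, x, -y - 1) := rfl
@[simp] lemma flipDual_eV (x y : ℤ) : flipDual.t (true, x, y) = (false, x - 1, -y - 1) := rfl

/-- The vertices `[-M, M - 1] × [-N, N - 1]`. -/
def core (M N : ℕ) : Finset (ℤ × ℤ) :=
  Finset.Icc (-(M : ℤ)) (M - 1) ×ˢ Finset.Icc (-(N : ℤ)) (N - 1)

lemma mem_core {M N : ℕ} {v : ℤ × ℤ} : v ∈ core M N ↔
    -(M : ℤ) ≤ v.1 ∧ v.1 ≤ M - 1 ∧ -(N : ℤ) ≤ v.2 ∧ v.2 ≤ N - 1 := by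
  simp [core, and_assoc]

/-- The edges that start from the vertices `[-M, M - 1] × [-N, N - 1]`. -/
def coreE (M N : ℕ) : Finset Edge := (Finset.univ : Finset Bool) ×ˢ core M N

lemma mem_coreE {M N : ℕ} {e : Edge} : e ∈ coreE M N ↔ src e ∈ core M N := by
  simp [coreE, src]

/-- The outside of the domain is wired. -/
abbrev coreBC (M N : ℕ) : Setoid (ℤ × ℤ) := wire {v | v ∉ core M N}

lemma wire_empty : wire ∅ = ⊥ := by
  ext u v; simp [wire_iff]

lemma cut_core (M N : ℕ) :
    Cut flipDual {v | v ∉ core M N} ∅ {v | v ∉ core M N} ∅ (coreE M N) where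
  disj := Set.disjoint_empty _
  fin := (core M N).finite_toSet.subset fun v hv => by
    by_contra h; exact hv (Or.inl h)
  mem_iff := by
    rintro ⟨_ | _, x, y⟩ <;>
      simp only [mem_coreE, mem_core, Free, src_eH, src_eV, tgt_eH, tgt_eV, flipDual_eH,
        flipDual_eV, Set.mem_ofPred_eq, Set.mem_empty_iff_false, false_and, not_false_eq_true,
        and_true] <;> omega
  ends₁ := fun _ _ _ _ _ _ h => h
  ends₂ := fun _ _ _ _ _ _ h => h

lemma core_dual_conn {M N : ℕ} {ω : Set Edge} (hω : ω ⊆ coreE M N) {e : Edge}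
    (he : e ∈ coreE M N) (hn : ¬ conn (coreBC M N) ω (src e) (tgt e)) :
    conn (coreBC M N) (flipDual.t '' (coreE M N \ insert e ω)) (src (flipDual.t e))
      (tgt (flipDual.t e)) := by
  have := (cut_core M N).dual_conn hω he (by rwa [Set.union_empty])
  rwa [wire_empty, sup_bot_eq] at this

lemma coreBC_full {M N : ℕ} {ω : Set Edge} (h : ∀ v ∈ core M N, eV v.1 v.2 ∈ ω) (u : ℤ × ℤ) :
    conn (coreBC M N) ω u (0, N) := by
  have h0 : ((0, N) : ℤ × ℤ) ∉ core M N := by rw [mem_core]; simp only; omega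
  by_cases hu : u ∈ core M N
  · obtain ⟨x, y⟩ := u
    have hu' := mem_core.1 hu
    simp only at hu'
    have key : ∀ z : ℤ, -(N : ℤ) ≤ z → z ≤ N → conn (coreBC M N) ω (x, -(N : ℤ)) (x, z) := by
      intro z hz
      induction z, hz using Int.leInduction with
      | base => intro _; exact Setoid.refl' _ _
      | succ z hz ih =>
        intro hzN
        refine Setoid.trans' _ (ih (by omega)) ?_
        exact conn_edge (h (x, z) (mem_core.2 (by simp only; omega)))
    refine Setoid.trans' _ (Setoid.trans' _ (Setoid.symm' _ (key y (by omega) (by omega)))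
      (key N (by omega) le_rfl)) (le_conn _ _ (Or.inr ⟨?_, h0⟩))
    rw [Set.mem_ofPred_eq, mem_core]; simp only; omega
  · exact le_conn _ _ (Or.inr ⟨hu, h0⟩)

lemma le_ncl_coreBC (M N : ℕ) :
    (core M N).card + 1 ≤ ncl (rect (M + 1) N) (coreBC M N) := by
  unfold ncl
  have h0 : ((M : ℤ), (N : ℤ)) ∉ core M N := by rw [mem_core]; simp only; omega
  have hinj : Set.InjOn (Quotient.mk (coreBC M N)) (insert ((M : ℤ), (N : ℤ)) (core M N) : Finset (ℤ × ℤ)) := by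
    intro u hu v hv huv
    rcases (Quotient.eq (r := coreBC M N)).1 huv with h | ⟨h1, h2⟩
    · exact h
    · rw [Finset.mem_coe, Finset.mem_insert] at hu hv
      rw [hu.resolve_right h1, hv.resolve_right h2]
  rw [← Finset.card_insert_of_notMem h0, ← Finset.card_image_of_injOn hinj]
  refine Finset.card_le_card (Finset.image_subset_image fun v hv => ?_)
  rw [Finset.mem_insert] at hv
  rcases hv with rfl | hv
  · rw [mem_rect]; simp only; push_cast; omega
  · rw [mem_core] at hv
    rw [mem_rect]; push_cast; omega

lemma ncl_coreBC_full {M N : ℕ} {ω : Set Edge} (h : ∀ v ∈ core M N, eV v.1 v.2 ∈ ω)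
    (V : Finset (ℤ × ℤ)) : ncl V (conn (coreBC M N) ω) ≤ 1 := by
  unfold ncl
  rw [Finset.card_le_one]
  intro a ha b hb
  obtain ⟨u, -, rfl⟩ := Finset.mem_image.1 ha
  obtain ⟨v, -, rfl⟩ := Finset.mem_image.1 hb
  exact (Quotient.eq (r := conn (coreBC M N) ω)).2
    (Setoid.trans' _ (coreBC_full h u) (Setoid.symm' _ (coreBC_full h v)))

lemma endsIn_coreE (M N : ℕ) : EndsIn (rect (M + 1) N) (coreE M N) := by
  rintro ⟨_ | _, x, y⟩ he <;>
    simp only [mem_coreE, mem_core, mem_rect, src_eH, src_eV, tgt_eH, tgt_eV] at he ⊢ <;>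
    push_cast <;> omega

lemma endsIn_coreE_map (M N : ℕ) :
    EndsIn (rect (M + 1) N) ((coreE M N).map flipDual.t.toEmbedding) := by
  intro f hf
  obtain ⟨e, he, rfl⟩ := Finset.mem_map.1 hf
  rcases e with ⟨_ | _, x, y⟩ <;>
    simp only [mem_coreE, mem_core, mem_rect, src_eH, src_eV, tgt_eH, tgt_eV,
      Equiv.coe_toEmbedding, flipDual_eH, flipDual_eV] at he ⊢ <;>
    push_cast <;> omega

lemma ncl_insert_le {V : Finset (ℤ × ℤ)} {r : Setoid (ℤ × ℤ)} {ω : Set Edge} {e : Edge}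
    (hs : src e ∈ V) (ht : tgt e ∈ V) :
    ncl V (conn r ω) ≤ ncl V (conn r (insert e ω)) + 1 := by
  rw [conn_insert]
  by_cases h : conn r ω (src e) (tgt e)
  · rw [sup_link_of_rel h]; omega
  · rw [ncl_sup_link hs ht h]

/-- The dual of the configuration `ω` has as many clusters as predicted by Euler's formula. The
difference of the two sides is monotone along the sequences that open one edge after the other,
by `core_dual_conn`, and it takes the same value for the empty and for the full configuration. -/
lemma ncl_dual {M N : ℕ} {ω : Finset Edge} (hω : ω ⊆ coreE M N) :
    ncl (rect (M + 1) N) (conn (coreBC M N) (flipDual.t '' (coreE M N \ ω))) + (core M N).card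
      = ncl (rect (M + 1) N) (conn (coreBC M N) ω) + ω.card := by
  set V := rect (M + 1) N
  set S := coreE M N
  set r := coreBC M N
  let T : Finset Edge → ℤ := fun ω =>
    (ncl V (conn r (flipDual.t '' (S \ ω))) : ℤ) - ncl V (conn r ω) - ω.card
  have hstep : ∀ ω ⊆ S, ∀ e ∈ S, e ∉ ω → T (insert e ω) ≤ T ω := by
    intro ω hω e he heω
    have hVe := endsIn_coreE M N e he
    have hVe' := endsIn_coreE_map M N (flipDual.t e) (Finset.mem_map_of_mem _ he)
    have himg : flipDual.t '' ((S : Set Edge) \ ω)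
        = insert (flipDual.t e) (flipDual.t '' (S \ (insert e ω : Finset Edge))) := by
      rw [← Set.image_insert_eq]
      congr 1
      ext e'
      simp only [Finset.coe_insert, Set.mem_sdiff, Set.mem_insert_iff, Finset.mem_coe]
      by_cases hee : e' = e
      · subst hee; simp [he, heω]
      · simp [hee]
    simp only [T]
    rw [Finset.card_insert_of_notMem heω, himg]
    by_cases hc : conn r ω (src e) (tgt e)
    · have h1 := ncl_insert_le (V := V) (r := r) (ω := flipDual.t '' (S \ (insert e ω : Finset Edge)))
        hVe'.1 hVe'.2
      rw [Finset.coe_insert e ω, conn_insert r ω, sup_link_of_rel hc]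
      rw [Finset.coe_insert] at h1
      push_cast; omega
    · have h1 : conn r (flipDual.t '' ((S : Set Edge) \ insert e (ω : Set Edge)))
          (src (flipDual.t e)) (tgt (flipDual.t e)) :=
        core_dual_conn (Finset.coe_subset.2 hω) he hc
      have h2 := ncl_sup_link (V := V) hVe.1 hVe.2 hc
      rw [Finset.coe_insert e ω, conn_insert r ω, conn_insert, sup_link_of_rel h1]
      push_cast; omega
  have hmono : ∀ D : Finset Edge, ∀ ω, ω ⊆ S → D ⊆ S → Disjoint D ω → T (D ∪ ω) ≤ T ω := by
    intro D
    induction D using Finset.induction_on with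
    | empty => intro ω _ _ _; simp
    | insert e D he ih =>
      intro ω hω hD hd
      rw [Finset.insert_subset_iff] at hD
      rw [Finset.disjoint_insert_left] at hd
      rw [Finset.insert_union]
      exact (hstep _ (Finset.union_subset hD.2 hω) e hD.1 (by simp [he, hd.1])).trans
        (ih ω hω hD.2 hd.2)
  have h1 : T S ≤ T ω := by
    have := hmono (S \ ω) ω hω Finset.sdiff_subset Finset.sdiff_disjoint
    rwa [Finset.sdiff_union_of_subset hω] at this
  have h2 : T ω ≤ T ∅ := by
    have := hmono ω ∅ (Finset.empty_subset _) hω (Finset.disjoint_empty_right _)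
    rwa [Finset.union_empty] at this
  have hr : conn r ∅ = r := le_antisymm (conn_le.2 ⟨le_rfl, by simp⟩) (le_conn _ _)
  have hcard : S.card = 2 * (core M N).card := by
    simp [S, coreE]
  have hle : (core M N).card + 1 ≤ ncl V r := le_ncl_coreBC M N
  have hS1 : ncl V (conn r (S : Set Edge)) ≤ 1 :=
    ncl_coreBC_full (fun v hv => Finset.mem_coe.2 (mem_coreE.2 hv)) V
  have hS2 : ncl V (conn r (flipDual.t '' S)) ≤ 1 := by
    refine ncl_coreBC_full (fun v hv => (Set.mem_image _ _ _).2 ⟨eH v.1 (-v.2 - 1), ?_, ?_⟩) V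
    · rw [mem_core] at hv
      rw [Finset.mem_coe, mem_coreE, mem_core]
      simp only [src_eH]; omega
    · simp
  simp only [T, Finset.coe_empty, Set.sdiff_empty, Set.sdiff_self, Set.image_empty, hr,
    Finset.card_empty] at h1 h2
  omega

lemma wsum_core_dual (x : ℝ) (M N : ℕ) (A : Set (Set Edge)) :
    wsum ((coreE M N).map flipDual.t.toEmbedding) (wt (rect (M + 1) N) (coreBC M N) x) A =
      wsum (coreE M N) (wt (rect (M + 1) N) (coreBC M N) x)
        {ω | flipDual.t '' (coreE M N \ ω) ∈ A} := by
  rw [← wsum_dual]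
  refine wsum_congr (fun _ _ => Iff.rfl) fun ω' hω' _ => ?_
  set ω : Finset Edge := {e ∈ coreE M N | flipDual.t e ∉ ω'} with hω
  have hsub : ω ⊆ coreE M N := Finset.filter_subset _ _
  have himg : flipDual.t '' ((coreE M N : Set Edge) \ ω) = (ω' : Set Edge) := by
    ext f
    simp only [hω, Set.mem_image, Set.mem_sdiff, Finset.mem_coe, Finset.mem_filter]
    constructor
    · rintro ⟨e, ⟨h1, h2⟩, rfl⟩; tauto
    · intro hf
      obtain ⟨e, he, rfl⟩ := Finset.mem_map.1 (hω' hf)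
      exact ⟨e, ⟨he, fun h => h.2 hf⟩, rfl⟩
  have h1 := ncl_dual hsub
  rw [himg] at h1
  have h2 : ω'.card + ω.card = (coreE M N).card := by
    have h3 : ω' = (coreE M N \ ω).map flipDual.t.toEmbedding := by
      apply Finset.coe_injective
      rw [← himg]; simp
    rw [h3, Finset.card_map, Finset.card_sdiff_add_card_eq_card hsub]
  have hcard : (coreE M N).card = 2 * (core M N).card := by simp [coreE]
  unfold wt
  congr 1
  omega

lemma pr_union_loops {x : ℝ} (hx : 1 ≤ x) {E F : Finset Edge} (h : Disjoint E F)
    {r : Setoid (ℤ × ℤ)} (hr : ∀ e ∈ F, r (src e) (tgt e)) {A : Set (Set Edge)}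
    (hA : DepOn E A) : pr x (E ∪ F) r A = pr x E r A := by
  have := pr_union_mem hx h (r := r) hA (m := pr x E r A) (M := pr x E r A) (ε := 0)
    (fun ψ hψ => by
      have h1 : conn r ψ = r := le_antisymm (conn_le.2 ⟨le_rfl, fun e he => hr e (hψ he)⟩)
        (le_conn _ _)
      rw [h1]; exact ⟨le_rfl, le_rfl⟩) (by simp)
  simp only [zero_mul, add_zero, sub_zero] at this
  exact le_antisymm this.2 this.1

/-- The edges of the rectangle `[-K, K] × [-N, N]`, except those of the top side. -/
def lowE (K N : ℕ) : Set Edge := {e ∈ (rectE K N : Set Edge) | (src e).2 < N}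

lemma lowE_subset (K N : ℕ) : lowE K N ⊆ rectE K N := fun _ he => he.1

lemma lowE_mono {K L : ℕ} (h : K ≤ L) (N : ℕ) : lowE K N ⊆ lowE L N :=
  fun _ he => ⟨Finset.coe_subset.2 (rectE_mono h) he.1, he.2⟩

lemma mem_lowE {K N : ℕ} {e : Edge} :
    e ∈ lowE K N ↔ (src e ∈ rect K N ∧ tgt e ∈ rect K N) ∧ (src e).2 < N := by
  unfold lowE
  rw [Set.mem_sep_iff, Finset.mem_coe, mem_rectE]
  rfl

lemma flipDual_mem_lowE {K N : ℕ} {e : Edge} (he : flipDual.t e ∈ lowE K N) :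
    e ∈ lowE (K + 1) N := by
  rw [mem_lowE] at he ⊢
  rcases e with ⟨_ | _, x, y⟩ <;>
    simp only [mem_rect, flipDual_eH, flipDual_eV, src_eH, src_eV, tgt_eH, tgt_eV] at he ⊢ <;>
    push_cast <;> omega

lemma depOn_dual {K N : ℕ} {A : Set (Set Edge)} (hA : DepOn (lowE K N) A) :
    DepOn (lowE (K + 1) N) {ω | flipDual.t '' ωᶜ ∈ A} := by
  intro ω ω' h
  have : ∀ ω ω' : Set Edge, ω ∩ lowE (K + 1) N = ω' ∩ lowE (K + 1) N →
      flipDual.t '' ωᶜ ∩ lowE K N ⊆ flipDual.t '' ω'ᶜ ∩ lowE K N := by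
    rintro ω ω' h _ ⟨⟨e, he, rfl⟩, hl⟩
    refine ⟨⟨e, fun h' => he ?_, rfl⟩, hl⟩
    have h2 : e ∈ ω' ∩ lowE (K + 1) N := ⟨h', flipDual_mem_lowE hl⟩
    rw [← h] at h2
    exact h2.1
  exact hA _ _ ((this _ _ h).antisymm (this _ _ h.symm))

/-- Self-duality: the dual configuration, turned upside down, has the same law as the
configuration. -/
theorem strip_dual {x : ℝ} (hx : 1 ≤ x) {K N : ℕ} {A : Set (Set Edge)}
    (hA : DepOn (lowE K N) A) : strip x N {ω | flipDual.t '' ωᶜ ∈ A} = strip x N A := by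
  refine eq_of_abs_sub_le_all fun δ hδ => ?_
  have hA' := depOn_dual hA
  obtain ⟨K₁, -, h1⟩ := strip_spec hx (hA.mono (lowE_subset _ _)) (half_pos hδ)
  obtain ⟨K₂, -, h2⟩ := strip_spec hx (hA'.mono (lowE_subset _ _)) (half_pos hδ)
  set M := max (max K₁ K₂) K + 2 with hM
  set top : Finset Edge := (Finset.Icc (-(M : ℤ)) M).image fun z => eH z N
  have htop : ∀ e, e ∈ top ↔ ∃ z : ℤ, (-(M : ℤ) ≤ z ∧ z ≤ M) ∧ eH z N = e := by
    intro e; simp [top]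
  set r := coreBC M N
  have hr : ∀ K ≤ max K₁ K₂, Adm K N r := by
    intro K hK
    refine ⟨fun u _ v _ hu hv => Or.inr ⟨?_, ?_⟩, fun u hu h1 h2 h3 v huv => ?_⟩
    · rw [Set.mem_ofPred_eq, mem_core]; omega
    · rw [Set.mem_ofPred_eq, mem_core]; omega
    · rcases huv with h | h
      · exact h.symm
      · rw [mem_rect] at hu
        exact absurd (mem_core.2 (by omega)) h.1
  have hloop : ∀ e ∈ top, r (src e) (tgt e) := by
    intro e he
    obtain ⟨z, -, rfl⟩ := (htop e).1 he
    refine Or.inr ⟨?_, ?_⟩ <;> rw [Set.mem_ofPred_eq, mem_core] <;> simp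
  set S := coreE M N
  set S' := S.map flipDual.t.toEmbedding
  have hS' : ∀ e, e ∈ S' ↔ ∃ f ∈ S, flipDual.t f = e := fun e => Finset.mem_map
  have hV' : ∀ x y : ℤ, ((true, x, y) : Edge) ∈ S' ↔ -(M : ℤ) ≤ x ∧ x ≤ M - 1 ∧ -(N : ℤ) ≤ y ∧ y ≤ N - 1 := by
    intro x y
    rw [hS']
    constructor
    · rintro ⟨⟨_ | _, a, b⟩, hf, hfe⟩
      · simp only [S, mem_coreE, mem_core, src_eH, flipDual_eH, Prod.mk.injEq, true_and] at hf hfe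
        omega
      · simp at hfe
    · intro h
      refine ⟨eH x (-y - 1), ?_, by simp⟩
      simp only [S, mem_coreE, mem_core, src_eH]; omega
  have hH' : ∀ x y : ℤ, ((false, x, y) : Edge) ∈ S' ↔ -(M : ℤ) ≤ x + 1 ∧ x + 1 ≤ M - 1 ∧ -(N : ℤ) ≤ y ∧ y ≤ N - 1 := by
    intro x y
    rw [hS']
    constructor
    · rintro ⟨⟨_ | _, a, b⟩, hf, hfe⟩
      · simp at hfe
      · simp only [S, mem_coreE, mem_core, src_eV, flipDual_eV, Prod.mk.injEq, true_and] at hf hfe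
        omega
    · intro h
      refine ⟨eV (x + 1) (-y - 1), ?_, by simp⟩
      simp only [S, mem_coreE, mem_core, src_eV]; omega
  have hd : Disjoint S top := by
    rw [Finset.disjoint_left]
    intro e he he'
    obtain ⟨z, -, rfl⟩ := (htop e).1 he'
    simp only [S, mem_coreE, mem_core, src_eH] at he; omega
  have hd' : Disjoint S' top := by
    rw [Finset.disjoint_left]
    intro e he he'
    obtain ⟨z, -, rfl⟩ := (htop e).1 he'
    rw [hH'] at he; omega
  have hstrip : ((S ∪ top : Finset Edge) : Set Edge) ⊆ stripE N := by
    intro e he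
    rw [Finset.mem_coe, Finset.mem_union] at he
    rcases he with he | he
    · rcases e with ⟨_ | _, x, y⟩ <;>
        simp only [S, mem_coreE, mem_core, stripE, inside, Set.mem_ofPred_eq, src_eH, src_eV,
          tgt_eH, tgt_eV] at he ⊢ <;> omega
    · obtain ⟨z, -, rfl⟩ := (htop e).1 he
      simp only [stripE, inside, Set.mem_ofPred_eq, src_eH, tgt_eH]; omega
  have hstrip' : ((S' ∪ top : Finset Edge) : Set Edge) ⊆ stripE N := by
    intro e he
    rw [Finset.mem_coe, Finset.mem_union] at he
    rcases he with he | he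
    · rcases e with ⟨_ | _, x, y⟩ <;> first | rw [hH'] at he | rw [hV'] at he
      all_goals
        simp only [stripE, inside, Set.mem_ofPred_eq, src_eH, src_eV, tgt_eH, tgt_eV]; omega
    · obtain ⟨z, -, rfl⟩ := (htop e).1 he
      simp only [stripE, inside, Set.mem_ofPred_eq, src_eH, tgt_eH]; omega
  have hlow : lowE (max (max K₁ K₂) K + 1) N ⊆ S := by
    intro e he
    rw [mem_lowE] at he
    rcases e with ⟨_ | _, x, y⟩ <;>
      simp only [S, Finset.mem_coe, mem_coreE, mem_core, mem_rect, src_eH, src_eV, tgt_eH,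
        tgt_eV] at he ⊢ <;> omega
  have hlow' : lowE (max (max K₁ K₂) K) N ⊆ S' := by
    intro e he
    rw [mem_lowE] at he
    rcases e with ⟨_ | _, x, y⟩ <;> rw [Finset.mem_coe] <;> first | rw [hH'] | rw [hV']
    all_goals
      simp only [mem_rect, src_eH, src_eV, tgt_eH, tgt_eV] at he ⊢; omega
  have hrect : ∀ L ≤ max (max K₁ K₂) K, ∀ e ∈ rectE L N, e ∉ lowE L N → e ∈ top := by
    intro L hL e he hel
    have h3 : ¬ (src e).2 < N := fun h => hel ⟨he, h⟩
    rw [mem_rectE] at he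
    rw [htop]
    rcases e with ⟨_ | _, x, y⟩
    · simp only [inside, Set.mem_ofPred_eq, Finset.mem_coe, mem_rect, src_eH, tgt_eH] at he h3
      refine ⟨x, by omega, ?_⟩
      rw [show y = N by omega]
    · exfalso
      simp only [inside, Set.mem_ofPred_eq, Finset.mem_coe, mem_rect, src_eV, tgt_eV] at he h3
      omega
  have hsub : rectE K₂ N ⊆ S ∪ top := fun e he => by
    by_cases h : e ∈ lowE K₂ N
    · exact Finset.mem_union_left _ (Finset.mem_coe.1 (hlow (lowE_mono (by omega) N h)))
    · exact Finset.mem_union_right _ (hrect K₂ (by omega) e he h)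
  have hsub' : rectE K₁ N ⊆ S' ∪ top := fun e he => by
    by_cases h : e ∈ lowE K₁ N
    · exact Finset.mem_union_left _ (Finset.mem_coe.1 (hlow' (lowE_mono (by omega) N h)))
    · exact Finset.mem_union_right _ (hrect K₁ (by omega) e he h)
  have e1 := h1 _ hsub' hstrip' r (hr _ (le_max_left _ _))
  have e2 := h2 _ hsub hstrip r (hr _ (le_max_right _ _))
  rw [pr_union_loops hx hd' hloop (hA.mono ((lowE_mono (by omega) N).trans hlow')),
    pr_eq hx (endsIn_coreE_map M N), wsum_core_dual, wsum_core_dual] at e1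
  rw [pr_union_loops hx hd hloop (hA'.mono ((lowE_mono (by omega) N).trans hlow)),
    pr_eq hx (endsIn_coreE M N)] at e2
  have e3 : wsum S (wt (rect (M + 1) N) r x) {ω | flipDual.t '' (S \ ω) ∈ A} =
      wsum S (wt (rect (M + 1) N) r x) {ω | flipDual.t '' ωᶜ ∈ A} := by
    refine wsum_congr (fun ω _ => hA _ _ ?_) fun _ _ _ => rfl
    ext f
    constructor
    · rintro ⟨⟨e, he, rfl⟩, hl⟩
      exact ⟨⟨e, he.2, rfl⟩, hl⟩
    · rintro ⟨⟨e, he, rfl⟩, hl⟩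
      exact ⟨⟨e, ⟨hlow (lowE_mono (by omega) N (flipDual_mem_lowE hl)), he⟩, rfl⟩, hl⟩
  have e4 : {ω : Set Edge | flipDual.t '' (S \ ω) ∈ Set.univ} = Set.univ := by simp
  rw [e3, e4] at e1
  rw [abs_le] at e1 e2 ⊢
  constructor <;> linarith

/-! ### Conditioning on explorations -/

/-- A lower bound on the conditional probability of `T` given the states of the edges outside of a
random set `S ω`, which is itself determined by these states, gives a lower bound on the
probability of `T`. -/
theorem wsum_le_of_stopping {V : Finset (ℤ × ℤ)} {r : Setoid (ℤ × ℤ)} {x : ℝ} (hx : 1 ≤ x)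
    {E : Finset Edge} {G T : Set (Set Edge)} {S : Set Edge → Set Edge} {C : ℝ} (hC : 0 ≤ C)
    (hdet : ∀ ω ∈ G, ∀ ω', ω' \ S ω = ω \ S ω → ω' ∈ G ∧ S ω' = S ω)
    (hcond : ∀ ω : Finset Edge, ω ⊆ E → (ω : Set Edge) ∈ G →
      wsum {e ∈ E | e ∈ S ω} (wt V (conn r ((ω : Set Edge) \ S ω)) x) Set.univ ≤
        C * wsum {e ∈ E | e ∈ S ω} (wt V (conn r ((ω : Set Edge) \ S ω)) x)
          {ψ : Set Edge | (ω : Set Edge) \ S ω ∪ ψ ∈ T}) :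
    wsum E (wt V r x) G ≤ C * wsum E (wt V r x) T := by
  set Gf : Finset (Finset Edge) := {ω ∈ E.powerset | (ω : Set Edge) ∈ G} with hGf
  let k : Finset Edge → Finset Edge × Finset Edge := fun ω =>
    ({e ∈ E | e ∈ S ω}, {e ∈ ω | e ∉ S ω})
  have hmem : ∀ ω, ω ∈ Gf ↔ ω ⊆ E ∧ (ω : Set Edge) ∈ G := fun ω => by simp [hGf]
  -- the configurations that agree with `ω₀` outside of `S ω₀`
  have hfib : ∀ ω₀ ∈ Gf, ∀ f : Finset Edge → ℝ, ∑ ω ∈ Gf with k ω = k ω₀, f ω =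
      ∑ ψ ∈ ({e ∈ E | e ∈ S ω₀} : Finset Edge).powerset, f ({e ∈ ω₀ | e ∉ S ω₀} ∪ ψ) := by
    intro ω₀ hω₀ f
    obtain ⟨hE₀, hG₀⟩ := (hmem ω₀).1 hω₀
    refine Finset.sum_nbij' (fun ω => {e ∈ ω | e ∈ S ω₀}) (fun ψ => {e ∈ ω₀ | e ∉ S ω₀} ∪ ψ)
      ?_ ?_ ?_ ?_ ?_
    · intro ω hω
      obtain ⟨h1, -⟩ := Finset.mem_filter.1 hω
      rw [hmem] at h1
      exact Finset.mem_powerset.2 (Finset.filter_subset_filter _ h1.1)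
    · intro ψ hψ
      rw [Finset.mem_powerset] at hψ
      have hψS : ∀ e ∈ ψ, e ∈ S ω₀ := fun e he => (Finset.mem_filter.1 (hψ he)).2
      have hagree : ((({e ∈ ω₀ | e ∉ S ω₀} ∪ ψ : Finset Edge) : Set Edge)) \ S ω₀
          = (ω₀ : Set Edge) \ S ω₀ := by
        ext e
        simp only [Finset.coe_union, Set.mem_sdiff, Set.mem_union, Finset.mem_coe,
          Finset.mem_filter]
        have := hψS e
        tauto
      obtain ⟨h1, h2⟩ := hdet ω₀ hG₀ _ hagree
      rw [Finset.mem_filter, hmem]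
      refine ⟨⟨Finset.union_subset ((Finset.filter_subset _ _).trans hE₀)
        (hψ.trans (Finset.filter_subset _ _)), h1⟩, ?_⟩
      simp only [k, h2, Prod.mk.injEq, true_and]
      ext e
      simp only [Finset.mem_filter, Finset.mem_union]
      have := hψS e
      tauto
    · intro ω hω
      obtain ⟨h1, h2⟩ := Finset.mem_filter.1 hω
      rw [hmem] at h1
      have h3 := congrArg Prod.fst h2
      have h4 := congrArg Prod.snd h2
      simp only [k] at h3 h4
      rw [← h4]
      ext e
      have h5 : e ∈ E → (e ∈ S ω ↔ e ∈ S ω₀) := fun he => by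
        have := Finset.ext_iff.1 h3 e
        simpa [he] using this
      simp only [Finset.mem_filter, Finset.mem_union]
      have := @h1.1 e
      tauto
    · intro ψ hψ
      rw [Finset.mem_powerset] at hψ
      ext e
      have := @hψ e
      simp only [Finset.mem_filter, Finset.mem_union] at this ⊢
      tauto
    · intro ω hω
      obtain ⟨h1, h2⟩ := Finset.mem_filter.1 hω
      rw [hmem] at h1
      have h3 := congrArg Prod.fst h2
      have h4 := congrArg Prod.snd h2
      simp only [k] at h3 h4
      congr 1
      rw [← h4]
      ext e
      have h5 : e ∈ E → (e ∈ S ω ↔ e ∈ S ω₀) := fun he => by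
        have := Finset.ext_iff.1 h3 e
        simpa [he] using this
      simp only [Finset.mem_filter, Finset.mem_union]
      have := @h1.1 e
      tauto
  have hG : wsum E (wt V r x) G = ∑ ω ∈ Gf, wt V r x ω := by
    rw [wsum, hGf, Finset.sum_filter]
  have hT : ∑ ω ∈ Gf, (if (ω : Set Edge) ∈ T then wt V r x ω else 0) ≤ wsum E (wt V r x) T :=
    Finset.sum_le_sum_of_subset_of_nonneg (Finset.filter_subset _ _) fun ω _ _ => by
      split_ifs <;> simp [(wt_pos V r hx ω).le]
  rw [hG]
  refine le_trans ?_ (mul_le_mul_of_nonneg_left hT hC)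
  rw [← Finset.sum_fiberwise_of_maps_to (g := k) (t := Gf.image k)
      (fun ω hω => Finset.mem_image_of_mem _ hω),
    ← Finset.sum_fiberwise_of_maps_to (g := k) (t := Gf.image k) (s := Gf)
      (f := fun ω => if (ω : Set Edge) ∈ T then wt V r x ω else 0)
      (fun ω hω => Finset.mem_image_of_mem _ hω), Finset.mul_sum]
  refine Finset.sum_le_sum fun κ hκ => ?_
  obtain ⟨ω₀, hω₀, rfl⟩ := Finset.mem_image.1 hκ
  obtain ⟨hE₀, hG₀⟩ := (hmem ω₀).1 hω₀
  rw [hfib ω₀ hω₀, hfib ω₀ hω₀]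
  have hc := hcond ω₀ hE₀ hG₀
  set η : Finset Edge := {e ∈ ω₀ | e ∉ S ω₀} with hη
  set S' : Finset Edge := {e ∈ E | e ∈ S ω₀} with hS'
  have hη' : (ω₀ : Set Edge) \ S ω₀ = η := by ext e; simp [hη]
  rw [hη'] at hc
  have hd : ∀ ψ ∈ S'.powerset, wt V r x (η ∪ ψ) = x ^ η.card * wt V (conn r η) x ψ := by
    intro ψ hψ
    refine wt_union V r x (Finset.disjoint_left.2 fun e he he' => ?_)
    exact (Finset.mem_filter.1 he).2 (Finset.mem_filter.1 (Finset.mem_powerset.1 hψ he')).2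
  rw [wsum_univ] at hc
  calc ∑ ψ ∈ S'.powerset, wt V r x (η ∪ ψ)
      = x ^ η.card * ∑ ψ ∈ S'.powerset, wt V (conn r η) x ψ := by
        rw [Finset.mul_sum]; exact Finset.sum_congr rfl hd
    _ ≤ x ^ η.card * (C * wsum S' (wt V (conn r η) x) {ψ | (η : Set Edge) ∪ ψ ∈ T}) :=
        mul_le_mul_of_nonneg_left hc (by positivity)
    _ = C * ∑ ψ ∈ S'.powerset,
          (if ((η ∪ ψ : Finset Edge) : Set Edge) ∈ T then wt V r x (η ∪ ψ) else 0) := by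
        rw [mul_left_comm, wsum, Finset.mul_sum]
        congr 1
        refine Finset.sum_congr rfl fun ψ hψ => ?_
        rw [mul_ite, mul_zero, hd ψ hψ, Finset.coe_union]
        rfl

/-- Two successful explorations find crossings that are connected to each other with a conditional
probability at least `1 / (1 + q)`, if the crossing principle applies to the unexplored domain. -/
theorem pr_le_of_explorations {x : ℝ} (hx : 1 ≤ x) {E : Finset Edge} {r : Setoid (ℤ × ℤ)}
    {B₁ near₁ far₁ s₁ s₁' B₂ near₂ far₂ s₂ s₂' R : Set (ℤ × ℤ)}
    {W₁ Q₁ W₂ Q₂ : Set Edge → Set (ℤ × ℤ)} {G₁ G₂ : Set (Set Edge)}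
    (h₁ : IsExploration B₁ near₁ far₁ s₁ s₁' W₁ Q₁ G₁)
    (h₂ : IsExploration B₂ near₂ far₂ s₂ s₂' W₂ Q₂ G₂)
    (hB₁ : B₁ ⊆ R) (hB₂ : B₂ ⊆ R) (hR : inside R ⊆ E) (hE : ∀ v ∈ R, v ∈ ends E) (D : DualMap)
    (hcut : ∀ ω ∈ G₁ ∩ G₂, (Q₁ ω ∩ Q₂ ω).Nonempty ∨ ∃ (𝒲₁ 𝒲₂ : Set (ℤ × ℤ)) (S₀ : Finset Edge)
      (A : Set (ℤ × ℤ)) (e₀ : Edge), Cut D 𝒲₁ 𝒲₂ (Q₁ ω) (Q₂ ω) S₀ ∧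
        (symmDiff 𝒲₁ A).Finite ∧ cob (ind A) e₀ * cob (ind A) (D.t e₀) = 1 ∧
        (∀ e, cob (ind A) e * cob (ind A) (D.t e) ≠ 0 → e = e₀) ∧
        ∀ e ∈ S₀, ∀ f, (f = e ∨ f = D.t e) →
          f ∈ inside R ∧ f ∉ inside (W₁ ω) ∧ f ∉ inside (W₂ ω)) :
    pr x E r (G₁ ∩ G₂) ≤ (1 + x ^ 2) *
      pr x E r {ω | ω ∈ G₁ ∩ G₂ ∧ ∃ a ∈ Q₁ ω, ∃ b ∈ Q₂ ω, conn ⊥ (ω ∩ inside R) a b} := by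
  set V := ends E
  set T : Set (Set Edge) :=
    {ω | ω ∈ G₁ ∩ G₂ ∧ ∃ a ∈ Q₁ ω, ∃ b ∈ Q₂ ω, conn ⊥ (ω ∩ inside R) a b}
  obtain ⟨S, hS⟩ : ∃ S : Set Edge → Set Edge, ∀ ω, S ω = (inside (W₁ ω) ∪ inside (W₂ ω))ᶜ :=
    ⟨_, fun _ => rfl⟩
  have hdet' : ∀ ω ∈ G₁ ∩ G₂, ∀ ω', ω' \ S ω = ω \ S ω →
      ω' ∈ G₁ ∩ G₂ ∧ (W₁ ω' = W₁ ω ∧ Q₁ ω' = Q₁ ω) ∧ (W₂ ω' = W₂ ω ∧ Q₂ ω' = Q₂ ω) := by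
    intro ω hω ω' h
    have hag : ∀ W, inside W ⊆ inside (W₁ ω) ∪ inside (W₂ ω) →
        ω' ∩ inside W = ω ∩ inside W := by
      intro W hW
      have h' : ∀ e, e ∈ ω' \ S ω ↔ e ∈ ω \ S ω := fun e => by rw [h]
      ext e
      have := h' e
      simp only [hS, Set.mem_sdiff, Set.mem_compl_iff, not_not] at this
      have h3 := @hW e
      simp only [Set.mem_inter_iff]
      tauto
    have k1 := h₁.stopping ω hω.1 ω' (hag _ Set.subset_union_left)
    have k2 := h₂.stopping ω hω.2 ω' (hag _ Set.subset_union_right)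
    exact ⟨⟨k1.1, k2.1⟩, k1.2, k2.2⟩
  have hC : (0 : ℝ) ≤ 1 + x ^ 2 := by positivity
  have hz : 0 < wsum E (wt V r x) Set.univ := wsum_univ_pos (wt_pos V r hx)
  have main : wsum E (wt V r x) (G₁ ∩ G₂) ≤ (1 + x ^ 2) * wsum E (wt V r x) T := by
    refine wsum_le_of_stopping hx (S := S) hC (fun ω hω ω' h => ?_) fun ω hωE hω => ?_
    · obtain ⟨k1, k2, k3⟩ := hdet' ω hω ω' h
      exact ⟨k1, by simp only [hS, k2.1, k3.1]⟩
    · set S' : Finset Edge := {e ∈ E | e ∈ S ω} with hS'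
      have hfree : ∀ ψ : Finset Edge, ψ ⊆ S' →
          ((ω : Set Edge) \ S ω ∪ ψ) \ S ω = (ω : Set Edge) \ S ω := by
        intro ψ hψ
        ext e
        have h3 : e ∈ ψ → e ∈ S ω := fun he => (Finset.mem_filter.1 (hψ he)).2
        simp only [Set.mem_sdiff, Set.mem_union, Finset.mem_coe]
        tauto
      -- the crossings found by the explorations consist of explored open edges
      have hwired : ∀ W Q : Set (ℤ × ℤ), Q ⊆ W → W ⊆ R →
          inside W ⊆ inside (W₁ ω) ∪ inside (W₂ ω) →
          (∀ u ∈ Q, ∀ v ∈ Q, conn ⊥ ((ω : Set Edge) ∩ inside Q) u v) →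
          ∀ ψ : Set Edge, wire Q ≤ conn ⊥ (((ω : Set Edge) \ S ω ∪ ψ) ∩ inside R) := by
        intro W Q hQW hWR hW hQ ψ
        refine wire_le fun u hu v hv => conn_mono le_rfl ?_ (hQ u hu v hv)
        rintro e ⟨he, hin⟩
        refine ⟨Or.inl ⟨he, ?_⟩, inside_mono (hQW.trans hWR) hin⟩
        simp only [hS, Set.mem_compl_iff, not_not]
        exact hW (inside_mono hQW hin)
      have hw1 := hwired _ _ (h₁.sub _ hω.1) ((h₁.sub_box _ hω.1).trans hB₁)
        Set.subset_union_left (h₁.conn _ hω.1)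
      have hw2 := hwired _ _ (h₂.sub _ hω.2) ((h₂.sub_box _ hω.2).trans hB₂)
        Set.subset_union_right (h₂.conn _ hω.2)
      have hTmem : ∀ ψ : Finset Edge, ψ ⊆ S' → ∀ a ∈ Q₁ ω, ∀ b ∈ Q₂ ω,
          conn ⊥ (((ω : Set Edge) \ S ω ∪ ψ) ∩ inside R) a b →
          (ω : Set Edge) \ S ω ∪ ψ ∈ T := by
        intro ψ hψ a ha b hb hab
        obtain ⟨k1, k2, k3⟩ := hdet' ω hω _ (hfree ψ hψ)
        exact ⟨k1, a, by rw [k2.2]; exact ha, b, by rw [k3.2]; exact hb, hab⟩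
      have hw0 : ∀ A, 0 ≤ wsum S' (wt V (conn r (↑ω \ S ω)) x) A := fun A =>
        wsum_nonneg (fun ψ => (wt_pos _ _ hx ψ).le) A
      rcases hcut ω hω with ⟨a, ha1, ha2⟩ | ⟨𝒲₁, 𝒲₂, S₀, A, e₀, hc, hA, he₀, hA', hS₀⟩
      · refine le_trans (wsum_mono (fun ψ => (wt_pos _ _ hx ψ).le)
          (B := {ψ : Set Edge | (ω : Set Edge) \ S ω ∪ ψ ∈ T}) fun ψ hψ _ => ?_) ?_
        · exact hTmem ψ hψ a ha1 a ha2 (Setoid.refl' _ _)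
        · have := hw0 {ψ : Set Edge | (ω : Set Edge) \ S ω ∪ ψ ∈ T}
          nlinarith [mul_nonneg (sq_nonneg x) this]
      · obtain ⟨a, ha, -⟩ := h₁.start _ hω.1
        obtain ⟨b, hb, -⟩ := h₂.start _ hω.2
        have haR := hB₁ (h₁.sub_box _ hω.1 (h₁.sub _ hω.1 ha))
        have hbR := hB₂ (h₂.sub_box _ hω.2 (h₂.sub _ hω.2 hb))
        have hin : ∀ e ∈ S₀, ∀ f, (f = e ∨ f = D.t e) → f ∈ S' := by
          intro e he f hf
          obtain ⟨k1, k2, k3⟩ := hS₀ e he f hf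
          refine Finset.mem_filter.2 ⟨Finset.mem_coe.1 (hR k1), ?_⟩
          simp only [hS, Set.mem_compl_iff, Set.mem_union]
          tauto
        have hr : wire (Q₁ ω) ⊔ wire (Q₂ ω) ≤ conn r ((ω : Set Edge) \ S ω) := by
          have k : conn ⊥ ((ω : Set Edge) \ S ω ∪ ∅) ≤ conn r ((ω : Set Edge) \ S ω) :=
            conn_mono bot_le (by simp)
          exact sup_le (((hw1 ∅).trans (conn_mono le_rfl Set.inter_subset_left)).trans k)
            (((hw2 ∅).trans (conn_mono le_rfl Set.inter_subset_left)).trans k)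
        refine (hc.wsum_le hA he₀ hA' hx ((endsIn_ends E).mono (Finset.filter_subset _ _))
          (fun e he => hin e he e (Or.inl rfl)) (fun f hf => ?_) hr ha hb (hE _ haR)
          (hE _ hbR)).trans (mul_le_mul_of_nonneg_left (wsum_mono
            (fun ψ => (wt_pos _ _ hx ψ).le) fun ψ hψ hJ => ?_) hC)
        · obtain ⟨e, he, rfl⟩ := Finset.mem_map.1 hf
          exact hin e he _ (Or.inr rfl)
        · refine hTmem ψ hψ a ha b hb ?_
          have k : conn (wire (Q₁ ω) ⊔ wire (Q₂ ω)) (ψ ∩ (S₀ ∪ D.t '' S₀)) ≤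
              conn ⊥ (((ω : Set Edge) \ S ω ∪ ψ) ∩ inside R) := by
            refine conn_le.2 ⟨sup_le (hw1 ψ) (hw2 ψ), fun f hf => conn_edge ⟨Or.inr hf.1, ?_⟩⟩
            rcases hf.2 with h3 | ⟨e, he, rfl⟩
            exacts [(hS₀ f h3 f (Or.inl rfl)).1, (hS₀ e he _ (Or.inr rfl)).1]
          exact k hJ
  unfold pr
  rw [← mul_div_assoc]
  exact div_le_div_of_nonneg_right main hz.le

/-! ### Symmetries of the lattice, and explorations from each side -/

/-- The reflection that maps the abscissa `x` to `s - x`. -/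
def reflX (s : ℤ) : LatticeIso where
  σ := ⟨fun v => (s - v.1, v.2), fun v => (s - v.1, v.2), fun v => by simp, fun v => by simp⟩
  τ :=
    { toFun := fun e => if e.1 then (true, s - e.2.1, e.2.2) else (false, s - 1 - e.2.1, e.2.2)
      invFun := fun e => if e.1 then (true, s - e.2.1, e.2.2) else (false, s - 1 - e.2.1, e.2.2)
      left_inv := by rintro ⟨_ | _, x, y⟩ <;> simp
      right_inv := by rintro ⟨_ | _, x, y⟩ <;> simp }
  ends := by
    rintro ⟨_ | _, x, y⟩
    · right; simp [src, tgt]; omega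
    · left; simp [src, tgt]

/-- The translation by `s` in the horizontal direction. -/
def transX (s : ℤ) : LatticeIso where
  σ := ⟨fun v => (v.1 + s, v.2), fun v => (v.1 - s, v.2), fun v => by simp, fun v => by simp⟩
  τ := ⟨fun e => (e.1, e.2.1 + s, e.2.2), fun e => (e.1, e.2.1 - s, e.2.2), fun e => by simp,
    fun e => by simp⟩
  ends := by
    rintro ⟨_ | _, x, y⟩
    · left; simp [src, tgt]; omega
    · left; simp [src, tgt]

/-- The rotation by a quarter turn around the origin. -/
def rot : LatticeIso where
  σ := ⟨fun v => (-v.2, v.1), fun v => (v.2, -v.1), fun v => by simp, fun v => by simp⟩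
  τ := swapEquiv
    ⟨fun v => (-v.2, v.1), fun v => (v.2, -v.1), fun v => by simp, fun v => by simp⟩
    ⟨fun v => (-v.2 - 1, v.1), fun v => (v.2, -v.1 - 1), fun v => by simp, fun v => by simp⟩
  ends := by
    rintro ⟨_ | _, x, y⟩
    · left; simp [src, tgt, swapEquiv]
    · right; simp [src, tgt, swapEquiv]; omega

@[simp] lemma reflX_σ (s : ℤ) (v : ℤ × ℤ) : (reflX s).σ v = (s - v.1, v.2) := rfl
@[simp] lemma transX_σ (s : ℤ) (v : ℤ × ℤ) : (transX s).σ v = (v.1 + s, v.2) := rfl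
@[simp] lemma rot_σ (v : ℤ × ℤ) : rot.σ v = (-v.2, v.1) := rfl

lemma reflX_box (s a b c d : ℤ) : (reflX s).σ ⁻¹' box a b c d = box (s - b) (s - a) c d := by
  ext v
  simp only [Set.mem_preimage, reflX_σ, mem_box]
  omega

lemma transX_box (s a b c d : ℤ) : (transX s).σ ⁻¹' box a b c d = box (a - s) (b - s) c d := by
  ext v
  simp only [Set.mem_preimage, transX_σ, mem_box]
  omega

lemma rot_box (a b c d : ℤ) : rot.σ ⁻¹' box (-d) (-c) a b = box a b c d := by
  ext v
  simp only [Set.mem_preimage, rot_σ, mem_box]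
  omega

theorem exists_exploration_left {a b c d : ℤ} (hab : a ≤ b) (hcd : c < d) :
    ∃ W Q, IsExploration (box a b c d) {v ∈ box a b c d | v.1 = a} {v ∈ box a b c d | v.1 = b}
      {v ∈ box a b c d | v.2 = c} {v ∈ box a b c d | v.2 = d} W Q (VCross a b c d) := by
  have h := isExploration_leftmost hab hcd
  have : VCross a b c d = {ω | dualSet ω ∉ HCross (a - 1) b c (d - 1)} :=
    Set.ext fun ω => VCross_iff hab hcd
  exact ⟨_, _, this ▸ h⟩

theorem exists_exploration_right_gated {a b c d g : ℤ} (hag : a ≤ g) (hgb : g ≤ b) (hcd : c < d) :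
    ∃ W Q, IsExploration (box a b c d)
      {v ∈ box a b c d | v.1 = b ∨ v.2 = c ∧ g ≤ v.1} {v ∈ box a b c d | v.1 = a}
      {v ∈ box a b c d | v.2 = c ∧ v.1 ≤ g} {v ∈ box a b c d | v.2 = d} W Q
      (Crossed (box a b c d) {v ∈ box a b c d | v.2 = c ∧ v.1 ≤ g}
        {v ∈ box a b c d | v.2 = d}) := by
  obtain ⟨W, Q, h⟩ := exists_exploration_gated (a := a) (b := b) (g := a + b - g) (by omega)
    (by omega) hcd
  have h' := h.preimage (reflX (a + b))
  simp only [LatticeIso.image_mem_crossed] at h'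
  have e0 : (reflX (a + b)).σ ⁻¹' box a b c d = box a b c d := by
    rw [reflX_box]; congr 1 <;> omega
  have e (P P' : ℤ × ℤ → Prop) (hP : ∀ v, P (a + b - v.1, v.2) ↔ P' v) :
      (reflX (a + b)).σ ⁻¹' {v ∈ box a b c d | P v} = {v ∈ box a b c d | P' v} := by
    have : (reflX (a + b)).σ ⁻¹' {v ∈ box a b c d | P v} =
      {v ∈ (reflX (a + b)).σ ⁻¹' box a b c d | P ((reflX (a + b)).σ v)} := rfl
    rw [this, e0]
    ext v
    simp only [Set.mem_sep_iff, reflX_σ, hP]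
  rw [e0, e _ (fun v => v.1 = b ∨ v.2 = c ∧ g ≤ v.1) (by intro v; dsimp only; omega),
    e _ (fun v => v.1 = a) (by intro v; dsimp only; omega),
    e _ (fun v => v.2 = c ∧ v.1 ≤ g) (by intro v; dsimp only; omega),
    e _ (fun v => v.2 = d) (by intro v; dsimp only; omega)] at h'
  exact ⟨_, _, h'⟩

theorem exists_exploration_right {a b c d : ℤ} (hab : a ≤ b) (hcd : c < d) :
    ∃ W Q, IsExploration (box a b c d) {v ∈ box a b c d | v.1 = b} {v ∈ box a b c d | v.1 = a}
      {v ∈ box a b c d | v.2 = c} {v ∈ box a b c d | v.2 = d} W Q (VCross a b c d) := by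
  obtain ⟨W, Q, h⟩ := exists_exploration_right_gated hab le_rfl hcd
  have e1 : {v ∈ box a b c d | v.1 = b ∨ v.2 = c ∧ b ≤ v.1} = {v ∈ box a b c d | v.1 = b} := by
    ext v; simp only [Set.mem_ofPred_eq, mem_box]; omega
  have e2 : {v ∈ box a b c d | v.2 = c ∧ v.1 ≤ b} = {v ∈ box a b c d | v.2 = c} := by
    ext v; simp only [Set.mem_ofPred_eq, mem_box]; omega
  rw [e1, e2] at h
  exact ⟨W, Q, h⟩

theorem exists_exploration_top {a b c d : ℤ} (hab : a < b) (hcd : c ≤ d) :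
    ∃ W Q, IsExploration (box a b c d) {v ∈ box a b c d | v.2 = d} {v ∈ box a b c d | v.2 = c}
      {v ∈ box a b c d | v.1 = a} {v ∈ box a b c d | v.1 = b} W Q (HCross a b c d) := by
  obtain ⟨W, Q, h⟩ := exists_exploration_left (a := -d) (b := -c) (c := a) (d := b) (by omega) hab
  have h' := h.preimage rot
  unfold VCross at h'
  simp only [LatticeIso.image_mem_crossed] at h'
  have e (P P' : ℤ × ℤ → Prop) (hP : ∀ v, P (-v.2, v.1) ↔ P' v) :
      rot.σ ⁻¹' {v ∈ box (-d) (-c) a b | P v} = {v ∈ box a b c d | P' v} := by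
    have : rot.σ ⁻¹' {v ∈ box (-d) (-c) a b | P v} =
      {v ∈ rot.σ ⁻¹' box (-d) (-c) a b | P (rot.σ v)} := rfl
    rw [this, rot_box]
    ext v
    simp only [Set.mem_sep_iff, rot_σ, hP]
  rw [rot_box, e _ (fun v => v.2 = d) (by intro v; dsimp only; omega),
    e _ (fun v => v.2 = c) (by intro v; dsimp only; omega),
    e _ (fun v => v.1 = a) (by intro v; dsimp only; omega),
    e _ (fun v => v.1 = b) (by intro v; dsimp only; omega)] at h'
  exact ⟨_, _, h'⟩

/-! ### From vertical crossings to horizontal crossings -/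

lemma mem_of_conn {B : Set (ℤ × ℤ)} {ω : Set Edge} {u v : ℤ × ℤ} (hu : u ∈ B)
    (h : conn ⊥ (ω ∩ inside B) u v) : v ∈ B :=
  (conn_bot_mem_iff (fun _ he => iff_of_true he.2.1 he.2.2) h).1 hu

/-- A connection that goes through a whole rectangle contains a crossing of it. -/
lemma HCross_of_conn {a b c d a' b' : ℤ} (hab : a < b) {ω : Set Edge}
    {u v : ℤ × ℤ} (hua : u.1 ≤ a) (hvb : b ≤ v.1)
    (huv : conn ⊥ (ω ∩ inside (box a' b' c d)) u v) : ω ∈ HCross a b c d := by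
  by_contra hn
  set B := box a b c d
  let C : ℤ × ℤ → Prop := fun w => ∃ l ∈ B, l.1 = a ∧ conn ⊥ (ω ∩ inside B) l w
  have hC : ∀ w, C w → w.1 ≠ b := by
    rintro w ⟨l, hl, hla, hlw⟩ hw
    exact hn ⟨l, ⟨hl, hla⟩, w, ⟨mem_of_conn hl hlw, hw⟩, hlw⟩
  have hCe : ∀ e ∈ ω, e ∈ inside B → (C (src e) ↔ C (tgt e)) := fun e he hin =>
    ⟨fun ⟨l, h1, h2, h3⟩ => ⟨l, h1, h2, Setoid.trans' _ h3 (conn_edge ⟨he, hin⟩)⟩,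
      fun ⟨l, h1, h2, h3⟩ => ⟨l, h1, h2, Setoid.trans' _ h3
        (Setoid.symm' _ (conn_edge ⟨he, hin⟩))⟩⟩
  have key := (conn_bot_mem_iff (K := {w | w.1 ≤ a ∨ w.1 ≤ b ∧ C w}) ?_ huv).1 (Or.inl hua)
  · rcases key with h | ⟨h, h'⟩
    · omega
    · exact hC _ h' (le_antisymm h hvb)
  · rintro e ⟨he, hin⟩
    have h1 := hCe e he
    have h2 := hC (src e)
    have h3 : e ∈ inside B → (src e).1 = a → C (src e) := fun h h' =>
      ⟨src e, h.1, h', Setoid.refl' _ _⟩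
    rcases e with ⟨_ | _, x, y⟩
    · simp only [inside, B, mem_box, Set.mem_ofPred_eq, src_eH, tgt_eH] at hin h1 h2 h3 ⊢
      rcases lt_or_ge x a with h | h
      · exact iff_of_true (Or.inl (by omega)) (Or.inl (by omega))
      rcases lt_or_ge x b with h' | h'
      · have h4 := h1 (by omega)
        rcases h.eq_or_lt with h5 | h5
        · have := h4.1 (h3 (by omega) h5.symm)
          exact iff_of_true (Or.inl h5.ge) (Or.inr ⟨by omega, this⟩)
        · rw [← h4]
          have e1 : ¬ x ≤ a := by omega
          have e2 : ¬ x + 1 ≤ a := by omega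
          have e3 : x ≤ b := by omega
          have e4 : x + 1 ≤ b := by omega
          simp [e1, e2, e3, e4]
      · refine iff_of_false ?_ (by omega)
        rintro (h5 | ⟨h5, h6⟩)
        · omega
        · exact h2 h6 (by omega)
    · simp only [inside, B, mem_box, Set.mem_ofPred_eq, src_eV, tgt_eV] at hin h1 h2 h3 ⊢
      rcases le_or_gt x a with h | h
      · exact iff_of_true (Or.inl h) (Or.inl h)
      rcases le_or_gt x b with h' | h'
      · rw [h1 (by omega)]
      · exact iff_of_false (by omega) (by omega)

lemma box_finite (a b c d : ℤ) : (box a b c d).Finite := by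
  refine (Finset.finite_toSet (Finset.Icc a b ×ˢ Finset.Icc c d)).subset fun v hv => ?_
  simp only [mem_box] at hv
  simp only [Finset.coe_product, Finset.coe_Icc, Set.mem_prod, Set.mem_Icc]
  omega

lemma inside_box_finite (a b c d : ℤ) : (inside (box a b c d)).Finite := by
  refine ((Set.finite_univ (α := Bool)).prod (box_finite a b c d)).subset fun e he => ?_
  exact ⟨Set.mem_univ _, he.1⟩

lemma mem_ends_of_inside_box {a b c d : ℤ} (hcd : c < d) {E : Finset Edge}
    (hE : inside (box a b c d) ⊆ E) {v : ℤ × ℤ} (hv : v ∈ box a b c d) : v ∈ ends E := by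
  obtain ⟨x, y⟩ := v
  simp only [mem_box] at hv
  rcases lt_or_ge y d with h | h
  · exact (endsIn_ends E (eV x y) (hE (by
      simp only [inside, mem_box, Set.mem_ofPred_eq, src_eV, tgt_eV]; omega))).1
  · have := (endsIn_ends E (eV x (y - 1)) (hE (by
      simp only [inside, mem_box, Set.mem_ofPred_eq, src_eV, tgt_eV]; omega))).2
    simpa using this

/-- Duality followed by the symmetry with respect to a diagonal, which exchanges the horizontal and
the vertical sides of a square with bottom side at height `c`. -/
def diagDual (c : ℤ) : DualMap where
  t :=
    { toFun := fun e => if e.1 then (true, e.2.2 + 1 - c, e.2.1 - 1 + c)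
        else (false, e.2.2 - c, e.2.1 + c)
      invFun := fun e => if e.1 then (true, e.2.2 + 1 - c, e.2.1 - 1 + c)
        else (false, e.2.2 - c, e.2.1 + c)
      left_inv := by rintro ⟨_ | _, x, y⟩ <;> simp; omega
      right_inv := by rintro ⟨_ | _, x, y⟩ <;> simp; omega }
  par C v := by
    obtain ⟨x, y⟩ := v
    rw [sum_star]
    simp only [Equiv.coe_fn_mk, cob, src, tgt, if_true, Bool.false_eq_true, if_false]
    rw [show x - 1 + c + 1 = x + c by ring, show y - 1 + 1 - c = y - c by ring,
      show y - c + 1 = y + 1 - c by ring]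
    have h : ∀ z : ZMod 2, z + z = 0 := CharTwo.add_self_eq_zero
    linear_combination h (C (y - c, x + c)) + h (C (y + 1 - c, x + c)) +
      h (C (y - c, x - 1 + c)) + h (C (y + 1 - c, x - 1 + c))
  par_symm C v := by
    obtain ⟨x, y⟩ := v
    rw [sum_star]
    simp only [Equiv.coe_fn_symm_mk, cob, src, tgt, if_true, Bool.false_eq_true, if_false]
    rw [show x - 1 + c + 1 = x + c by ring, show y - 1 + 1 - c = y - c by ring,
      show y - c + 1 = y + 1 - c by ring]
    have h : ∀ z : ZMod 2, z + z = 0 := CharTwo.add_self_eq_zero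
    linear_combination h (C (y - c, x + c)) + h (C (y + 1 - c, x + c)) +
      h (C (y - c, x - 1 + c)) + h (C (y + 1 - c, x - 1 + c))

@[simp] lemma diagDual_eH (c x y : ℤ) : (diagDual c).t (false, x, y) = (false, y - c, x + c) := rfl
@[simp] lemma diagDual_eV (c x y : ℤ) :
    (diagDual c).t (true, x, y) = (true, y + 1 - c, x - 1 + c) := rfl

lemma diagDual_diagDual (c : ℤ) (e : Edge) : (diagDual c).t ((diagDual c).t e) = e := by
  rcases e with ⟨_ | _, x, y⟩ <;> simp; omega

/-- An edge that leaves the explored set, and is not inside the explored set, starts from the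
crossing that has been found. -/
lemma IsExploration.mem_of_edge {B near far s₁ s₂ : Set (ℤ × ℤ)} {W Q : Set Edge → Set (ℤ × ℤ)}
    {G : Set (Set Edge)} (h : IsExploration B near far s₁ s₂ W Q G) {ω : Set Edge} (hω : ω ∈ G)
    {e : Edge} (hB : e ∉ inside B → ∀ v, v = src e ∨ v = tgt e → v ∈ W ω → v ∈ far)
    (he : e ∉ inside (W ω)) {v : ℤ × ℤ} (hv : v = src e ∨ v = tgt e) (hvW : v ∈ W ω) :
    v ∈ Q ω := by
  by_contra hvQ
  by_cases hin : e ∈ inside B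
  · rcases hv with rfl | rfl
    · exact he ⟨hvW, h.step ω hω e hin _ _ (Or.inl ⟨rfl, rfl⟩) hvW hvQ⟩
    · exact he ⟨h.step ω hω e hin _ _ (Or.inr ⟨rfl, rfl⟩) hvW hvQ, hvW⟩
  · exact hvQ (h.far ω hω v (hB hin v hv hvW) hvW)

/-- Two narrow rectangles on the left and on the right of a square, or of a wide rectangle, both
crossed vertically: the region between the two crossings is dominated by a square, in which the
crossing principle for the symmetry with respect to the diagonal applies. -/
theorem pr_VCross_mul_le {x : ℝ} (hx : 1 ≤ x) {E : Finset Edge} {r : Setoid (ℤ × ℤ)}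
    {w X c d : ℤ} (hw : 0 ≤ w) (hwX : w < X - w) (hcd : c < d) (hX : X ≤ d - c + 1)
    (hE : inside (box 0 X c d) ⊆ E) :
    pr x E r (VCross 0 w c d) * pr x E r (VCross (X - w) X c d) ≤
      (1 + x ^ 2) * pr x E r (HCross w (X - w) c d) := by
  obtain ⟨W₁, Q₁, h₁⟩ := exists_exploration_left hw hcd
  obtain ⟨W₂, Q₂, h₂⟩ := exists_exploration_right (a := X - w) (b := X) (by omega) hcd
  have hC : (0 : ℝ) ≤ 1 + x ^ 2 := by positivity
  refine (pr_fkg hx (isUpperSet_crossed _ _ _) (isUpperSet_crossed _ _ _)).trans ?_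
  have hB₁ : box 0 w c d ⊆ box 0 X c d := fun v hv => by rw [mem_box] at hv ⊢; omega
  have hB₂ : box (X - w) X c d ⊆ box 0 X c d := fun v hv => by rw [mem_box] at hv ⊢; omega
  refine (pr_le_of_explorations hx h₁ h₂ hB₁ hB₂ hE
    (fun v hv => mem_ends_of_inside_box hcd hE hv) (diagDual c) ?_).trans
    (mul_le_mul_of_nonneg_left (pr_mono hx ?_) hC)
  · intro ω hω
    right
    set R := box 0 X c d with hR
    have hW₁ := h₁.sub_box ω hω.1
    have hW₂ := h₂.sub_box ω hω.2
    have hn₁ := h₁.near ω hω.1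
    have hn₂ := h₂.near ω hω.2
    set 𝒲₁ : Set (ℤ × ℤ) := W₁ ω ∪ {v | v ∉ R ∧ v.1 ≤ w} with h𝒲₁
    set 𝒲₂ : Set (ℤ × ℤ) := W₂ ω ∪ {v | v ∉ R ∧ w < v.1} with h𝒲₂
    have k1 : ∀ a b, a ≤ 0 → (a, b) ∈ 𝒲₁ := fun a b ha => by
      by_cases h : (a, b) ∈ R
      · rw [hR, mem_box] at h
        exact Or.inl (hn₁ ⟨by rw [mem_box]; dsimp only at h ⊢; omega, by dsimp only at h ⊢; omega⟩)
      · exact Or.inr ⟨h, by dsimp only; omega⟩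
    have k2 : ∀ a b, X ≤ a → (a, b) ∈ 𝒲₂ := fun a b ha => by
      by_cases h : (a, b) ∈ R
      · rw [hR, mem_box] at h
        exact Or.inl (hn₂ ⟨by rw [mem_box]; dsimp only at h ⊢; omega, by dsimp only at h ⊢; omega⟩)
      · exact Or.inr ⟨h, by dsimp only; omega⟩
    have k3 : ∀ a b, (b < c ∨ d < b) → a ≤ w → (a, b) ∈ 𝒲₁ := fun a b hb ha =>
      Or.inr ⟨by rw [hR, mem_box]; dsimp only; omega, ha⟩
    have k4 : ∀ a b, (b < c ∨ d < b) → w < a → (a, b) ∈ 𝒲₂ := fun a b hb ha =>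
      Or.inr ⟨by rw [hR, mem_box]; dsimp only; omega, ha⟩
    have hfree : ∀ e, Free 𝒲₁ 𝒲₂ e → Free 𝒲₁ 𝒲₂ ((diagDual c).t e) → e ∈ inside R := by
      rintro ⟨_ | _, a, b⟩ he he'
      · simp only [Free, src_eH, tgt_eH, diagDual_eH] at he he'
        by_contra hin
        simp only [inside, hR, mem_box, Set.mem_ofPred_eq, src_eH, tgt_eH] at hin
        by_cases hb : b < c ∨ d < b
        · have e1 : a = w := by
            by_contra ha
            rcases lt_or_gt_of_ne ha with h | h
            · exact he.1 ⟨k3 _ _ hb h.le, k3 _ _ hb (by omega)⟩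
            · exact he.2 ⟨k4 _ _ hb h, k4 _ _ hb (by omega)⟩
          rcases hb with h | h
          · exact he'.1 ⟨k1 _ _ (by omega), k1 _ _ (by omega)⟩
          · exact he'.2 ⟨k2 _ _ (by omega), k2 _ _ (by omega)⟩
        · rcases lt_or_ge a 0 with h | h
          · exact he.1 ⟨k1 _ _ (by omega), k1 _ _ (by omega)⟩
          · exact he.2 ⟨k2 _ _ (by omega), k2 _ _ (by omega)⟩
      · simp only [Free, src_eV, tgt_eV, diagDual_eV] at he he'
        by_contra hin
        simp only [inside, hR, mem_box, Set.mem_ofPred_eq, src_eV, tgt_eV] at hin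
        rcases lt_or_ge a 0 with h | h
        · exact he.1 ⟨k1 _ _ (by omega), k1 _ _ (by omega)⟩
        rcases lt_or_ge X a with h' | h'
        · exact he.2 ⟨k2 _ _ (by omega), k2 _ _ (by omega)⟩
        rcases lt_or_ge b c with hb | hb
        · exact he'.1 ⟨k1 _ _ (by omega), k1 _ _ (by omega)⟩
        · exact he'.2 ⟨k2 _ _ (by omega), k2 _ _ (by omega)⟩
    -- both `e` and its image are inside the rectangle, since the map is an involution
    have hfree' : ∀ e, Free 𝒲₁ 𝒲₂ e → Free 𝒲₁ 𝒲₂ ((diagDual c).t e) →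
        ∀ f, (f = e ∨ f = (diagDual c).t e) → f ∈ inside R ∧ Free 𝒲₁ 𝒲₂ f := by
      rintro e he he' f (rfl | rfl)
      · exact ⟨hfree _ he he', he⟩
      · exact ⟨hfree _ he' (by rwa [diagDual_diagDual]), he'⟩
    set S₀ : Finset Edge := (inside_box_finite 0 X c d).toFinset.filter
      fun e => Free 𝒲₁ 𝒲₂ e ∧ Free 𝒲₁ 𝒲₂ ((diagDual c).t e) with hS₀
    have hmem : ∀ e, e ∈ S₀ ↔ Free 𝒲₁ 𝒲₂ e ∧ Free 𝒲₁ 𝒲₂ ((diagDual c).t e) := fun e => by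
      rw [hS₀, Finset.mem_filter, Set.Finite.mem_toFinset]
      exact ⟨fun h => h.2, fun h => ⟨hfree e h.1 h.2, h⟩⟩
    have hout : ∀ f, Free 𝒲₁ 𝒲₂ f → f ∉ inside (W₁ ω) ∧ f ∉ inside (W₂ ω) := fun f hf =>
      ⟨fun h => hf.1 ⟨Or.inl h.1, Or.inl h.2⟩, fun h => hf.2 ⟨Or.inl h.1, Or.inl h.2⟩⟩
    have hend : ∀ f ∈ inside R, ∀ v, (v = src f ∨ v = tgt f) → v ∈ R := by
      rintro f hf v (rfl | rfl)
      exacts [hf.1, hf.2]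
    refine ⟨𝒲₁, 𝒲₂, S₀, {v | v.1 ≤ w}, eH w (w + c), ⟨?_, ?_, hmem, ?_, ?_⟩, ?_, ?_, ?_, ?_⟩
    · rw [Set.disjoint_left]
      rintro v (hv | hv) (hv' | hv')
      · have := hW₁ hv; have := hW₂ hv'
        rw [mem_box] at *; omega
      · exact hv'.1 (hB₁ (hW₁ hv))
      · exact hv.1 (hB₂ (hW₂ hv'))
      · exact absurd hv.2 (not_le.2 hv'.2)
    · refine (box_finite 0 X c d).subset fun v hv => by_contra fun h => hv ?_
      rcases le_or_gt v.1 w with h' | h'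
      exacts [Or.inl (Or.inr ⟨h, h'⟩), Or.inr (Or.inr ⟨h, h'⟩)]
    · intro e he f hf v hv hvW
      rw [hmem] at he
      obtain ⟨hfR, hff⟩ := hfree' e he.1 he.2 f hf
      refine h₁.mem_of_edge hω.1 (fun hB v hv hvW => ?_) (hout f hff).1 hv
        (hvW.resolve_right fun h => h.1 (hend f hfR v hv))
      refine ⟨hW₁ hvW, ?_⟩
      have h1 := hW₁ hvW
      rcases f with ⟨_ | _, a, b⟩ <;> rcases hv with rfl | rfl <;>
        simp only [inside, hR, Set.mem_ofPred_eq, mem_box, src_eH, tgt_eH, src_eV, tgt_eV]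
          at hfR hB h1 ⊢ <;> omega
    · intro e he f hf v hv hvW
      rw [hmem] at he
      obtain ⟨hfR, hff⟩ := hfree' e he.1 he.2 f hf
      refine h₂.mem_of_edge hω.2 (fun hB v hv hvW => ?_) (hout f hff).2 hv
        (hvW.resolve_right fun h => h.1 (hend f hfR v hv))
      refine ⟨hW₂ hvW, ?_⟩
      have h1 := hW₂ hvW
      rcases f with ⟨_ | _, a, b⟩ <;> rcases hv with rfl | rfl <;>
        simp only [inside, hR, Set.mem_ofPred_eq, mem_box, src_eH, tgt_eH, src_eV, tgt_eV]
          at hfR hB h1 ⊢ <;> omega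
    · refine (box_finite 0 X c d).subset ?_
      rintro v (⟨hv | hv, hv'⟩ | ⟨hv, hv'⟩)
      · exact hB₁ (hW₁ hv)
      · exact absurd hv.2 hv'
      · by_contra h
        exact hv' (Or.inr ⟨h, hv⟩)
    · rw [cob_ind_eq_one, cob_ind_eq_one, one_mul] <;>
        simp only [diagDual_eH, src_eH, tgt_eH, Set.mem_ofPred_eq] <;> omega
    · rintro ⟨_ | _, a, b⟩ he
      · have h1 := left_ne_zero_of_mul he
        have h2 := right_ne_zero_of_mul he
        rw [Ne, cob_ind_eq_zero] at h1 h2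
        simp only [diagDual_eH, src_eH, tgt_eH, Set.mem_ofPred_eq] at h1 h2
        simp only [Prod.mk.injEq, true_and]
        omega
      · refine absurd (left_ne_zero_of_mul he) (not_not.2 ?_)
        rw [cob_ind_eq_zero]
        exact Iff.rfl
    · intro e he f hf
      rw [hmem] at he
      obtain ⟨hfR, hff⟩ := hfree' e he.1 he.2 f hf
      exact ⟨hfR, hout f hff⟩
  · rintro ω - ⟨hω, a, ha, b, hb, hab⟩
    have h1 := h₁.sub_box ω hω.1 (h₁.sub ω hω.1 ha)
    have h2 := h₂.sub_box ω hω.2 (h₂.sub ω hω.2 hb)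
    exact HCross_of_conn hwX h1.2.1 h2.1 hab

/-! ### Extending horizontal crossings -/

/-- Duality followed by the symmetry with respect to a vertical line close to the abscissa `L`. -/
def vertDual (L : ℤ) : DualMap where
  t := swapEquiv
    ⟨fun v => (2 * L - v.1, v.2), fun v => (2 * L - v.1, v.2), fun v => by simp, fun v => by simp⟩
    ⟨fun v => (2 * L - v.1, v.2 + 1), fun v => (2 * L - v.1, v.2 - 1), fun v => by simp,
      fun v => by simp⟩
  par C v := by
    obtain ⟨x, y⟩ := v
    rw [sum_star]
    simp only [swapEquiv, Equiv.coe_fn_mk, cob, src, tgt, if_true, Bool.false_eq_true, if_false]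
    rw [show 2 * L - (x - 1) = 2 * L - x + 1 by ring, show y - 1 + 1 = y by ring]
    have h : ∀ z : ZMod 2, z + z = 0 := CharTwo.add_self_eq_zero
    linear_combination h (C (2 * L - x, y)) + h (C (2 * L - x, y + 1)) +
      h (C (2 * L - x + 1, y)) + h (C (2 * L - x + 1, y + 1))
  par_symm C v := by
    obtain ⟨x, y⟩ := v
    rw [sum_star]
    simp only [swapEquiv, Equiv.coe_fn_symm_mk, cob, src, tgt, if_true, Bool.false_eq_true,
      if_false]
    rw [show 2 * L - (x - 1) = 2 * L - x + 1 by ring, show y - 1 + 1 = y by ring]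
    have h : ∀ z : ZMod 2, z + z = 0 := CharTwo.add_self_eq_zero
    linear_combination h (C (2 * L - x, y)) + h (C (2 * L - x, y - 1)) +
      h (C (2 * L - x + 1, y)) + h (C (2 * L - x + 1, y - 1))

@[simp] lemma vertDual_eH (L x y : ℤ) : (vertDual L).t (false, x, y) = (true, 2 * L - x, y) := rfl
@[simp] lemma vertDual_eV (L x y : ℤ) :
    (vertDual L).t (true, x, y) = (false, 2 * L - x, y + 1) := rfl

/-- A set of vertices connected by edges that do not leave `K` is disjoint from `K`, if one of its
points is not in `K`. -/
lemma disjoint_of_conn {ω : Set Edge} {Q K : Set (ℤ × ℤ)}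
    (hQ : ∀ u ∈ Q, ∀ v ∈ Q, conn ⊥ (ω ∩ inside Q) u v)
    (hK : ∀ e ∈ inside Q, (src e ∈ K ↔ tgt e ∈ K)) {u : ℤ × ℤ} (hu : u ∈ Q) (huK : u ∉ K) :
    Disjoint Q K :=
  Set.disjoint_left.2 fun v hv hvK =>
    huK ((conn_bot_mem_iff (fun e he => hK e he.2) (hQ u hu v hv)).2 hvK)

/-- The event that the left side of `[0, s'] × [c, d]` is connected to a vertical crossing of
`[s, s'] × [c, d]`. -/
def LeftToVCross (s s' c d : ℤ) : Set (Set Edge) :=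
  {ω | ∃ u ∈ box 0 s' c d, ∃ v ∈ box s s' c d, ∃ v', u.1 = 0 ∧ v.2 = c ∧ v'.2 = d ∧
    conn ⊥ (ω ∩ inside (box s s' c d)) v v' ∧ conn ⊥ (ω ∩ inside (box 0 s' c d)) u v}

lemma isUpperSet_leftToVCross (s s' c d : ℤ) : IsUpperSet (LeftToVCross s s' c d) := by
  rintro ω ω' h ⟨u, hu, v, hv, v', h1, h2, h3, h4, h5⟩
  exact ⟨u, hu, v, hv, v', h1, h2, h3, conn_mono le_rfl (Set.inter_subset_inter_left _ h) h4,
    conn_mono le_rfl (Set.inter_subset_inter_left _ h) h5⟩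

/-- The topmost horizontal crossing of `[0, L] × [c, d]` and the rightmost vertical crossing of
`[s, s'] × [c, d]` that starts on the left of `L` are connected with a conditional probability at
least `1 / (1 + q)`. The region below the former and on the left of the latter is compared to its
image under the symmetry with respect to the vertical line through the corner `(L, c)`. -/
theorem pr_inter_le_leftToVCross {x : ℝ} (hx : 1 ≤ x) {E : Finset Edge} {r : Setoid (ℤ × ℤ)}
    {L s s' c d : ℤ} (hs : 0 < s) (hsL : s ≤ L) (hL : L < s') (hs' : s' ≤ 2 * L) (hcd : c < d)
    (hE : inside (box 0 s' c d) ⊆ E) :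
    pr x E r (HCross 0 L c d ∩ Crossed (box s s' c d) {v ∈ box s s' c d | v.2 = c ∧ v.1 ≤ L}
        {v ∈ box s s' c d | v.2 = d}) ≤
      (1 + x ^ 2) * pr x E r (LeftToVCross s s' c d) := by
  obtain ⟨W₁, Q₁, h₁⟩ := exists_exploration_top (a := 0) (b := L) (by omega) hcd.le
  obtain ⟨W₂, Q₂, h₂⟩ := exists_exploration_right_gated hsL hL.le hcd
  have hC : (0 : ℝ) ≤ 1 + x ^ 2 := by positivity
  have hB₁ : box 0 L c d ⊆ box 0 s' c d := fun v hv => by rw [mem_box] at hv ⊢; omega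
  have hB₂ : box s s' c d ⊆ box 0 s' c d := fun v hv => by rw [mem_box] at hv ⊢; omega
  refine (pr_le_of_explorations hx h₁ h₂ hB₁ hB₂ hE
    (fun v hv => mem_ends_of_inside_box hcd hE hv) (vertDual L) ?_).trans
    (mul_le_mul_of_nonneg_left (pr_mono hx ?_) hC)
  · intro ω hω
    rw [or_iff_not_imp_left, Set.not_nonempty_iff_eq_empty, ← Set.disjoint_iff_inter_eq_empty]
    intro hQQ
    set R := box 0 s' c d with hR
    have hW₁ := h₁.sub_box ω hω.1
    have hW₂ := h₂.sub_box ω hω.2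
    have hn₁ := h₁.near ω hω.1
    have hn₂ := h₂.near ω hω.2
    have hfar₁ := h₁.far ω hω.1
    -- the first crossing starts on the left of the second rectangle, and can only enter the
    -- explored part of it through the second crossing
    have hQW : Disjoint (Q₁ ω) (W₂ ω) := by
      obtain ⟨u, hu, hu'⟩ := h₁.start ω hω.1
      refine disjoint_of_conn (h₁.conn ω hω.1) (fun e he => ?_) hu (fun h => ?_)
      · have hB := inside_mono ((h₁.sub ω hω.1).trans hW₁) he
        have key : ∀ v, (v = src e ∨ v = tgt e) → v ∈ Q₁ ω → v ∈ W₂ ω → e ∈ inside (W₂ ω) := by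
          intro v hv hvQ hvW
          by_contra hin
          refine hQQ.notMem_of_mem_left hvQ (h₂.mem_of_edge hω.2 (fun hB2 v hv hvW => ?_) hin hv hvW)
          refine ⟨hW₂ hvW, ?_⟩
          have h1 := hW₂ hvW
          rcases e with ⟨_ | _, a, b⟩ <;> rcases hv with rfl | rfl <;>
            simp only [inside, Set.mem_ofPred_eq, mem_box, src_eH, tgt_eH, src_eV, tgt_eV]
              at hB hB2 h1 ⊢ <;> omega
        exact ⟨fun h => (key _ (Or.inl rfl) he.1 h).2, fun h => (key _ (Or.inr rfl) he.2 h).1⟩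
      · have h1 := hW₂ h
        have h2 := hu'.2
        rw [mem_box] at h1
        omega
    set 𝒲₁ : Set (ℤ × ℤ) := W₁ ω ∪ {v | v ∉ R ∧ v.1 ≤ L ∧ c ≤ v.2} with h𝒲₁
    set 𝒲₂ : Set (ℤ × ℤ) := (W₂ ω \ W₁ ω) ∪ {v | v ∉ R ∧ ¬ (v.1 ≤ L ∧ c ≤ v.2)} with h𝒲₂
    have k1 : ∀ a b, a ≤ L → d ≤ b → (a, b) ∈ 𝒲₁ := fun a b ha hb => by
      by_cases h : (a, b) ∈ R
      · rw [hR, mem_box] at h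
        exact Or.inl (hn₁ ⟨by rw [mem_box]; dsimp only at h ⊢; omega, by dsimp only at h ⊢; omega⟩)
      · exact Or.inr ⟨h, by dsimp only; omega⟩
    have k2 : ∀ a b, a < 0 → c ≤ b → (a, b) ∈ 𝒲₁ := fun a b ha hb =>
      Or.inr ⟨by rw [hR, mem_box]; dsimp only; omega, by dsimp only; omega⟩
    have k3 : ∀ a b, b < c → (a, b) ∈ 𝒲₂ := fun a b hb =>
      Or.inr ⟨by rw [hR, mem_box]; dsimp only; omega, by dsimp only; omega⟩
    have k4 : ∀ a b, L < a → d < b → (a, b) ∈ 𝒲₂ := fun a b ha hb =>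
      Or.inr ⟨by rw [hR, mem_box]; dsimp only; omega, by dsimp only; omega⟩
    have k5 : ∀ a b, s' ≤ a → (a, b) ∈ 𝒲₂ := fun a b ha => by
      by_cases h : (a, b) ∈ R
      · rw [hR, mem_box] at h
        refine Or.inl ⟨hn₂ ⟨by rw [mem_box]; dsimp only at h ⊢; omega,
          by dsimp only at h ⊢; omega⟩, fun h' => ?_⟩
        have := hW₁ h'
        rw [mem_box] at this
        dsimp only at this
        omega
      · exact Or.inr ⟨h, by dsimp only; omega⟩
    have k6 : ∀ a, L ≤ a → (a, c) ∈ 𝒲₂ := fun a ha => by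
      rcases lt_or_ge a s' with h | h
      · have h1 : (a, c) ∈ W₂ ω := hn₂ ⟨by rw [mem_box]; dsimp only; omega, by dsimp only; omega⟩
        refine Or.inl ⟨h1, fun h' => hQW.notMem_of_mem_right h1 (hfar₁ _ ⟨hW₁ h', rfl⟩ h')⟩
      · exact k5 _ _ h
    have hfree : ∀ e, Free 𝒲₁ 𝒲₂ e → Free 𝒲₁ 𝒲₂ ((vertDual L).t e) → e ∈ inside R := by
      rintro ⟨_ | _, a, b⟩ he he'
      · simp only [Free, src_eH, tgt_eH, vertDual_eH, src_eV, tgt_eV] at he he'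
        by_contra hin
        simp only [inside, hR, mem_box, Set.mem_ofPred_eq, src_eH, tgt_eH] at hin
        rcases lt_or_ge b c with h1 | h1
        · exact he.2 ⟨k3 _ _ h1, k3 _ _ h1⟩
        rcases lt_or_ge a (-1) with h2 | h2
        · exact he.1 ⟨k2 _ _ (by omega) h1, k2 _ _ (by omega) h1⟩
        rcases lt_or_ge d b with h3 | h3
        · rcases lt_trichotomy a L with h4 | h4 | h4
          · exact he.1 ⟨k1 _ _ (by omega) (by omega), k1 _ _ (by omega) (by omega)⟩
          · exact he'.1 ⟨k1 _ _ (by omega) (by omega), k1 _ _ (by omega) (by omega)⟩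
          · exact he.2 ⟨k4 _ _ (by omega) (by omega), k4 _ _ (by omega) (by omega)⟩
        rcases lt_or_ge a 0 with h4 | h4
        · exact he'.2 ⟨k5 _ _ (by omega), k5 _ _ (by omega)⟩
        · exact he.2 ⟨k5 _ _ (by omega), k5 _ _ (by omega)⟩
      · simp only [Free, src_eH, tgt_eH, vertDual_eV, src_eV, tgt_eV] at he he'
        by_contra hin
        simp only [inside, hR, mem_box, Set.mem_ofPred_eq, src_eV, tgt_eV] at hin
        rcases lt_or_ge (b + 1) c with h1 | h1
        · exact he.2 ⟨k3 _ _ (by omega), k3 _ _ h1⟩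
        rcases lt_or_ge s' a with h2 | h2
        · exact he.2 ⟨k5 _ _ (by omega), k5 _ _ (by omega)⟩
        rcases h1.eq_or_lt with h3 | h3
        · rw [← h3] at he'
          rcases lt_or_ge a L with h4 | h4
          · exact he'.2 ⟨k6 _ (by omega), k6 _ (by omega)⟩
          · rw [← h3] at he
            exact he.2 ⟨k3 _ _ (by omega), k6 _ (by omega)⟩
        rcases lt_or_ge a 0 with h4 | h4
        · exact he.1 ⟨k2 _ _ (by omega) (by omega), k2 _ _ (by omega) (by omega)⟩
        rcases le_or_gt a L with h5 | h5
        · exact he.1 ⟨k1 _ _ (by omega) (by omega), k1 _ _ (by omega) (by omega)⟩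
        · exact he'.1 ⟨k1 _ _ (by omega) (by omega), k1 _ _ (by omega) (by omega)⟩
    have hfree' : ∀ e, Free 𝒲₁ 𝒲₂ e → Free 𝒲₁ 𝒲₂ ((vertDual L).t e) →
        (vertDual L).t e ∈ inside R := by
      rintro ⟨_ | _, a, b⟩ he he'
      · simp only [Free, src_eH, tgt_eH, vertDual_eH, src_eV, tgt_eV] at he he'
        by_contra hin
        simp only [inside, hR, mem_box, Set.mem_ofPred_eq, vertDual_eH, src_eV, tgt_eV] at hin
        rcases lt_or_ge b c with h1 | h1
        · exact he.2 ⟨k3 _ _ h1, k3 _ _ h1⟩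
        rcases le_or_gt s' (2 * L - a) with h2 | h2
        · exact he'.2 ⟨k5 _ _ (by omega), k5 _ _ (by omega)⟩
        rcases lt_or_ge (2 * L - a) 0 with h3 | h3
        · exact he'.1 ⟨k2 _ _ (by omega) (by omega), k2 _ _ (by omega) (by omega)⟩
        rcases le_or_gt (2 * L - a) L with h4 | h4
        · exact he'.1 ⟨k1 _ _ (by omega) (by omega), k1 _ _ (by omega) (by omega)⟩
        · exact he.1 ⟨k1 _ _ (by omega) (by omega), k1 _ _ (by omega) (by omega)⟩
      · simp only [Free, src_eH, tgt_eH, vertDual_eV, src_eV, tgt_eV] at he he'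
        by_contra hin
        simp only [inside, hR, mem_box, Set.mem_ofPred_eq, vertDual_eV, src_eH, tgt_eH] at hin
        rcases lt_or_ge (b + 1) c with h1 | h1
        · exact he.2 ⟨k3 _ _ (by omega), k3 _ _ (by omega)⟩
        rcases le_or_gt s' (2 * L - a) with h2 | h2
        · exact he'.2 ⟨k5 _ _ (by omega), k5 _ _ (by omega)⟩
        rcases lt_or_ge (2 * L - a) (-1) with h3 | h3
        · exact he'.1 ⟨k2 _ _ (by omega) (by omega), k2 _ _ (by omega) (by omega)⟩
        rcases lt_or_ge (2 * L - a) 0 with h4 | h4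
        · exact he.2 ⟨k5 _ _ (by omega), k5 _ _ (by omega)⟩
        rcases lt_trichotomy (2 * L - a) L with h5 | h5 | h5
        · exact he'.1 ⟨k1 _ _ (by omega) (by omega), k1 _ _ (by omega) (by omega)⟩
        · exact he.1 ⟨k1 _ _ (by omega) (by omega), k1 _ _ (by omega) (by omega)⟩
        · exact he'.2 ⟨k4 _ _ (by omega) (by omega), k4 _ _ (by omega) (by omega)⟩
    -- the vertical edges at the end of the right side of the first rectangle, above the crossing,
    -- are not free
    have hcol : ∀ y, (L, y) ∈ W₁ ω → (L, y) ∉ Q₁ ω →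
        (L, y + 1) ∈ 𝒲₁ ∧ (L, y - 1) ∈ 𝒲₁ ∧ (L, y) ∈ 𝒲₁ := by
      intro y hy hyQ
      have h1 := hW₁ hy
      simp only [mem_box] at h1
      have hyc : y ≠ c := fun h => hyQ (hfar₁ _ ⟨hW₁ hy, h⟩ hy)
      refine ⟨?_, Or.inl ?_, Or.inl hy⟩
      · rcases h1.2.2.2.eq_or_lt with h | h
        · exact k1 _ _ le_rfl (by omega)
        · refine Or.inl (h₁.step ω hω.1 (eV L y) ?_ (L, y) _ (Or.inl ⟨rfl, rfl⟩) hy hyQ)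
          simp only [inside, Set.mem_ofPred_eq, mem_box, src_eV, tgt_eV]; omega
      · refine h₁.step ω hω.1 (eV L (y - 1)) ?_ (L, y) _ (Or.inr ⟨?_, rfl⟩) hy hyQ
        · simp only [inside, Set.mem_ofPred_eq, mem_box, src_eV, tgt_eV]; omega
        · simp
    have hedge : ∀ e, Free 𝒲₁ 𝒲₂ e → Free 𝒲₁ 𝒲₂ ((vertDual L).t e) →
        ∀ f, (f = e ∨ f = (vertDual L).t e) → f ∈ inside R ∧ Free 𝒲₁ 𝒲₂ f ∧
          ∀ y, f = eH L y → (L, y) ∈ W₁ ω → (L, y) ∈ Q₁ ω := by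
      rintro e he he' f (rfl | rfl)
      · refine ⟨hfree _ he he', he, fun y hy h => by_contra fun h' => ?_⟩
        subst hy
        obtain ⟨h1, h2, h3⟩ := hcol y h h'
        simp only [Free, vertDual_eH, src_eV, tgt_eV, show 2 * L - L = L by ring] at he'
        exact he'.1 ⟨h3, h1⟩
      · refine ⟨hfree' _ he he', he', fun y hy h => by_contra fun h' => ?_⟩
        obtain ⟨h1, h2, h3⟩ := hcol y h h'
        rcases e with ⟨_ | _, a, b⟩
        · simp at hy
        · simp only [vertDual_eV, Prod.mk.injEq, true_and] at hy
          obtain ⟨rfl, rfl⟩ : a = L ∧ b = y - 1 := by omega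
          simp only [Free, src_eV, tgt_eV, sub_add_cancel] at he
          exact he.1 ⟨h2, h3⟩
    have hend : ∀ f ∈ inside R, ∀ v, (v = src f ∨ v = tgt f) → v ∈ R := by
      rintro f hf v (rfl | rfl)
      exacts [hf.1, hf.2]
    have hQ₁ : ∀ f ∈ inside R, Free 𝒲₁ 𝒲₂ f →
        (∀ y, f = eH L y → (L, y) ∈ W₁ ω → (L, y) ∈ Q₁ ω) →
        ∀ v, (v = src f ∨ v = tgt f) → v ∈ W₁ ω → v ∈ Q₁ ω := by
      intro f hfR hff hfL v hv hvW
      have hout : f ∉ inside (W₁ ω) := fun h => hff.1 ⟨Or.inl h.1, Or.inl h.2⟩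
      by_contra hvQ
      by_cases hin : f ∈ inside (box 0 L c d)
      · rcases hv with rfl | rfl
        · exact hout ⟨hvW, h₁.step ω hω.1 f hin _ _ (Or.inl ⟨rfl, rfl⟩) hvW hvQ⟩
        · exact hout ⟨h₁.step ω hω.1 f hin _ _ (Or.inr ⟨rfl, rfl⟩) hvW hvQ, hvW⟩
      · have h1 := hW₁ hvW
        obtain ⟨y, rfl, rfl⟩ : ∃ y, f = eH L y ∧ v = (L, y) := by
          rcases f with ⟨_ | _, a, b⟩ <;> rcases hv with rfl | rfl <;>
            simp only [inside, hR, Set.mem_ofPred_eq, mem_box, src_eH, tgt_eH, src_eV, tgt_eV]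
              at hfR hin h1 <;> first | omega | skip
          obtain rfl : a = L := by omega
          exact ⟨b, rfl, rfl⟩
        exact hvQ (hfL y rfl hvW)
    have hout : ∀ f ∈ inside R, Free 𝒲₁ 𝒲₂ f →
        (∀ y, f = eH L y → (L, y) ∈ W₁ ω → (L, y) ∈ Q₁ ω) →
        f ∉ inside (W₁ ω) ∧ f ∉ inside (W₂ ω) := by
      intro f hfR hff hfL
      refine ⟨fun h => hff.1 ⟨Or.inl h.1, Or.inl h.2⟩, fun h => hff.2 ⟨Or.inl ⟨h.1, fun h' => ?_⟩,
        Or.inl ⟨h.2, fun h' => ?_⟩⟩⟩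
      · exact hQW.notMem_of_mem_right h.1 (hQ₁ f hfR hff hfL _ (Or.inl rfl) h')
      · exact hQW.notMem_of_mem_right h.2 (hQ₁ f hfR hff hfL _ (Or.inr rfl) h')
    set S₀ : Finset Edge := (inside_box_finite 0 s' c d).toFinset.filter
      fun e => Free 𝒲₁ 𝒲₂ e ∧ Free 𝒲₁ 𝒲₂ ((vertDual L).t e) with hS₀
    have hmem : ∀ e, e ∈ S₀ ↔ Free 𝒲₁ 𝒲₂ e ∧ Free 𝒲₁ 𝒲₂ ((vertDual L).t e) := fun e => by
      rw [hS₀, Finset.mem_filter, Set.Finite.mem_toFinset]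
      exact ⟨fun h => h.2, fun h => ⟨hfree e h.1 h.2, h⟩⟩
    refine ⟨𝒲₁, 𝒲₂, S₀, {v | v.1 ≤ L ∧ c ≤ v.2}, eV L (c - 1), ⟨?_, ?_, hmem, ?_, ?_⟩,
      ?_, ?_, ?_, ?_⟩
    · rw [Set.disjoint_left]
      rintro v (hv | hv) (hv' | hv')
      · exact hv'.2 hv
      · exact hv'.1 (hB₁ (hW₁ hv))
      · exact hv.1 (hB₂ (hW₂ hv'.1))
      · exact hv'.2 hv.2
    · refine (box_finite 0 s' c d).subset fun v hv => by_contra fun h => hv ?_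
      by_cases h' : v.1 ≤ L ∧ c ≤ v.2
      exacts [Or.inl (Or.inr ⟨h, h'⟩), Or.inr (Or.inr ⟨h, h'⟩)]
    · intro e he f hf v hv hvW
      rw [hmem] at he
      obtain ⟨hfR, hff, hfL⟩ := hedge e he.1 he.2 f hf
      exact hQ₁ f hfR hff hfL v hv (hvW.resolve_right fun h => h.1 (hend f hfR v hv))
    · intro e he f hf v hv hvW
      rw [hmem] at he
      obtain ⟨hfR, hff, hfL⟩ := hedge e he.1 he.2 f hf
      refine h₂.mem_of_edge hω.2 (fun hB v hv hvW => ?_) (hout f hfR hff hfL).2 hv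
        (hvW.resolve_right fun h => h.1 (hend f hfR v hv)).1
      refine ⟨hW₂ hvW, ?_⟩
      have h1 := hW₂ hvW
      rcases f with ⟨_ | _, a, b⟩ <;> rcases hv with rfl | rfl <;>
        simp only [inside, hR, Set.mem_ofPred_eq, mem_box, src_eH, tgt_eH, src_eV, tgt_eV]
          at hfR hB h1 ⊢ <;> omega
    · refine (box_finite 0 s' c d).subset ?_
      rintro v (⟨hv | hv, hv'⟩ | ⟨hv, hv'⟩)
      · exact hB₁ (hW₁ hv)
      · exact absurd hv.2 hv'
      · by_contra h
        exact hv' (Or.inr ⟨h, hv⟩)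
    · rw [cob_ind_eq_one, cob_ind_eq_one, one_mul] <;>
        simp only [vertDual_eV, src_eH, tgt_eH, src_eV, tgt_eV, Set.mem_ofPred_eq] <;> omega
    · rintro ⟨_ | _, a, b⟩ he
      · have h1 := left_ne_zero_of_mul he
        have h2 := right_ne_zero_of_mul he
        rw [Ne, cob_ind_eq_zero] at h1 h2
        simp only [vertDual_eH, src_eH, tgt_eH, src_eV, tgt_eV, Set.mem_ofPred_eq] at h1 h2
        omega
      · have h1 := left_ne_zero_of_mul he
        have h2 := right_ne_zero_of_mul he
        rw [Ne, cob_ind_eq_zero] at h1 h2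
        simp only [vertDual_eV, src_eH, tgt_eH, src_eV, tgt_eV, Set.mem_ofPred_eq] at h1 h2
        simp only [Prod.mk.injEq, true_and]
        omega
    · intro e he f hf
      rw [hmem] at he
      obtain ⟨hfR, hff, hfL⟩ := hedge e he.1 he.2 f hf
      exact ⟨hfR, hout f hfR hff hfL⟩
  · rintro ω - ⟨hω, a, ha, b, hb, hab⟩
    obtain ⟨u, hu, huB, hu0⟩ := h₁.start ω hω.1
    obtain ⟨v, hv, hvB, hvc, -⟩ := h₂.start ω hω.2
    obtain ⟨v', hv', -, hv'd⟩ := h₂.goal ω hω.2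
    have hs1 := (h₁.sub ω hω.1).trans (h₁.sub_box ω hω.1)
    have hs2 := (h₂.sub ω hω.2).trans (h₂.sub_box ω hω.2)
    refine ⟨u, hB₁ huB, v, hvB, v', hu0, hvc, hv'd, conn_mono le_rfl
      (Set.inter_subset_inter_right _ (inside_mono hs2)) (h₂.conn ω hω.2 v hv v' hv'), ?_⟩
    refine Setoid.trans' _ (conn_mono le_rfl (Set.inter_subset_inter_right _
      (inside_mono (hs1.trans hB₁))) (h₁.conn ω hω.1 u hu a ha)) (Setoid.trans' _ hab ?_)
    exact conn_mono le_rfl (Set.inter_subset_inter_right _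
      (inside_mono (hs2.trans hB₂))) (h₂.conn ω hω.2 b hb v hv)

/-- A horizontal crossing is extended with a cost that does not depend on the boundary
conditions. -/
theorem pr_extend {x : ℝ} (hx : 1 ≤ x) {E : Finset Edge} {r : Setoid (ℤ × ℤ)}
    {L s s' c d : ℤ} (hs : 0 < s) (hsL : s ≤ L) (hL : L < s') (hs' : s' ≤ 2 * L) (hcd : c < d)
    (hE : inside (box 0 s' c d) ⊆ E) :
    pr x E r (HCross 0 L c d) * pr x E r (Crossed (box s s' c d)
        {v ∈ box s s' c d | v.2 = c ∧ v.1 ≤ L} {v ∈ box s s' c d | v.2 = d}) *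
        pr x E r (HCross s s' c d) ≤ (1 + x ^ 2) * pr x E r (HCross 0 s' c d) := by
  have h1 := pr_fkg hx (E := E) (r := r) (isUpperSet_crossed (box 0 L c d)
    {v ∈ box 0 L c d | v.1 = 0} {v ∈ box 0 L c d | v.1 = L}) (isUpperSet_crossed (box s s' c d)
    {v ∈ box s s' c d | v.2 = c ∧ v.1 ≤ L} {v ∈ box s s' c d | v.2 = d})
  have h2 := pr_inter_le_leftToVCross hx (r := r) hs hsL hL hs' hcd hE
  have h3 := pr_fkg hx (E := E) (r := r) (isUpperSet_leftToVCross s s' c d)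
    (isUpperSet_crossed (box s s' c d) {v ∈ box s s' c d | v.1 = s} {v ∈ box s s' c d | v.1 = s'})
  have h4 : pr x E r (LeftToVCross s s' c d ∩ HCross s s' c d) ≤ pr x E r (HCross 0 s' c d) := by
    refine pr_mono hx ?_
    rintro ω - ⟨⟨u, hu, v, hv, v', hu0, hvc, hvd, hvv, huv⟩, l, ⟨hl, hls⟩, k, ⟨hk, hks⟩, hlk⟩
    have hB₂ : box s s' c d ⊆ box 0 s' c d := fun v hv => by rw [mem_box] at hv ⊢; omega
    have h5 := conn_of_cross hcd Set.inter_subset_right hv hl hk hvc hvd hls hks hvv hlk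
    have h6 := conn_mono (le_refl ⊥) (Set.inter_subset_inter_right ω (inside_mono hB₂))
      (Setoid.trans' _ h5 hlk)
    exact ⟨u, ⟨hu, hu0⟩, k, ⟨hB₂ hk, hks⟩, Setoid.trans' _ huv h6⟩
  have h5 := pr_nonneg hx (E := E) (r := r) (HCross s s' c d)
  have hC : (0 : ℝ) ≤ 1 + x ^ 2 := by positivity
  calc _ ≤ (1 + x ^ 2) * pr x E r (LeftToVCross s s' c d) * pr x E r (HCross s s' c d) :=
        mul_le_mul_of_nonneg_right (h1.trans h2) h5
    _ = (1 + x ^ 2) * (pr x E r (LeftToVCross s s' c d) * pr x E r (HCross s s' c d)) := by ring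
    _ ≤ _ := mul_le_mul_of_nonneg_left (h3.trans h4) hC

/-! ### Crossing probabilities in the strip -/

/-- The event `A` depends on finitely many edges of the strip. -/
def Cyl (N : ℕ) (A : Set (Set Edge)) : Prop := ∃ K, DepOn (rectE K N) A

lemma Cyl.inter {N : ℕ} {A B : Set (Set Edge)} (hA : Cyl N A) (hB : Cyl N B) : Cyl N (A ∩ B) := by
  obtain ⟨K, hK⟩ := hA
  obtain ⟨L, hL⟩ := hB
  exact ⟨max K L, (hK.mono (Finset.coe_subset.2 (rectE_mono (le_max_left _ _)))).inter
    (hL.mono (Finset.coe_subset.2 (rectE_mono (le_max_right _ _))))⟩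

lemma exists_box_subset_rectE {N : ℕ} (a b : ℤ) {c d : ℤ} (hc : -(N : ℤ) ≤ c) (hd : d ≤ N) :
    ∃ K₀, ∀ K ≥ K₀, inside (box a b c d) ⊆ rectE K N := by
  refine ⟨max a.natAbs b.natAbs, fun K hK e he => ?_⟩
  rw [Finset.mem_coe, mem_rectE]
  refine inside_mono (fun v hv => ?_) he
  rw [Finset.mem_coe, mem_rect]
  rw [mem_box] at hv
  have h1 := le_max_left a.natAbs b.natAbs
  have h2 := le_max_right a.natAbs b.natAbs
  omega

lemma cyl_crossed {N : ℕ} (a b : ℤ) {c d : ℤ} (hc : -(N : ℤ) ≤ c) (hd : d ≤ N)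
    (A A' : Set (ℤ × ℤ)) : Cyl N (Crossed (box a b c d) A A') := by
  obtain ⟨K, hK⟩ := exists_box_subset_rectE a b hc hd
  exact ⟨K, (depOn_crossed _ _ _).mono (hK K le_rfl)⟩

section
variable {x : ℝ} (hx : 1 ≤ x) {N : ℕ}
include hx

lemma Cyl.tendsto {A : Set (Set Edge)} (hA : Cyl N A) :
    Tendsto (fun K => pr x (rectE K N) (wireTop N) A) atTop (𝓝 (strip x N A)) := by
  obtain ⟨K, hK⟩ := hA
  exact tendsto_strip hx hK

lemma Cyl.strip_mono {A B : Set (Set Edge)} (hA : Cyl N A) (hB : Cyl N B) (h : A ⊆ B) :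
    strip x N A ≤ strip x N B :=
  le_of_tendsto_of_tendsto' (hA.tendsto hx) (hB.tendsto hx) fun _ => pr_mono hx fun _ _ h' => h h'

lemma Cyl.strip_nonneg {A : Set (Set Edge)} (hA : Cyl N A) : 0 ≤ strip x N A :=
  ge_of_tendsto' (hA.tendsto hx) fun _ => pr_nonneg hx _

lemma Cyl.strip_fkg {A B : Set (Set Edge)} (hA : Cyl N A) (hB : Cyl N B) (hA' : IsUpperSet A)
    (hB' : IsUpperSet B) : strip x N A * strip x N B ≤ strip x N (A ∩ B) :=
  le_of_tendsto_of_tendsto' ((hA.tendsto hx).mul (hB.tendsto hx)) ((hA.inter hB).tendsto hx)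
    fun _ => pr_fkg hx hA' hB'

lemma Cyl.strip_le_add {A B C : Set (Set Edge)} (hA : Cyl N A) (hB : Cyl N B) (hC : Cyl N C)
    (h : C ⊆ A ∪ B) : strip x N C ≤ strip x N A + strip x N B := by
  refine le_of_tendsto_of_tendsto' (hC.tendsto hx) ((hA.tendsto hx).add (hB.tendsto hx))
    fun K => ?_
  have hw : ∀ ω, 0 ≤ wt (ends (rectE K N)) (wireTop N) x ω := fun ω => (wt_pos _ _ hx ω).le
  rw [pr, pr, pr, ← add_div]
  refine div_le_div_of_nonneg_right ?_ (wsum_nonneg hw _)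
  generalize wt (ends (rectE K N)) (wireTop N) x = f at hw
  unfold wsum
  rw [← Finset.sum_add_distrib]
  refine Finset.sum_le_sum fun ω _ => ?_
  have h0 : ∀ D : Set (Set Edge), 0 ≤ if (ω : Set Edge) ∈ D then f ω else 0 := fun D => by
    split_ifs
    exacts [hw ω, le_rfl]
  by_cases h1 : (ω : Set Edge) ∈ C
  · rw [if_pos h1]
    rcases h h1 with h2 | h2
    · rw [if_pos h2]; exact le_add_of_nonneg_right (h0 B)
    · rw [if_pos h2]; exact le_add_of_nonneg_left (h0 A)
  · rw [if_neg h1]; exact add_nonneg (h0 A) (h0 B)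

/-- Invariance under the automorphisms of the lattice that preserve the strip. -/
lemma strip_crossed_preimage (I : LatticeIso) (hI : ∀ v, (I.σ v).2 = v.2)
    (hK : ∀ K, ∃ L, ∀ v ∈ rect K N, I.σ.symm v ∈ rect L N) {a b a' b' c d : ℤ}
    (hc : -(N : ℤ) ≤ c) (hd : d ≤ N) (hB : I.σ ⁻¹' box a b c d = box a' b' c d)
    (A A' : Set (ℤ × ℤ)) :
    strip x N (Crossed (box a' b' c d) (I.σ ⁻¹' A) (I.σ ⁻¹' A')) =
      strip x N (Crossed (box a b c d) A A') := by
  obtain ⟨K, hK₁⟩ := exists_box_subset_rectE a b hc hd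
  obtain ⟨L, hL⟩ := exists_box_subset_rectE a' b' hc hd
  have e : {ω | I.τ '' ω ∈ Crossed (box a b c d) A A'} =
      Crossed (box a' b' c d) (I.σ ⁻¹' A) (I.σ ⁻¹' A') := by
    ext ω
    rw [Set.mem_ofPred_eq, I.image_mem_crossed, hB]
  rw [← e]
  refine strip_image hx I hI (K₀ := max K L)
    ((depOn_crossed _ _ _).mono (hK₁ _ (le_max_left _ _))) ?_ hK
  rw [e]
  exact (depOn_crossed _ _ _).mono (hL _ (le_max_right _ _))

lemma strip_HCross_translate {a b c d : ℤ} (hc : -(N : ℤ) ≤ c) (hd : d ≤ N) (s : ℤ) :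
    strip x N (HCross (a + s) (b + s) c d) = strip x N (HCross a b c d) := by
  have h := strip_crossed_preimage hx (transX s) (fun _ => rfl)
    (fun K => ⟨K + s.natAbs, fun v hv => by
      rw [mem_rect] at hv ⊢
      simp only [transX, Equiv.coe_fn_symm_mk]
      rw [Nat.cast_add]
      omega⟩) (a := a + s) (b := b + s) (a' := a) (b' := b) hc hd
    (by rw [transX_box]; congr 1 <;> ring)
    {v ∈ box (a + s) (b + s) c d | v.1 = a + s} {v ∈ box (a + s) (b + s) c d | v.1 = b + s}
  unfold HCross
  rw [← h]
  congr 2 <;> · ext v; simp only [Set.mem_preimage, Set.mem_ofPred_eq, mem_box, transX_σ]; omega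

lemma strip_VCross_translate {a b c d : ℤ} (hc : -(N : ℤ) ≤ c) (hd : d ≤ N) (s : ℤ) :
    strip x N (VCross (a + s) (b + s) c d) = strip x N (VCross a b c d) := by
  have h := strip_crossed_preimage hx (transX s) (fun _ => rfl)
    (fun K => ⟨K + s.natAbs, fun v hv => by
      rw [mem_rect] at hv ⊢
      simp only [transX, Equiv.coe_fn_symm_mk]
      rw [Nat.cast_add]
      omega⟩) (a := a + s) (b := b + s) (a' := a) (b' := b) hc hd
    (by rw [transX_box]; congr 1 <;> ring)
    {v ∈ box (a + s) (b + s) c d | v.2 = c} {v ∈ box (a + s) (b + s) c d | v.2 = d}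
  unfold VCross
  rw [← h]
  congr 2 <;> · ext v; simp only [Set.mem_preimage, Set.mem_ofPred_eq, mem_box, transX_σ]; omega

/-- By reflection, a vertical crossing starts on the left of `L` with conditional probability at
least one half, if `L` is not on the left of the middle. -/
lemma strip_VCross_le_two_mul {s s' c d L : ℤ} (hc : -(N : ℤ) ≤ c) (hd : d ≤ N)
    (hL : s + s' ≤ 2 * L + 1) :
    strip x N (VCross s s' c d) ≤ 2 * strip x N (Crossed (box s s' c d)
      {v ∈ box s s' c d | v.2 = c ∧ v.1 ≤ L} {v ∈ box s s' c d | v.2 = d}) := by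
  have h := strip_crossed_preimage hx (reflX (s + s')) (fun _ => rfl)
    (fun K => ⟨K + (s + s').natAbs, fun v hv => by
      rw [mem_rect] at hv ⊢
      simp only [reflX, Equiv.coe_fn_symm_mk]
      rw [Nat.cast_add]
      omega⟩) (a := s) (b := s') (a' := s) (b' := s') hc hd
    (by rw [reflX_box]; congr 1 <;> ring)
    {v ∈ box s s' c d | v.2 = c ∧ v.1 ≤ L} {v ∈ box s s' c d | v.2 = d}
  rw [two_mul]
  nth_rewrite 1 [← h]
  refine Cyl.strip_le_add hx (cyl_crossed _ _ hc hd _ _) (cyl_crossed _ _ hc hd _ _)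
    (cyl_crossed _ _ hc hd _ _) ?_
  rintro ω ⟨u, ⟨hu, huc⟩, v, ⟨hv, hvd⟩, huv⟩
  rcases le_or_gt u.1 L with h' | h'
  · exact Or.inr ⟨u, ⟨hu, huc, h'⟩, v, ⟨hv, hvd⟩, huv⟩
  · refine Or.inl ⟨u, ?_, v, ?_, huv⟩
    · simp only [Set.mem_preimage, Set.mem_ofPred_eq, mem_box, reflX_σ] at hu ⊢; omega
    · simp only [Set.mem_preimage, Set.mem_ofPred_eq, mem_box, reflX_σ] at hv ⊢; omega

lemma strip_HCross_antitone {b b' c d : ℤ} (hc : -(N : ℤ) ≤ c) (hd : d ≤ N) (hb : 0 < b)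
    (hbb : b ≤ b') : strip x N (HCross 0 b' c d) ≤ strip x N (HCross 0 b c d) := by
  refine Cyl.strip_mono hx (cyl_crossed _ _ hc hd _ _) (cyl_crossed _ _ hc hd _ _) ?_
  rintro ω ⟨u, ⟨-, hu⟩, v, ⟨-, hv⟩, huv⟩
  exact HCross_of_conn hb hu.le (by omega) huv

lemma strip_VCross_sq_le {w X c d : ℤ} (hc : -(N : ℤ) ≤ c) (hd : d ≤ N) (hw : 0 ≤ w)
    (hwX : w < X - w) (hcd : c < d) (hX : X ≤ d - c + 1) :
    strip x N (VCross 0 w c d) ^ 2 ≤ (1 + x ^ 2) * strip x N (HCross 0 (X - 2 * w) c d) := by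
  have e1 := strip_VCross_translate hx (a := 0) (b := w) hc hd (X - w)
  have e2 := strip_HCross_translate hx (a := 0) (b := X - 2 * w) hc hd w
  rw [show (0 : ℤ) + (X - w) = X - w by ring, show w + (X - w) = X by ring] at e1
  rw [show (0 : ℤ) + w = w by ring, show X - 2 * w + w = X - w by ring] at e2
  rw [sq, ← e2]
  nth_rewrite 2 [← e1]
  obtain ⟨K, hK⟩ := exists_box_subset_rectE 0 X hc hd
  refine le_of_tendsto_of_tendsto
    ((Cyl.tendsto hx (cyl_crossed _ _ hc hd _ _)).mul (Cyl.tendsto hx (cyl_crossed _ _ hc hd _ _)))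
    ((Cyl.tendsto hx (cyl_crossed _ _ hc hd _ _)).const_mul _)
    (eventually_atTop.2 ⟨K, fun L hL => ?_⟩)
  exact pr_VCross_mul_le hx hw hwX hcd hX (hK L hL)

lemma strip_extend {L s c d : ℤ} (hc : -(N : ℤ) ≤ c) (hd : d ≤ N) (hcd : c < d) (hL : 0 < L)
    (hs : L ≤ 2 * s) (hs' : 2 * s ≤ L + 1) :
    strip x N (HCross 0 L c d) ^ 2 * strip x N (VCross 0 L c d) ≤
      2 * (1 + x ^ 2) * strip x N (HCross 0 (L + s) c d) := by
  have e1 := strip_HCross_translate hx (a := 0) (b := L) hc hd s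
  have e2 := strip_VCross_translate hx (a := 0) (b := L) hc hd s
  rw [zero_add] at e1 e2
  have h1 := strip_VCross_le_two_mul hx (s := s) (s' := L + s) (L := L) hc hd (by omega)
  obtain ⟨K, hK⟩ := exists_box_subset_rectE 0 (L + s) hc hd
  have h2 := le_of_tendsto_of_tendsto
    (((Cyl.tendsto hx (cyl_crossed _ _ hc hd _ _)).mul
      (Cyl.tendsto hx (cyl_crossed _ _ hc hd _ _))).mul
      (Cyl.tendsto hx (cyl_crossed _ _ hc hd _ _)))
    ((Cyl.tendsto hx (cyl_crossed _ _ hc hd _ _)).const_mul _)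
    (eventually_atTop.2 ⟨K, fun M hM => pr_extend hx (r := wireTop N) (L := L) (s := s)
      (s' := L + s) (by omega) (by omega) (by omega) (by omega) hcd (hK M hM)⟩)
  change strip x N (HCross 0 L c d) * _ * strip x N (HCross s (L + s) c d) ≤
    _ * strip x N (HCross 0 (L + s) c d) at h2
  rw [e1] at h2
  rw [e2] at h1
  have h3 : 0 ≤ strip x N (HCross 0 L c d) := Cyl.strip_nonneg hx (cyl_crossed _ _ hc hd _ _)
  nlinarith [mul_le_mul_of_nonneg_left h1 (mul_nonneg h3 h3)]

/-- Two horizontal crossings and a vertical crossing of the intersection of the two rectangles. -/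
lemma strip_glue {b w m c d : ℤ} (hc : -(N : ℤ) ≤ c) (hd : d ≤ N) (hcd : c < d) (hwb : w ≤ b)
    (hwm : w ≤ m) :
    strip x N (HCross 0 b c d) * strip x N (VCross 0 w c d) * strip x N (HCross 0 m c d) ≤
      strip x N (HCross 0 (b + (m - w)) c d) := by
  have e1 := strip_HCross_translate hx (a := 0) (b := m) hc hd (b - w)
  have e2 := strip_VCross_translate hx (a := 0) (b := w) hc hd (b - w)
  rw [zero_add, show m + (b - w) = b + (m - w) by ring] at e1
  rw [zero_add, show w + (b - w) = b by ring] at e2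
  rw [← e1, ← e2]
  have hH : ∀ a b, Cyl N (HCross a b c d) := fun a b => cyl_crossed _ _ hc hd _ _
  have hV : ∀ a b, Cyl N (VCross a b c d) := fun a b => cyl_crossed _ _ hc hd _ _
  refine (mul_le_mul_of_nonneg_right (Cyl.strip_fkg hx (hH _ _) (hV _ _)
    (isUpperSet_crossed _ _ _) (isUpperSet_crossed _ _ _)) ((hH _ _).strip_nonneg hx)).trans
    ((Cyl.strip_fkg hx ((hH _ _).inter (hV _ _)) (hH _ _) ((isUpperSet_crossed _ _ _).inter
      (isUpperSet_crossed _ _ _)) (isUpperSet_crossed _ _ _)).trans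
    (Cyl.strip_mono hx (((hH _ _).inter (hV _ _)).inter (hH _ _)) (hH _ _) ?_))
  rintro ω ⟨⟨⟨l, ⟨hl, hl0⟩, r, ⟨hr, hrb⟩, hlr⟩, u, ⟨hu, huc⟩, v, ⟨hv, hvd⟩, huv⟩,
    l', ⟨hl', hl0'⟩, r', ⟨hr', hrb'⟩, hlr'⟩
  have hB : ∀ a b a' b', a' ≤ a → b ≤ b' → box a b c d ⊆ box a' b' c d := fun a b a' b' h h' v hv => by
    rw [mem_box] at hv ⊢; omega
  have hm : ∀ a b a' b', a' ≤ a → b ≤ b' →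
      conn ⊥ (ω ∩ inside (box a b c d)) ≤ conn ⊥ (ω ∩ inside (box a' b' c d)) :=
    fun a b a' b' h h' => conn_mono le_rfl (Set.inter_subset_inter_right _
      (inside_mono (hB a b a' b' h h')))
  have h1 := conn_of_cross hcd Set.inter_subset_right (hB (b - w) b 0 b (by omega) le_rfl hu) hl hr
    huc hvd hl0 hrb (hm _ _ _ _ (by omega) le_rfl huv) hlr
  have h2 := conn_of_cross hcd Set.inter_subset_right
    (hB (b - w) b (b - w) (b + (m - w)) le_rfl (by omega) hu) hl' hr' huc hvd hl0' hrb'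
    (hm _ _ _ _ le_rfl (by omega) huv) hlr'
  refine ⟨l, ⟨hB _ _ _ _ le_rfl (by omega) hl, hl0⟩, r',
    ⟨hB _ _ _ _ (by omega) le_rfl hr', hrb'⟩, ?_⟩
  exact Setoid.trans' _ (hm 0 b _ _ le_rfl (by omega) (Setoid.symm' _ h1))
    (hm (b - w) (b + (m - w)) _ _ (by omega) le_rfl (Setoid.trans' _ h2 hlr'))

end

/-- The symmetry with respect to a horizontal line, between the lattice of the faces and the lattice
of the vertices. -/
def reflY : LatticeIso where
  σ := ⟨fun v => (v.1, -v.2 - 1), fun v => (v.1, -v.2 - 1), fun v => by simp, fun v => by simp⟩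
  τ :=
    { toFun := fun e => if e.1 then (true, e.2.1, -e.2.2 - 2) else (false, e.2.1, -e.2.2 - 1)
      invFun := fun e => if e.1 then (true, e.2.1, -e.2.2 - 2) else (false, e.2.1, -e.2.2 - 1)
      left_inv := by rintro ⟨_ | _, x, y⟩ <;> simp
      right_inv := by rintro ⟨_ | _, x, y⟩ <;> simp }
  ends := by
    rintro ⟨_ | _, x, y⟩
    · left; simp [src, tgt]
    · right; simp [src, tgt]; omega

@[simp] lemma reflY_σ (v : ℤ × ℤ) : reflY.σ v = (v.1, -v.2 - 1) := rfl

lemma flipDual_image (ω : Set Edge) : flipDual.t '' ω = reflY.τ '' (plDual '' ω) := by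
  rw [← Set.image_comp]
  refine Set.image_congr' ?_
  rintro ⟨_ | _, x, y⟩
  · simp [reflY]; omega
  · simp [reflY]

lemma reflY_mem_HCross {a b c d : ℤ} {η : Set Edge} :
    reflY.τ '' η ∈ HCross a b c d ↔ η ∈ HCross a b (-d - 1) (-c - 1) := by
  unfold HCross
  rw [LatticeIso.image_mem_crossed]
  have e : reflY.σ ⁻¹' box a b c d = box a b (-d - 1) (-c - 1) := by
    ext v; simp only [Set.mem_preimage, reflY_σ, mem_box]; omega
  have e' (P : ℤ → Prop) : reflY.σ ⁻¹' {v ∈ box a b c d | P v.1} =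
      {v ∈ box a b (-d - 1) (-c - 1) | P v.1} := by
    rw [← e]; rfl
  rw [e, e' (fun z => z = a), e' (fun z => z = b)]

lemma depOn_HCross_lowE {N : ℕ} (a b : ℤ) {c d : ℤ} (hc : -(N : ℤ) ≤ c) (hd : d < N) :
    ∃ K, DepOn (lowE K N) (HCross a b c d) := by
  obtain ⟨K, hK⟩ := exists_box_subset_rectE (N := N) a b hc hd.le
  refine ⟨K, (depOn_crossed _ _ _).mono fun e he => ⟨hK K le_rfl he, ?_⟩⟩
  have := he.1.2.2.2
  omega

/-- The dual configuration is crossed horizontally with the same probability as the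
configuration. -/
lemma strip_dual_HCross {x : ℝ} (hx : 1 ≤ x) {N : ℕ} (a b : ℤ) {c d : ℤ} (hc : -(N : ℤ) ≤ c)
    (hd : d < N) : strip x N {ω | dualSet ω ∈ HCross a b (-d - 1) (-c - 1)} =
      strip x N (HCross a b c d) := by
  obtain ⟨K, hK⟩ := depOn_HCross_lowE a b hc hd
  rw [← strip_dual hx hK]
  congr 1
  ext ω
  rw [Set.mem_ofPred_eq, Set.mem_ofPred_eq, flipDual_image, reflY_mem_HCross, dualSet]

lemma one_le_strip_add {x : ℝ} (hx : 1 ≤ x) {N n : ℕ} (hn : 1 ≤ n) (hnN : n ≤ N) {L : ℤ}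
    (hL : 1 ≤ L) :
    1 ≤ strip x N (VCross 0 (L - 1) (-n) (n - 1)) + strip x N (HCross 0 L (-n) (n - 1)) := by
  have hc : -(N : ℤ) ≤ -n := by omega
  have hd : (n : ℤ) - 1 ≤ N := by omega
  obtain ⟨K, hK⟩ := exists_box_subset_rectE (N := N) 0 (L - 1) hc hd
  have hdep : DepOn (rectE K N) (VCross 0 (L - 1) (-n) (n - 1)) :=
    (depOn_crossed _ _ _).mono (hK K le_rfl)
  rw [← strip_add_compl hx hdep]
  have e : (VCross 0 (L - 1) (-n) (n - 1))ᶜ =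
      {ω | dualSet ω ∈ HCross (-1) (L - 1) (-((n : ℤ) - 1) - 1) (-(1 - n : ℤ) - 1)} := by
    ext ω
    rw [Set.mem_compl_iff, VCross_iff (by omega) (by omega), not_not, Set.mem_ofPred_eq,
      show (0 : ℤ) - 1 = -1 by ring, show -((n : ℤ) - 1) - 1 = -n by ring,
      show -(1 - n : ℤ) - 1 = n - 1 - 1 by ring]
  rw [e, strip_dual_HCross hx _ _ (by omega) (by omega)]
  have e1 := strip_HCross_translate hx (a := 0) (b := L) hc hd (-1)
  rw [zero_add, ← sub_eq_add_neg] at e1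
  rw [← e1]
  gcongr
  refine Cyl.strip_mono hx (cyl_crossed _ _ (by omega) (by omega) _ _)
    (cyl_crossed _ _ hc hd _ _) ?_
  rintro ω ⟨u, ⟨hu, hu'⟩, v, ⟨hv, hv'⟩, huv⟩
  have hB : box (-1) (L - 1) (1 - n) (n - 1) ⊆ box (-1) (L - 1) (-n) (n - 1) := fun v hv => by
    rw [mem_box] at hv ⊢; omega
  exact ⟨u, ⟨hB hu, hu'⟩, v, ⟨hB hv, hv'⟩, conn_mono le_rfl (Set.inter_subset_inter_right _
    (inside_mono hB)) huv⟩

/-- Properties of the crossing probabilities `h L` and `v L` of `[0, L] × [-n, n - 1]` that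
imply that `h` decays at most exponentially fast at the scale `n`. -/
structure CrossingBounds (C : ℝ) (n : ℕ) (h v : ℤ → ℝ) : Prop where
  nonneg : ∀ L, 0 ≤ h L
  antitone : ∀ b b' : ℤ, 0 < b → b ≤ b' → h b' ≤ h b
  mono : ∀ b b' : ℤ, b ≤ b' → v b ≤ v b'
  dual : ∀ L : ℤ, 1 ≤ L → 1 ≤ v (L - 1) + h L
  square : ∀ w X : ℤ, 0 ≤ w → w < X - w → X ≤ 2 * n → v w ^ 2 ≤ C * h (X - 2 * w)
  extend : ∀ L s : ℤ, 0 < L → L ≤ 2 * s → 2 * s ≤ L + 1 → h L ^ 2 * v L ≤ 2 * C * h (L + s)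
  glue : ∀ b w m : ℤ, w ≤ b → w ≤ m → h b * v w * h m ≤ h (b + (m - w))

lemma crossingBounds_strip {x : ℝ} (hx : 1 ≤ x) {N n : ℕ} (hn : 1 ≤ n) (hnN : n ≤ N) :
    CrossingBounds (1 + x ^ 2) n (fun L => strip x N (HCross 0 L (-n) (n - 1)))
      (fun L => strip x N (VCross 0 L (-n) (n - 1))) := by
  have hc : -(N : ℤ) ≤ -n := by omega
  have hd : (n : ℤ) - 1 ≤ N := by omega
  refine ⟨fun L => Cyl.strip_nonneg hx (cyl_crossed _ _ hc hd _ _),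
    fun b b' hb hbb => strip_HCross_antitone hx hc hd hb hbb, fun b b' hbb => ?_,
    fun L hL => one_le_strip_add hx hn hnN hL,
    fun w X hw hwX hX => strip_VCross_sq_le hx hc hd hw hwX (by omega) (by omega),
    fun L s hL hs hs' => strip_extend hx hc hd (by omega) hL hs hs',
    fun b w m hwb hwm => strip_glue hx hc hd (by omega) hwb hwm⟩
  refine Cyl.strip_mono hx (cyl_crossed _ _ hc hd _ _) (cyl_crossed _ _ hc hd _ _) ?_
  rintro ω ⟨u, ⟨hu, hu'⟩, v, ⟨hv, hv'⟩, huv⟩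
  have hB : box 0 b (-n) (n - 1) ⊆ box 0 b' (-n) (n - 1) := fun v hv => by
    rw [mem_box] at hv ⊢; omega
  exact ⟨u, ⟨hB hu, hu'⟩, v, ⟨hB hv, hv'⟩, conn_mono le_rfl (Set.inter_subset_inter_right _
    (inside_mono hB)) huv⟩

namespace CrossingBounds
variable {C : ℝ} {n : ℕ} {h v : ℤ → ℝ}

/-- A rectangle with a width comparable to `n`, or larger, is crossed horizontally with a positive
probability, and it can be glued to its translates along a narrower rectangle. Otherwise, vertical
crossings are unlikely at all widths, hence horizontal crossings are likely. -/
lemma exists_building_block (hb : CrossingBounds C n h v) (hC : 1 ≤ C) (hn : 1 ≤ n) :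
    (∃ w m : ℤ, 0 ≤ w ∧ w < m ∧ (n : ℤ) ≤ 8 * (m - w) ∧ 1 / 2 ≤ v w ∧ 1 / (16 * C) ≤ h m) ∨
    ∀ L : ℤ, 1 ≤ L → 1 / 2 ≤ h L := by
  by_cases hw : 1 / 2 ≤ v ((n / 4 : ℕ) : ℤ)
  · left
    obtain ⟨w, hwdef⟩ : ∃ w : ℤ, w = ((n / 4 : ℕ) : ℤ) := ⟨_, rfl⟩
    rw [← hwdef] at hw
    refine ⟨w, 2 * n - 2 * w, by omega, by omega, by omega, hw, ?_⟩
    have := hb.square w (2 * n) (by omega) (by omega) le_rfl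
    rw [div_le_iff₀ (by positivity)]
    nlinarith
  by_cases hex : ∃ L : ℕ, 1 / 2 ≤ v L
  · left
    obtain ⟨L, hL, hmin⟩ : ∃ L : ℕ, 1 / 2 ≤ v L ∧ ∀ m < L, ¬ 1 / 2 ≤ v (m : ℤ) :=
      ⟨Nat.find hex, Nat.find_spec hex, fun m hm => Nat.find_min hex hm⟩
    have hL' : n / 4 < L := by
      by_contra hle
      exact hw (hL.trans (hb.mono _ _ (by omega)))
    have hv : v ((L : ℤ) - 1) < 1 / 2 := by
      have := hmin (L - 1) (by omega)
      rw [not_le] at this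
      rwa [show ((L : ℤ) - 1) = ((L - 1 : ℕ) : ℤ) by omega]
    have h1 := hb.dual L (by omega)
    have h2 := hb.extend L ((L + 1) / 2 : ℕ) (by omega) (by omega) (by omega)
    refine ⟨L, L + ((L + 1) / 2 : ℕ), by omega, by omega, by omega, hL, ?_⟩
    rw [div_le_iff₀ (by positivity)]
    have h3 : (1 / 4 : ℝ) ≤ h L ^ 2 := by nlinarith
    have h4 : (1 / 4 : ℝ) * (1 / 2) ≤ h L ^ 2 * v L := mul_le_mul h3 hL (by norm_num) (by positivity)
    linarith
  · right
    intro L hL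
    have h1 := hb.dual L hL
    have h2 : ¬ 1 / 2 ≤ v ((L - 1).toNat : ℤ) := fun h' => hex ⟨_, h'⟩
    rw [Int.toNat_of_nonneg (by omega)] at h2
    linarith

/-- The crossing estimate, in an integral form. -/
theorem pow_le (hb : CrossingBounds C n h v) (hC : 1 ≤ C) (hn : 1 ≤ n) {k : ℕ}
    {K : ℤ} (hK : 1 ≤ K) (hk : 8 * K ≤ n * k) : (1 / (32 * C)) ^ (k + 1) ≤ h K := by
  obtain ⟨θ, hθ⟩ : ∃ θ, θ = 1 / (32 * C) := ⟨_, rfl⟩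
  have hθ0 : 0 < θ := by rw [hθ]; positivity
  have hθ1 : θ ≤ 1 / 2 := by
    rw [hθ]
    exact one_div_le_one_div_of_le (by norm_num) (by linarith)
  rw [← hθ]
  rcases hb.exists_building_block hC hn with ⟨w, m, hw, hwm, hnm, hV, hH⟩ | h'
  · have hH' : 2 * θ ≤ h m := by
      refine le_trans (le_of_eq ?_) hH
      rw [hθ]; field_simp; norm_num
    have key : ∀ j : ℕ, θ ^ (j + 1) ≤ h (m + j * (m - w)) := by
      intro j
      induction j with
      | zero => simp only [zero_add, pow_one, Nat.cast_zero, zero_mul, add_zero]; linarith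
      | succ j ih =>
        have hj : 0 ≤ (j : ℤ) * (m - w) := mul_nonneg (by omega) (by omega)
        have hg := hb.glue (m + j * (m - w)) w m (by omega) hwm.le
        rw [show m + (j : ℤ) * (m - w) + (m - w) = m + ((j + 1 : ℕ) : ℤ) * (m - w) by
          push_cast; ring] at hg
        refine le_trans ?_ hg
        have h0 := hb.nonneg (m + j * (m - w))
        calc θ ^ (j + 1 + 1) = θ ^ (j + 1) * (1 / 2) * (2 * θ) := by ring
          _ ≤ h (m + j * (m - w)) * v w * h m := by gcongr
    refine (key k).trans (hb.antitone _ _ (by omega) ?_)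
    nlinarith
  · refine le_trans ?_ (h' K hK)
    calc θ ^ (k + 1) ≤ θ := by
          simpa using pow_le_pow_of_le_one hθ0.le (by linarith) (show 1 ≤ k + 1 by omega)
      _ ≤ 1 / 2 := hθ1

end CrossingBounds

theorem pow_le_strip_HCross {x : ℝ} (hx : 1 ≤ x) {N n : ℕ} (hn : 1 ≤ n) (hnN : n ≤ N) {k : ℕ}
    {K : ℤ} (hK : 1 ≤ K) (hk : 8 * K ≤ n * k) :
    (1 / (32 * (1 + x ^ 2))) ^ (k + 1) ≤ strip x N (HCross 0 K (-n) (n - 1)) :=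
  (crossingBounds_strip hx hn hnN).pow_le (by nlinarith) hn hK hk

/-! ### Edges as unordered pairs of vertices -/

/-- The unordered pair of the ends of an edge. -/
def toSym (e : Edge) : Sym2 (ℤ × ℤ) := s(src e, tgt e)

lemma toSym_injective : Function.Injective toSym := by
  rintro ⟨_ | _, x, y⟩ ⟨_ | _, x', y'⟩ h <;>
    simp only [toSym, src_eH, tgt_eH, src_eV, tgt_eV, Sym2.eq_iff, Prod.mk.injEq] at h ⊢ <;>
    simp only [true_and, Bool.false_eq_true, Bool.true_eq_false, false_and] <;> omega

lemma lattice_adj_iff {u v : ℤ × ℤ} : lattice.Adj u v ↔ ∃ e, toSym e = s(u, v) := by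
  obtain ⟨a, b⟩ := u
  obtain ⟨a', b'⟩ := v
  change |a - a'| + |b - b'| = 1 ↔ _
  constructor
  · intro h
    have h' : (a' = a + 1 ∧ b' = b) ∨ (a = a' + 1 ∧ b' = b) ∨ (a' = a ∧ b' = b + 1) ∨
        (a' = a ∧ b = b' + 1) := by
      rcases abs_cases (a - a') with h1 | h1 <;> rcases abs_cases (b - b') with h2 | h2 <;> omega
    rcases h' with ⟨rfl, rfl⟩ | ⟨rfl, rfl⟩ | ⟨rfl, rfl⟩ | ⟨rfl, rfl⟩
    · exact ⟨eH a b', rfl⟩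
    · exact ⟨eH a' b', Sym2.eq_swap⟩
    · exact ⟨eV a' b, rfl⟩
    · exact ⟨eV a' b', Sym2.eq_swap⟩
  · rintro ⟨⟨_ | _, x, y⟩, h⟩ <;>
      simp only [toSym, src_eH, tgt_eH, src_eV, tgt_eV, Sym2.eq_iff, Prod.mk.injEq] at h <;>
      rcases h with ⟨⟨rfl, rfl⟩, rfl, rfl⟩ | ⟨⟨rfl, rfl⟩, rfl, rfl⟩ <;> simp

lemma mem_edgeSet_iff {f : Sym2 (ℤ × ℤ)} : f ∈ lattice.edgeSet ↔ ∃ e, toSym e = f := by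
  induction f using Sym2.ind with
  | _ u v => rw [SimpleGraph.mem_edgeSet, lattice_adj_iff]

lemma edgesIn_rect (M N : ℕ) : edgesIn (rect M N) = (rectE M N).image toSym := by
  ext f
  rw [edgesIn, Finset.mem_filter, mem_edgeSet_iff, Finset.mem_image]
  constructor
  · rintro ⟨h, e, rfl⟩
    rw [toSym, Finset.mk_mem_sym2_iff] at h
    exact ⟨e, mem_rectE.2 h, rfl⟩
  · rintro ⟨e, he, rfl⟩
    rw [mem_rectE] at he
    exact ⟨by rw [toSym, Finset.mk_mem_sym2_iff]; exact he, e, rfl⟩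

/-! ### The measures on rectangles -/

lemma reachable_of_conn {α : Type*} {G : SimpleGraph α} (i : α → ℤ × ℤ)
    (hi : Function.Injective i) {r : Setoid (ℤ × ℤ)} {ω : Set Edge}
    (hr : ∀ u v, r u v → u ≠ v → ∃ a b, i a = u ∧ i b = v ∧ G.Reachable a b)
    (hω : ∀ e ∈ ω, ∃ a b, i a = src e ∧ i b = tgt e ∧ G.Reachable a b) {a b : α}
    (h : conn r ω (i a) (i b)) : G.Reachable a b := by
  have hK : ∀ u v c d, i c = u → i d = v → G.Reachable c d →
      (u ∈ {w | ∃ b, i b = w ∧ G.Reachable a b} ↔ v ∈ {w | ∃ b, i b = w ∧ G.Reachable a b}) := by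
    rintro u v c d rfl rfl hcd
    constructor
    · rintro ⟨b, hb, hab⟩
      exact ⟨d, rfl, (hi hb ▸ hab).trans hcd⟩
    · rintro ⟨b, hb, hab⟩
      exact ⟨c, rfl, (hi hb ▸ hab).trans hcd.symm⟩
  have h1 : r ≤ Setoid.ker fun w => w ∈ {w | ∃ b, i b = w ∧ G.Reachable a b} := by
    intro u v huv
    rw [Setoid.ker_def, eq_iff_iff]
    by_cases huv' : u = v
    · rw [huv']
    · obtain ⟨c, d, hc, hd, hcd⟩ := hr u v huv huv'
      exact hK u v c d hc hd hcd
  obtain ⟨b', hb', h'⟩ := (conn_mem_iff h1 (fun e he => by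
    obtain ⟨c, d, hc, hd, hcd⟩ := hω e he
    exact hK _ _ c d hc hd hcd) h).1 ⟨a, rfl, SimpleGraph.Reachable.refl a⟩
  exact hi hb' ▸ h'

lemma numClusters_eq {V : Finset (ℤ × ℤ)} {ξ : Setoid (ℤ × ℤ)} (hξ : IsBoundaryCondition V ξ)
    {ω : Set Edge} (hω : ω ⊆ inside V) :
    numClusters V ξ (toSym '' ω) = ncl V (conn ξ ω) := by
  unfold numClusters
  set G := SimpleGraph.fromRel
    (fun u v : V => s((u : ℤ × ℤ), (v : ℤ × ℤ)) ∈ toSym '' ω ∨ ξ u v) with hG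
  have hadj : ∀ u v : V, (s((u : ℤ × ℤ), (v : ℤ × ℤ)) ∈ toSym '' ω ∨ ξ u v) →
      G.Reachable u v := by
    intro u v h
    by_cases huv : u = v
    · rw [huv]
    · exact SimpleGraph.Adj.reachable ((SimpleGraph.fromRel_adj _ _ _).2 ⟨huv, Or.inl h⟩)
  have key : ∀ u v : V, G.Reachable u v ↔ conn ξ ω (u : ℤ × ℤ) v := by
    intro u v
    constructor
    · rw [SimpleGraph.reachable_iff_reflTransGen]
      intro h
      have hs : ∀ u v : V, (s((u : ℤ × ℤ), (v : ℤ × ℤ)) ∈ toSym '' ω ∨ ξ u v) →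
          conn ξ ω (u : ℤ × ℤ) v := by
        rintro u v (⟨e, he, h⟩ | h)
        · rw [toSym, Sym2.eq_iff] at h
          rcases h with ⟨h1, h2⟩ | ⟨h1, h2⟩
          · rw [← h1, ← h2]; exact conn_edge he
          · rw [← h1, ← h2]; exact Setoid.symm' _ (conn_edge he)
        · exact le_conn _ _ h
      induction h with
      | refl => exact Setoid.refl' _ _
      | tail _ h ih =>
        rcases ((SimpleGraph.fromRel_adj _ _ _).1 h).2 with h' | h'
        · exact Setoid.trans' _ ih (hs _ _ h')
        · exact Setoid.trans' _ ih (Setoid.symm' _ (hs _ _ h'))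
    · intro h
      refine reachable_of_conn (fun w : V => (w : ℤ × ℤ)) Subtype.val_injective (fun a b hab hne => ?_)
        (fun e he => ?_) h
      · obtain ⟨h1, h2⟩ := hξ a b hab hne
        exact ⟨⟨a, h1.1⟩, ⟨b, h2.1⟩, rfl, rfl, hadj _ _ (Or.inr hab)⟩
      · exact ⟨⟨src e, (hω he).1⟩, ⟨tgt e, (hω he).2⟩, rfl, rfl, hadj _ _ (Or.inl ⟨e, he, rfl⟩)⟩
  rw [ncl, ← Fintype.card_coe, ← Nat.card_eq_fintype_card]
  let f : G.ConnectedComponent → (V.image (Quotient.mk (conn ξ ω)) : Finset _) :=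
    SimpleGraph.ConnectedComponent.lift (fun v => ⟨Quotient.mk _ (v : ℤ × ℤ),
      Finset.mem_image_of_mem _ v.2⟩) fun u v p _ => Subtype.ext
        ((Quotient.eq (r := conn ξ ω)).2 ((key u v).1 p.reachable))
  refine Nat.card_eq_of_bijective f ⟨?_, ?_⟩
  · intro c c'
    induction c using SimpleGraph.ConnectedComponent.ind with | _ u
    induction c' using SimpleGraph.ConnectedComponent.ind with | _ v
    intro h
    have h1 := (Quotient.eq (r := conn ξ ω)).1 (Subtype.ext_iff.1 h)
    exact SimpleGraph.ConnectedComponent.eq.2 ((key u v).2 h1)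
  · rintro ⟨c, hc⟩
    obtain ⟨v, hv, rfl⟩ := Finset.mem_image.1 hc
    exact ⟨G.connectedComponentMk ⟨v, hv⟩, rfl⟩

lemma endsIn_rectE (M N : ℕ) : EndsIn (rect M N) (rectE M N) := fun _ he => mem_rectE.1 he

lemma fkWeight_eq {q : ℝ} (hq : 1 ≤ q) {M N : ℕ} {ξ : Setoid (ℤ × ℤ)}
    (hξ : IsBoundaryCondition (rect M N) ξ) {ω : Finset Edge} (hω : ω ⊆ rectE M N) :
    fkWeight (rect M N) (pSd q) q ξ (ω.image toSym) =
      wt (rect M N) ξ (Real.sqrt q) ω / (1 + Real.sqrt q) ^ (rectE M N).card := by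
  have hx : 0 < 1 + Real.sqrt q := by positivity
  have h1 : 1 - pSd q = 1 / (1 + Real.sqrt q) := by unfold pSd; field_simp; ring
  have hin : (ω : Set Edge) ⊆ inside (rect M N) := fun e he => mem_rectE.1 (hω he)
  have hcard := Finset.card_le_card hω
  unfold fkWeight
  rw [h1, edgesIn_rect, Finset.card_image_of_injective _ toSym_injective,
    Finset.card_image_of_injective _ toSym_injective, Finset.coe_image, numClusters_eq hξ hin,
    wt, pSd, div_pow, one_div, inv_pow, pow_add, pow_mul, Real.sq_sqrt (by linarith)]
  have h2 : (1 + Real.sqrt q) ^ (rectE M N).card =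
      (1 + Real.sqrt q) ^ ω.card * (1 + Real.sqrt q) ^ ((rectE M N).card - ω.card) := by
    rw [← pow_add, Nat.add_sub_cancel' hcard]
  rw [h2]
  field_simp

lemma sum_powerset_edgesIn (M N : ℕ) (f : Finset (Sym2 (ℤ × ℤ)) → ℝ) :
    ∑ ω ∈ (edgesIn (rect M N)).powerset, f ω = ∑ ω ∈ (rectE M N).powerset, f (ω.image toSym) := by
  rw [edgesIn_rect, Finset.powerset_image, Finset.sum_image]
  intro a _ b _ h
  exact Finset.image_injective toSym_injective h

theorem fkMeasure_real {q : ℝ} (hq : 1 ≤ q) {M N : ℕ} {ξ : Setoid (ℤ × ℤ)}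
    (hξ : IsBoundaryCondition (rect M N) ξ) (A : Set Config) :
    (fkMeasure (rect M N) (pSd q) q ξ).real A =
      pr (Real.sqrt q) (rectE M N) ξ {ω | toSym '' ω ∈ A} := by
  have hx : 1 ≤ Real.sqrt q := Real.one_le_sqrt.2 hq
  have hw : ∀ ω ⊆ rectE M N, fkWeight (rect M N) (pSd q) q ξ (ω.image toSym) =
      wt (rect M N) ξ (Real.sqrt q) ω / (1 + Real.sqrt q) ^ (rectE M N).card :=
    fun ω hω => fkWeight_eq hq hξ hω
  have hZ : fkPartition (rect M N) (pSd q) q ξ =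
      wsum (rectE M N) (wt (rect M N) ξ (Real.sqrt q)) Set.univ /
        (1 + Real.sqrt q) ^ (rectE M N).card := by
    rw [fkPartition, sum_powerset_edgesIn, wsum_univ, Finset.sum_div]
    exact Finset.sum_congr rfl fun ω hω => hw ω (Finset.mem_powerset.1 hω)
  rw [pr_eq hx (endsIn_rectE M N), fkMeasure, measureReal_def, Measure.finsetSum_apply,
    ENNReal.toReal_sum (fun ω _ => ?_)]
  · simp only [Measure.smul_apply, Measure.dirac_apply, smul_eq_mul, ENNReal.toReal_mul]
    rw [sum_powerset_edgesIn, wsum, Finset.sum_div]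
    refine Finset.sum_congr rfl fun ω hω => ?_
    have hpos := wt_pos (rect M N) ξ hx ω
    have hzpos := wsum_univ_pos (S := rectE M N) (wt_pos (rect M N) ξ hx)
    have h1 : (0 : ℝ) < (1 + Real.sqrt q) ^ (rectE M N).card := by positivity
    rw [hw ω (Finset.mem_powerset.1 hω), hZ, div_div_div_cancel_right₀ h1.ne',
      ENNReal.toReal_ofReal (by positivity), Finset.coe_image]
    by_cases hA : toSym '' (ω : Set Edge) ∈ A
    · have hA' : (ω : Set Edge) ∈ {ω | toSym '' ω ∈ A} := hA
      rw [Set.indicator_of_mem hA, if_pos hA']; simp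
    · have hA' : (ω : Set Edge) ∉ {ω | toSym '' ω ∈ A} := hA
      rw [Set.indicator_of_notMem hA, if_neg hA']; simp
  · rw [Measure.smul_apply, Measure.dirac_apply, smul_eq_mul]
    refine ENNReal.mul_ne_top ENNReal.ofReal_ne_top ?_
    unfold Set.indicator
    split_ifs <;> simp

lemma IsTopWiredBottomFree.adm {M N : ℕ} {ξ : Setoid (ℤ × ℤ)} (h : IsTopWiredBottomFree M N ξ) :
    Adm M N ξ := by
  refine ⟨h.top_wired, fun u hu h1 h2 h3 v huv => ?_⟩
  by_cases hb : u.2 = -N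
  · exact (h.bottom_free u hu hb v huv).symm
  · by_contra hne
    obtain ⟨-, w, hw, hwn⟩ := (h.isBoundaryCondition u v huv (Ne.symm hne)).1
    rw [mem_rect] at hu
    rw [lattice_adj_iff] at hw
    obtain ⟨e, he⟩ := hw
    apply hwn
    rw [toSym, Sym2.eq_iff] at he
    rw [mem_rect]
    rcases e with ⟨_ | _, x, y⟩ <;> rcases he with ⟨rfl, rfl⟩ | ⟨rfl, rfl⟩ <;>
      simp only [src_eH, tgt_eH, src_eV, tgt_eV] at hu h1 h2 h3 hb ⊢ <;> omega

lemma exists_isTopWiredBottomFree (M : ℕ) {N : ℕ} (hN : 1 ≤ N) :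
    ∃ ξ, IsTopWiredBottomFree M N ξ := by
  refine ⟨wire {v | v ∈ rect M N ∧ v.2 = N}, ?_, ?_, ?_⟩
  · have hb : ∀ v ∈ {v : ℤ × ℤ | v ∈ rect M N ∧ v.2 = N}, v ∈ boundary (rect M N) := by
      rintro ⟨x, y⟩ ⟨hv, hv'⟩
      refine ⟨hv, (x, y + 1), lattice_adj_iff.2 ⟨eV x y, rfl⟩, fun h => ?_⟩
      rw [mem_rect] at h
      simp only at h hv'
      omega
    rintro u v (h | ⟨h1, h2⟩) hne
    exacts [absurd h hne, ⟨hb u h1, hb v h2⟩]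
  · exact fun u hu v hv hu' hv' => Or.inr ⟨⟨hu, hu'⟩, hv, hv'⟩
  · rintro u hu hu' v (h | h)
    · exact h
    · have := h.1.2
      omega

/-! ### Existence of the limiting measure -/

lemma exists_rectE_mem {N : ℕ} (F : Finset (Sym2 (ℤ × ℤ))) :
    ∃ K, ∀ e ∈ stripE N, toSym e ∈ F → e ∈ rectE K N := by
  have hfin : {e : Edge | toSym e ∈ F}.Finite :=
    F.finite_toSet.preimage toSym_injective.injOn
  obtain ⟨K, hK⟩ := (hfin.image fun e => (src e).1.natAbs).bddAbove
  refine ⟨K + 1, fun e he heF => ?_⟩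
  have := hK ⟨e, heF, rfl⟩
  rw [mem_rectE]
  rcases e with ⟨_ | _, x, y⟩ <;>
    simp only [stripE, inside, Set.mem_ofPred_eq, Finset.mem_coe, mem_rect, src_eH, tgt_eH, src_eV,
      tgt_eV] at he this ⊢ <;> push_cast <;> omega

lemma IsLocal.cyl {A : Set Config} (hA : IsLocal A) (N : ℕ) :
    Cyl N {ω | toSym '' (ω ∩ stripE N) ∈ A} := by
  obtain ⟨F, hF⟩ := hA
  obtain ⟨K, hK⟩ := exists_rectE_mem (N := N) F
  refine ⟨K, fun ω ω' h => hF _ _ fun f hf => ?_⟩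
  have key : ∀ ω ω' : Set Edge, ω ∩ rectE K N = ω' ∩ rectE K N → f ∈ toSym '' (ω ∩ stripE N) →
      f ∈ toSym '' (ω' ∩ stripE N) := by
    rintro ω ω' h ⟨e, ⟨he, hes⟩, rfl⟩
    have h1 : e ∈ ω ∩ rectE K N := ⟨he, hK e hes hf⟩
    rw [h] at h1
    exact ⟨e, ⟨h1.1, hes⟩, rfl⟩
  exact ⟨key _ _ h, key _ _ h.symm⟩

lemma IsLocal.measurableSet {A : Set Config} (hA : IsLocal A) : MeasurableSet A := by
  obtain ⟨F, hF⟩ := hA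
  let g : Config → (F → Prop) := fun ω e => (e : Sym2 (ℤ × ℤ)) ∈ ω
  have hg : Measurable g := measurable_pi_iff.2 fun e => measurable_set_mem _
  have e : A = g ⁻¹' (g '' A) := by
    refine Set.Subset.antisymm (Set.subset_preimage_image _ _) ?_
    rintro ω ⟨ω', hω', h⟩
    refine (hF ω' ω fun e he => ?_).1 hω'
    exact iff_of_eq (congrFun h ⟨e, he⟩)
  rw [e]
  exact hg MeasurableSet.of_discrete

theorem tendsto_fkMeasure {q : ℝ} (hq : 1 ≤ q) {N : ℕ} {ξ : ℕ → Setoid (ℤ × ℤ)}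
    (hξ : ∀ M, IsTopWiredBottomFree M N (ξ M)) {A : Set Config} (hA : IsLocal A) :
    Tendsto (fun M => (fkMeasure (rect M N) (pSd q) q (ξ M)).real A) atTop
      (𝓝 (strip (Real.sqrt q) N {ω | toSym '' (ω ∩ stripE N) ∈ A})) := by
  have hx : 1 ≤ Real.sqrt q := Real.one_le_sqrt.2 hq
  obtain ⟨K₀, hK₀⟩ := hA.cyl N
  rw [Metric.tendsto_atTop]
  intro ε hε
  obtain ⟨K, -, hK⟩ := strip_spec hx hK₀ (half_pos hε)
  refine ⟨K, fun M hM => ?_⟩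
  have h := hK _ (rectE_mono hM) (rectE_subset_stripE M N) _ ((hξ M).adm.mono hM)
  have e : pr (Real.sqrt q) (rectE M N) (ξ M) {ω | toSym '' ω ∈ A} =
      pr (Real.sqrt q) (rectE M N) (ξ M) {ω | toSym '' (ω ∩ stripE N) ∈ A} := by
    have : ∀ ω ⊆ (rectE M N : Set Edge), ω ∩ stripE N = ω := fun ω hω =>
      Set.inter_eq_left.2 (hω.trans (rectE_subset_stripE M N))
    refine le_antisymm (pr_mono hx fun ω hω h => ?_) (pr_mono hx fun ω hω h => ?_)
    · rwa [Set.mem_ofPred_eq, this ω hω]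
    · rwa [Set.mem_ofPred_eq, this ω hω] at h
  rw [Real.dist_eq, fkMeasure_real hq (hξ M).isBoundaryCondition, e]
  linarith

lemma isProbabilityMeasure_fkMeasure {q : ℝ} (hq : 1 ≤ q) {M N : ℕ} {ξ : Setoid (ℤ × ℤ)}
    (hξ : IsBoundaryCondition (rect M N) ξ) :
    IsProbabilityMeasure (fkMeasure (rect M N) (pSd q) q ξ) := by
  have h := fkMeasure_real hq hξ Set.univ
  have hx : 1 ≤ Real.sqrt q := Real.one_le_sqrt.2 hq
  have e : {ω : Set Edge | toSym '' ω ∈ (Set.univ : Set Config)} = Set.univ := by ext; simp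
  rw [e, pr_univ hx, measureReal_def] at h
  exact ⟨(ENNReal.toReal_eq_one_iff _).1 h⟩

/-- The configuration of the strip with the given states of the edges. -/
def ofStates (N : ℕ) (η : Edge → Bool) : Config := toSym '' ({e | η e = true} ∩ stripE N)

lemma measurable_ofStates (N : ℕ) : Measurable (ofStates N) := by
  rw [measurable_set_iff]
  intro f
  by_cases h : ∃ e ∈ stripE N, toSym e = f
  · obtain ⟨e, he, rfl⟩ := h
    have : (fun η => toSym e ∈ ofStates N η) = fun η => η e = true := by
      funext η
      refine propext ⟨?_, fun h => ⟨e, ⟨h, he⟩, rfl⟩⟩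
      rintro ⟨e', ⟨h1, -⟩, h2⟩
      rwa [← toSym_injective h2]
    rw [this]
    exact (Measurable.of_discrete (f := fun b : Bool => b = true)).comp (measurable_pi_apply e)
  · have : (fun η => f ∈ ofStates N η) = fun _ => False := by
      funext η
      refine propext ⟨?_, False.elim⟩
      rintro ⟨e, ⟨-, he⟩, rfl⟩
      exact h ⟨e, he, rfl⟩
    rw [this]
    exact measurable_const

/-- Existence of the limit, by compactness of the set of probability measures on a compact
space. -/
theorem exists_isStripMeasure {q : ℝ} (hq : 1 ≤ q) {N : ℕ} (hN : 1 ≤ N) :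
    ∃ φ : Measure Config, IsProbabilityMeasure φ ∧ ∀ A, IsLocal A →
      φ.real A = strip (Real.sqrt q) N {ω | toSym '' (ω ∩ stripE N) ∈ A} := by
  choose ξ hξ using fun M => exists_isTopWiredBottomFree M hN
  let g : Config → Edge → Bool := fun ω e => decide (toSym e ∈ ω)
  have hg : Measurable g := measurable_pi_iff.2 fun e =>
    (Measurable.of_discrete (f := fun p : Prop => decide p)).comp (measurable_set_mem _)
  have hprob : ∀ M, IsProbabilityMeasure (fkMeasure (rect M N) (pSd q) q (ξ M)) := fun M =>
    isProbabilityMeasure_fkMeasure hq (hξ M).isBoundaryCondition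
  let ν : ℕ → ProbabilityMeasure (Edge → Bool) := fun M =>
    ⟨(fkMeasure (rect M N) (pSd q) q (ξ M)).map g,
      Measure.isProbabilityMeasure_map hg.aemeasurable⟩
  let U : Ultrafilter ℕ := Ultrafilter.of atTop
  have hU : (U : Filter ℕ) ≤ atTop := Ultrafilter.of_le atTop
  obtain ⟨μ, -, hμ⟩ := isCompact_univ.ultrafilter_le_nhds (U.map ν) (by simp)
  have hμ' : Tendsto ν U (𝓝 μ) := hμ
  refine ⟨(μ : Measure (Edge → Bool)).map (ofStates N),
    Measure.isProbabilityMeasure_map (measurable_ofStates N).aemeasurable, fun A hA => ?_⟩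
  rw [map_measureReal_apply (measurable_ofStates N) hA.measurableSet]
  -- a local event is open and closed
  have hclopen : IsClopen (ofStates N ⁻¹' A) := by
    obtain ⟨F, hF⟩ := hA
    have hfin : {e : Edge | toSym e ∈ F}.Finite := F.finite_toSet.preimage toSym_injective.injOn
    have : Finite {e : Edge | toSym e ∈ F} := hfin
    let ρ : (Edge → Bool) → ({e : Edge | toSym e ∈ F} → Bool) := fun η e => η e
    have hρ : Continuous ρ := by fun_prop
    have e : ofStates N ⁻¹' A = ρ ⁻¹' (ρ '' (ofStates N ⁻¹' A)) := by
      refine Set.Subset.antisymm (Set.subset_preimage_image _ _) ?_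
      rintro η ⟨η', hη', h⟩
      refine (hF _ _ fun f hf => ?_).1 hη'
      have key : ∀ η η' : Edge → Bool, ρ η = ρ η' → f ∈ ofStates N η → f ∈ ofStates N η' := by
        rintro η η' h ⟨e, ⟨h1, h2⟩, rfl⟩
        exact ⟨e, ⟨(congrFun h ⟨e, hf⟩).symm.trans h1, h2⟩, rfl⟩
      exact ⟨key _ _ h, key _ _ h.symm⟩
    rw [e]
    exact (isClopen_discrete _).preimage hρ
  have h1 := ProbabilityMeasure.tendsto_measure_of_isClopen_of_tendsto hμ' hclopen
  have h2 : Tendsto (fun M => ((ν M : Measure (Edge → Bool)).real (ofStates N ⁻¹' A))) U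
      (𝓝 ((μ : Measure (Edge → Bool)).real (ofStates N ⁻¹' A))) :=
    (NNReal.tendsto_coe.2 h1)
  refine tendsto_nhds_unique h2 (Tendsto.congr (fun M => ?_) ((tendsto_fkMeasure hq hξ hA).mono_left hU))
  change _ = ((fkMeasure (rect M N) (pSd q) q (ξ M)).map g).real _
  rw [map_measureReal_apply hg (measurable_ofStates N hA.measurableSet),
    fkMeasure_real hq (hξ M).isBoundaryCondition, fkMeasure_real hq (hξ M).isBoundaryCondition]
  have hx : 1 ≤ Real.sqrt q := Real.one_le_sqrt.2 hq
  have e : ∀ ω ⊆ (rectE M N : Set Edge), ofStates N (g (toSym '' ω)) = toSym '' ω := by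
    intro ω hω
    unfold ofStates
    congr 1
    ext e
    simp only [g, decide_eq_true_eq, Set.mem_inter_iff, Set.mem_ofPred_eq,
      toSym_injective.mem_set_image, and_iff_left_iff_imp]
    exact fun he => rectE_subset_stripE M N (hω he)
  refine le_antisymm (pr_mono hx fun ω hω h => ?_) (pr_mono hx fun ω hω h => ?_)
  · change ofStates N (g (toSym '' ω)) ∈ A
    rwa [e ω hω]
  · change ofStates N (g (toSym '' ω)) ∈ A at h
    rwa [e ω hω] at h

/-! ### The crossing events -/

lemma isLocal_preimage {N : ℕ} {A : Set (Set Edge)} (hA : Cyl N A) :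
    IsLocal {ω : Config | toSym ⁻¹' ω ∈ A} := by
  obtain ⟨K, hK⟩ := hA
  refine ⟨(rectE K N).image toSym, fun ω ω' h => hK _ _ ?_⟩
  ext e
  simp only [Set.mem_inter_iff, Set.mem_preimage, and_congr_left_iff]
  exact fun he => h _ (Finset.mem_image_of_mem _ he)

lemma preimage_image_inter {N : ℕ} {A : Set (Set Edge)} (hA : Cyl N A) :
    {ω | toSym '' (ω ∩ stripE N) ∈ {ω : Config | toSym ⁻¹' ω ∈ A}} = A := by
  obtain ⟨K, hK⟩ := hA
  ext ω
  rw [Set.mem_ofPred_eq, Set.mem_ofPred_eq, Set.preimage_image_eq _ toSym_injective]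
  refine hK _ _ ?_
  rw [Set.inter_assoc, Set.inter_eq_right.2 (rectE_subset_stripE K N)]

/-- A connection in terms of edges is a path in the graph of open edges. -/
lemma reachable_induce {η : Set Edge} {ω : Config} {S : Set (ℤ × ℤ)}
    (hη : ∀ e ∈ η, toSym e ∈ ω ∧ src e ∈ S ∧ tgt e ∈ S) {u v : ℤ × ℤ} (hu : u ∈ S) (hv : v ∈ S)
    (huv : conn ⊥ η u v) :
    ((SimpleGraph.fromEdgeSet ω).induce S).Reachable ⟨u, hu⟩ ⟨v, hv⟩ := by
  refine reachable_of_conn (fun w : S => (w : ℤ × ℤ)) Subtype.val_injective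
    (fun a b hab hne => absurd hab hne) (fun e he => ?_) huv
  obtain ⟨h1, h2, h3⟩ := hη e he
  refine ⟨⟨_, h2⟩, ⟨_, h3⟩, rfl, rfl, SimpleGraph.Adj.reachable ?_⟩
  rw [SimpleGraph.comap_adj]
  exact (SimpleGraph.fromEdgeSet_adj _).2 ⟨h1, src_ne_tgt e⟩

lemma crossedHorizontally_of_conn {δ a b : ℝ} {ω : Config} {η : Set Edge} {x₁ x₂ c d : ℤ}
    (hx₁ : -a - 1 < x₁ + δ) (hx₁' : x₁ + δ ≤ -a) (hx₂ : a ≤ x₂ + δ) (hx₂' : x₂ + δ < a + 1)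
    (hc : -b ≤ c + δ) (hd : d + δ ≤ b) (hη : ∀ e ∈ η ∩ inside (box x₁ x₂ c d), toSym e ∈ ω)
    (h : η ∈ HCross x₁ x₂ c d) : CrossedHorizontally δ a b ω := by
  obtain ⟨u, ⟨hu, hu'⟩, v, ⟨hv, hv'⟩, huv⟩ := h
  have hS : ∀ w ∈ box x₁ x₂ c d,
      w ∈ {w : ℤ × ℤ | |(w.1 : ℝ) + δ| < a + 1 ∧ |(w.2 : ℝ) + δ| ≤ b} := by
    intro w hw
    rw [mem_box] at hw
    have h1 : (x₁ : ℝ) ≤ w.1 := by exact_mod_cast hw.1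
    have h2 : (w.1 : ℝ) ≤ x₂ := by exact_mod_cast hw.2.1
    have h3 : (c : ℝ) ≤ w.2 := by exact_mod_cast hw.2.2.1
    have h4 : (w.2 : ℝ) ≤ d := by exact_mod_cast hw.2.2.2
    refine ⟨abs_lt.2 ⟨by linarith, by linarith⟩, abs_le.2 ⟨by linarith, by linarith⟩⟩
  refine ⟨⟨u, hS u hu⟩, ⟨v, hS v hv⟩, ?_, ?_, ?_⟩
  · simp only [hu']; exact hx₁'
  · simp only [hv']; exact hx₂
  · exact reachable_induce (fun e he => ⟨hη e he, hS _ he.2.1, hS _ he.2.2⟩) _ _ huv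

lemma mem_dualConfig_of_mem_dualSet {N : ℕ} {ω : Config} {f : Edge} {a b c d : ℤ}
    (hc : -(N : ℤ) ≤ c) (hd : d < N) (hf : f ∈ dualSet (toSym ⁻¹' ω) ∩ inside (box a b c d)) :
    toSym f ∈ dualConfig (stripEdges N) ω := by
  obtain ⟨⟨e, he, rfl⟩, hin⟩ := hf
  have hstrip : toSym e ∈ stripEdges N := by
    refine ⟨mem_edgeSet_iff.2 ⟨e, rfl⟩, fun v hv => ?_⟩
    rw [toSym, Sym2.mem_iff] at hv
    rw [abs_le]
    rcases e with ⟨_ | _, x, y⟩ <;> rcases hv with rfl | rfl <;>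
      simp only [inside, Set.mem_ofPred_eq, mem_box, plDual_eH, plDual_eV, src_eH, tgt_eH, src_eV,
        tgt_eV] at hin ⊢ <;> omega
  rcases e with ⟨_ | _, x, y⟩
  · exact ⟨x, y, Or.inl ⟨by simp [toSym], hstrip, he⟩⟩
  · exact ⟨x, y, Or.inr ⟨by simp [toSym], hstrip, he⟩⟩

lemma cyl_dual_HCross {N : ℕ} (a b : ℤ) {c d : ℤ} (hc : -(N : ℤ) ≤ c) (hd : d < N) :
    Cyl N {ω | dualSet ω ∈ HCross a b (-d - 1) (-c - 1)} := by
  obtain ⟨K, hK⟩ := depOn_HCross_lowE a b hc hd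
  have e : {ω | dualSet ω ∈ HCross a b (-d - 1) (-c - 1)} =
      {ω | flipDual.t '' ωᶜ ∈ HCross a b c d} := by
    ext ω
    rw [Set.mem_ofPred_eq, Set.mem_ofPred_eq, flipDual_image, reflY_mem_HCross, dualSet]
  exact ⟨K + 1, e ▸ (depOn_dual hK).mono (lowE_subset _ _)⟩

lemma strip_HCross_congr {x : ℝ} (hx : 1 ≤ x) {N : ℕ} {a b c d : ℤ} (hc : -(N : ℤ) ≤ c)
    (hd : d ≤ N) : strip x N (HCross a b c d) = strip x N (HCross 0 (b - a) c d) := by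
  have := strip_HCross_translate hx (a := 0) (b := b - a) hc hd a
  rwa [zero_add, sub_add_cancel] at this

/-- The crossing estimate with a real exponent. -/
theorem rpow_le_strip_HCross {x : ℝ} (hx : 1 ≤ x) {N n : ℕ} (hn : 1 ≤ n) (hnN : n ≤ N) {ρ : ℝ}
    (hρ : 1 ≤ ρ) {K : ℤ} (hK : 1 ≤ K) (hKρ : (K : ℝ) ≤ 2 * (ρ * n) + 2) :
    ((1 / (32 * (1 + x ^ 2))) ^ 34) ^ ρ ≤ strip x N (HCross 0 K (-n) (n - 1)) := by
  obtain ⟨θ, hθ⟩ : ∃ θ, θ = 1 / (32 * (1 + x ^ 2)) := ⟨_, rfl⟩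
  have hθ0 : 0 < θ := by rw [hθ]; positivity
  have hθ1 : θ ≤ 1 := by
    rw [hθ]
    exact div_le_one_of_le₀ (by nlinarith) (by positivity)
  have hk1 := Nat.le_ceil (32 * ρ)
  have hk2 := Nat.ceil_lt_add_one (show 0 ≤ 32 * ρ by positivity)
  have hn' : (1 : ℝ) ≤ n := by exact_mod_cast hn
  have h := pow_le_strip_HCross hx hn hnN (k := ⌈32 * ρ⌉₊) hK (by
    have h1 : (8 : ℝ) * K ≤ n * ⌈32 * ρ⌉₊ := by
      have h2 : (n : ℝ) * (32 * ρ) ≤ n * ⌈32 * ρ⌉₊ := by gcongr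
      nlinarith [mul_le_mul hρ hn' (by norm_num) (by linarith)]
    exact_mod_cast h1)
  rw [← hθ] at h ⊢
  refine le_trans ?_ h
  rw [← Real.rpow_natCast, ← Real.rpow_natCast, ← Real.rpow_mul hθ0.le]
  refine Real.rpow_le_rpow_of_exponent_ge hθ0 hθ1 ?_
  push_cast
  linarith

end FKStrip

end

theorem mainTheorem9 (q : ℝ) (hq : 1 ≤ q) :
    ∃ c : ℝ, 0 < c ∧ ∀ N : ℕ, 1 ≤ N →
      ∃ φ : MeasureTheory.Measure FKStrip.Config,
        FKStrip.IsStripMeasure N (FKStrip.pSd q) q φ ∧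
        ∀ (ρ : ℝ) (n : ℕ), 1 ≤ ρ → 1 ≤ n → n ≤ N →
          c ^ ρ ≤ φ.real {ω | FKStrip.CrossedHorizontally 0 (ρ * n) n ω} ∧
          c ^ ρ ≤ φ.real {ω | FKStrip.CrossedHorizontally (1 / 2) (ρ * n) n
            (FKStrip.dualConfig (FKStrip.stripEdges N) ω)} := by
  have hx : 1 ≤ Real.sqrt q := Real.one_le_sqrt.2 hq
  refine ⟨(1 / (32 * (1 + Real.sqrt q ^ 2))) ^ 34, by positivity, fun N hN => ?_⟩
  obtain ⟨φ, hφ, hφA⟩ := FKStrip.exists_isStripMeasure hq hN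
  refine ⟨φ, ⟨hφ, fun ξ hξ A hA => ?_⟩, fun ρ n hρ hn hnN => ?_⟩
  · rw [hφA A hA]
    exact FKStrip.tendsto_fkMeasure hq hξ hA
  have hn' : (1 : ℝ) ≤ n := by exact_mod_cast hn
  have hρn : 1 ≤ ρ * n := one_le_mul_of_one_le_of_one_le hρ hn'
  have hreal : ∀ A, FKStrip.Cyl N A →
      φ.real {ω | FKStrip.toSym ⁻¹' ω ∈ A} = FKStrip.strip (Real.sqrt q) N A := fun A hA => by
    rw [hφA _ (FKStrip.isLocal_preimage hA), FKStrip.preimage_image_inter hA]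
  constructor
  · obtain ⟨K, hK⟩ : ∃ K : ℤ, K = ⌈ρ * n⌉ := ⟨_, rfl⟩
    have h1 := Int.le_ceil (ρ * n)
    have h2 := Int.ceil_lt_add_one (ρ * n)
    rw [← hK] at h1 h2
    have hK1 : (1 : ℤ) ≤ K := by exact_mod_cast hρn.trans h1
    refine (FKStrip.rpow_le_strip_HCross hx hn hnN hρ (K := K - -K) (by omega)
      (by push_cast; linarith)).trans ?_
    rw [← FKStrip.strip_HCross_congr hx (by omega) (by omega),
      ← hreal (FKStrip.HCross (-K) K (-n) (n - 1)) (FKStrip.cyl_crossed _ _ (by omega) (by omega) _ _)]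
    refine measureReal_mono fun ω hω => ?_
    exact FKStrip.crossedHorizontally_of_conn (by push_cast; linarith) (by push_cast; linarith)
      (by linarith) (by linarith) (by push_cast; linarith) (by push_cast; linarith)
      (fun e he => he.1) hω
  · -- the abscissas of the dual vertices are half-integers
    obtain ⟨K, hK⟩ : ∃ K : ℤ, K = ⌈ρ * n + 1 / 2⌉ := ⟨_, rfl⟩
    have h1 := Int.le_ceil (ρ * n + 1 / 2)
    have h2 := Int.ceil_lt_add_one (ρ * n + 1 / 2)
    rw [← hK] at h1 h2
    have hK1 : (1 : ℤ) ≤ K := by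
      have : (1 : ℝ) ≤ K := by linarith
      exact_mod_cast this
    refine (FKStrip.rpow_le_strip_HCross hx hn hnN hρ (K := K - 1 - -K) (by omega)
      (by push_cast; linarith)).trans ?_
    rw [← FKStrip.strip_HCross_congr hx (by omega) (by omega),
      ← FKStrip.strip_dual_HCross hx _ _ (by omega) (by omega),
      ← hreal _ (FKStrip.cyl_dual_HCross _ _ (by omega) (by omega))]
    refine measureReal_mono fun ω hω => ?_
    exact FKStrip.crossedHorizontally_of_conn (by push_cast; linarith) (by push_cast; linarith)
      (by push_cast; linarith) (by push_cast; linarith) (by push_cast; linarith)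
      (by push_cast; linarith)
      (fun e he => FKStrip.mem_dualConfig_of_mem_dualSet (by omega) (by omega) he) hω
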